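/- **Setting.** Let $g$ be a Lorentzian metric, of signature $(-,+,+,+)$ and with differentiable components, on an open set $D\subset\mathbb R^4$ of a coordinate patch whose coordinate $x^0$ is a time coordinate ($g^{00}<0$), and let $\nabla$ be its Levi-Civita connection. Consider differentiable fields $\mathbf U=(u^\nu,\varepsilon,n,\Pi,\pi^{\mu\nu})\in\mathbb R^{23}$ on $D$ with $u^\alpha u_\alpha=-1$, $\pi^{\mu\nu}=\pi^{\nu\mu}$, $u_\alpha\pi^{\alpha\mu}=0$, $\pi^\mu{}_\mu=0$. Let $P=P(\varepsilon,n)$ be a differentiable equation of state, and let $\tau_\Pi,\tau_\pi,\zeta,\eta,\delta_{\Pi\Pi},\lambda_{\Pi\pi},\delta_{\pi\pi},\tau_{\pi\pi},\lambda_{\pi\Pi}$ be arbitrary real functions of the fields and of the point. Put $\Delta_{\mu\nu}=g_{\mu\nu}+u_\mu u_\nu$, $\Delta^{\mu\nu}{}_{\rho\sigma}=\frac12(\Delta^\mu{}_\rho\Delta^\nu{}_\sigma+\Delta^\mu{}_\sigma\Delta^\nu{}_\rho)-\frac13\Delta^{\mu\nu}\Delta_{\rho\sigma}$, $X^{\langle\mu\nu\rangle}=\Delta^{\mu\nu}{}_{\rho\sigma}X^{\rho\sigma}$,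 $\sigma^{\mu\nu}=\Delta^{\mu\nu}{}_{\alpha\beta}\nabla^\alpha u^\beta$, $E=\varepsilon+P+\Pi$, $P_\varepsilon=\partial P/\partial\varepsilon$, $P_n=\partial P/\partial n$, $K=2\eta+\lambda_{\pi\Pi}\Pi$, $T^{\mu\nu}=\varepsilon u^\mu u^\nu+(P+\Pi)\Delta^{\mu\nu}+\pi^{\mu\nu}$ and $J^\mu=nu^\mu$. The equations of motion are $u_\alpha\nabla_\beta T^{\alpha\beta}=0$, $\Delta^\mu{}_\alpha\nabla_\beta T^{\alpha\beta}=0$, $\nabla_\alpha J^\alpha=0$, $$\tau_\Pi u^\alpha\nabla_\alpha\Pi+\Pi=-\zeta\nabla_\alpha u^\alpha-\delta_{\Pi\Pi}\Pi\nabla_\alpha u^\alpha-\lambda_{\Pi\pi}\pi^{\alpha\beta}\sigma_{\alpha\beta},$$ $$\tau_\pi\Delta^{\mu\nu}{}_{\beta\gamma}u^\alpha\nabla_\alpha\pi^{\beta\gamma}+\pi^{\mu\nu}=-2\eta\sigma^{\mu\nu}-\delta_{\pi\pi}\pi^{\mu\nu}\nabla_\alpha u^\alpha-\tau_{\pi\pi}\pi^{\alpha\langle\mu}\sigma^{\nu\rangle}{}_\alpha-\lambda_{\pi\Pi}\Pi\sigma^{\mu\nu}.$$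 The associated $23\times23$ quasilinear system $(\mathbb A^\alpha(\mathbf U)\partial_\alpha+\mathbb B)\mathbf U=0$ is obtained by inserting $u_\nu\nabla_\alpha u^\nu=0$ and $u_\mu\nabla_\alpha\pi^{\mu\nu}=-\pi^{\mu\nu}\nabla_\alpha u_\mu$. Its momentum, energy, baryon, bulk and shear rows are, up to terms without derivatives, respectively $$Eu^\alpha\nabla_\alpha u^\mu+\Delta^{\mu\alpha}(P_\varepsilon\nabla_\alpha\varepsilon+P_n\nabla_\alpha n+\nabla_\alpha\Pi)+\nabla_\alpha\pi^{\mu\alpha}-u^\mu\pi^\alpha{}_\nu\nabla_\alpha u^\nu,$$ $$u^\alpha\nabla_\alpha\varepsilon+E\nabla_\alpha u^\alpha+\pi^\alpha{}_\nu\nabla_\alpha u^\nu,\qquad u^\alpha\nabla_\alpha n+n\nabla_\alpha u^\alpha,$$ $$\tau_\Pi u^\alpha\nabla_\alpha\Pi+(\zeta+\delta_{\Pi\Pi}\Pi)\nabla_\alpha u^\alpha+\lambda_{\Pi\pi}\pi^\alpha{}_\nu\nabla_\alpha u^\nu,$$ $$\tau_\pi\big(u^\alpha\nabla_\alpha\pi^{\mu\nu}-(u^\mu\pi^\nu{}_\lambda+u^\nu\pi^\mu{}_\lambda)u^\alpha\nabla_\alpha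 u^\lambda\big)+K\tilde\sigma^{\mu\nu}+\delta_{\pi\pi}\pi^{\mu\nu}\nabla_\alpha u^\alpha+\tau_{\pi\pi}\big(\tfrac12(\pi^\mu{}_\rho\tilde\sigma^{\rho\nu}+\pi^\nu{}_\rho\tilde\sigma^{\rho\mu})-\tfrac13\Delta^{\mu\nu}\pi^\alpha{}_\lambda\nabla_\alpha u^\lambda\big),$$ where $\tilde\sigma^{\mu\nu}=\frac12(\Delta^{\mu\alpha}\nabla_\alpha u^\nu+\Delta^{\nu\alpha}\nabla_\alpha u^\mu)-\frac13\Delta^{\mu\nu}\nabla_\alpha u^\alpha$. A state is *causal* at a point if for all real $\phi_1,\phi_2,\phi_3$ every complex root $\phi_0$ of $\det(\mathbb A^\alpha\phi_\alpha)=0$ is real and satisfies $\phi^\alpha\phi_\alpha\ge0$. A solution propagates causally on a set if it is causal at each of its points. At each point let $e_0=u,e_1,e_2,e_3$ be an orthonormal basis of eigenvectors of $\pi^\mu{}_\nu$, with eigenvalues $\Lambda_0=0,\Lambda_1,\Lambda_2,\Lambda_3$. For $w=(w_1,w_2,w_3)$ put $\Lambda_w=\sum_a\Lambda_aw_a$,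 $c(w)=\big(\tfrac12K+\tfrac14\tau_{\pi\pi}\Lambda_w\big)/(\tau_\pi E)$, and let $N(w)$ be the $3\times3$ matrix $$N_{ab}=\frac{1}{E+\Lambda_a}\Big[w_b\Big(P_\varepsilon(E+\Lambda_b)+nP_n+\frac{\zeta+\delta_{\Pi\Pi}\Pi+\lambda_{\Pi\pi}\Lambda_b}{\tau_\Pi}+\frac{\frac16K+\delta_{\pi\pi}\Lambda_a-\frac1{12}\tau_{\pi\pi}(\Lambda_a+\Lambda_b)}{\tau_\pi}\Big)+\delta_{ab}\,\frac{\frac12K+\frac14\tau_{\pi\pi}(\Lambda_a+\Lambda_w)}{\tau_\pi}\Big].$$ Let $\mathcal A_2,\mathcal A_1,\mathcal A_0$ be the trace, the sum of the principal $2\times2$ minors and the determinant of $N(w)$, and $\mathcal P_3(y;w)=y^3-\mathcal A_2y^2+\mathcal A_1y-\mathcal A_0$. **Theorem.** Assume that $P$ is differentiable at the values of $(\varepsilon,n)$ that occur, and that $\tau_\Pi\ne0$, $\tau_\pi\ne0$ and $E+\Lambda_A\neq0$ for $A=0,1,2,3$ everywhere on $D$. Then: (i) At every point of $D$ the equations of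 motion hold if and only if $(\mathbb A^\alpha\partial_\alpha+\mathbb B)\mathbf U=0$ holds. (ii) For every real covector $\phi$ let $x=u^\alpha\phi_\alpha$, $v^\mu=\Delta^{\mu\alpha}\phi_\alpha$, $v^2=v^\mu v_\mu$. If $v^2\ne0$, let $v=\sqrt{v^2}$, $\hat x=x/v$, and $\hat v_a^2=(e_a\cdot v)^2/v^2$ for $a=1,2,3$. Then $$\frac{\det(\mathbb A^\alpha\phi_\alpha)}{v^{23}\prod_{k=1}^3(E+\Lambda_k)}=E\,\tau_\Pi\,\tau_\pi^{16}\,\hat x^{15}\,\big(\hat x^2-c(\hat v_a^2)\big)\,\mathcal P_3(\hat x^2;\hat v_a^2).$$ (iii) A solution of $(\mathbb A^\alpha\partial_\alpha+\mathbb B)\mathbf U=0$ on $D$ propagates causally on $D$ (or on any subset of $D$) if and only if, at each point of that set and for all $\chi^2,\kappa^2\in[0,1]$, with $w=(\hat v_1^2,\hat v_2^2,\hat v_3^2)=(\chi^2\kappa^2,\ \chi^2(1-\kappa^2),\ 1-\chi^2)$: 1. the discriminant of $\mathcal P_3(\,\cdot\,;w)$ is $\ge0$; 2. $0\le\mathcal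 A_2/3\le1$, $0\le\mathcal A_1$, $0\le\mathcal A_0$; 3. $0\le1-\mathcal A_2+\mathcal A_1-\mathcal A_0$; 4. $0\le1-\frac23\mathcal A_2+\frac13\mathcal A_1$; 5. $0\le c(w)\le1$. -/

import Mathlib

namespace IsraelStewart

/-- Coordinates `(x⁰, x¹, x², x³)` of a point of a coordinate patch of spacetime. -/
abbrev Point := Fin 4 → ℝ

/-- The 23 components of the unknown `U = (u^ν, ε, n, Π, π^{μν})`; the equations are labelled by the
same type (momentum, energy, baryon number, bulk and shear equations, in this order). -/
inductive Comp : Type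
  | vel (ν : Fin 4)
  | energy
  | baryon
  | bulk
  | shear (μ ν : Fin 4)
  deriving DecidableEq, Fintype

/-- The values of the unknown at a point. -/
abbrev State := Comp → ℝ

/-- The values of the relaxation times and of the transport coefficients. -/
structure Transport where
  /-- `τ_Π` -/
  tauBulk : ℝ
  /-- `τ_π` -/
  tauShear : ℝ
  /-- `ζ` -/
  zeta : ℝ
  /-- `η` -/
  eta : ℝ
  /-- `δ_{ΠΠ}` -/
  deltaBulk : ℝ
  /-- `λ_{Ππ}` -/
  lamBulkShear : ℝ
  /-- `δ_{ππ}` -/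
  deltaShear : ℝ
  /-- `τ_{ππ}` -/
  tauShearShear : ℝ
  /-- `λ_{πΠ}` -/
  lamShearBulk : ℝ

/-- A model: an equation of state `P = P(ε, n)`, and transport coefficients that may depend
arbitrarily on all fields and on the point (so in particular on `ε, n, Π, π_{αβ} π^{αβ}`). -/
structure Model where
  pressure : ℝ × ℝ → ℝ
  transport : Point → State → Transport

/-! ### Geometry -/

/-- The matrix `diag(-1, 1, 1, 1)`. -/
def minkowski : Matrix (Fin 4) (Fin 4) ℝ := Matrix.diagonal ![-1, 1, 1, 1]

/-- `g` is the matrix of a Lorentzian inner product of signature `(-,+,+,+)`: it is symmetric and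
has an orthonormal basis (the columns of `b`). -/
def IsLorentzian (g : Matrix (Fin 4) (Fin 4) ℝ) : Prop :=
  g.IsSymm ∧ ∃ b : Matrix (Fin 4) (Fin 4) ℝ, b.transpose * g * b = minkowski

/-- The coordinate derivative `∂_α f` at `p`. -/
noncomputable def partialD (f : Point → ℝ) (p : Point) (α : Fin 4) : ℝ :=
  fderiv ℝ f p (Pi.single α 1)

/-- The Christoffel symbols `Γ^ν_{αβ}` of the Levi-Civita connection of `g`. -/
noncomputable def christoffel (g : Point → Matrix (Fin 4) (Fin 4) ℝ) (p : Point)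
    (ν α β : Fin 4) : ℝ :=
  (1 / 2) * ∑ σ, (g p)⁻¹ ν σ *
    (partialD (fun q => g q σ β) p α + partialD (fun q => g q σ α) p β
      - partialD (fun q => g q α β) p σ)

/-- `∇_α X^ν`. -/
noncomputable def covVec (g : Point → Matrix (Fin 4) (Fin 4) ℝ) (X : Point → Fin 4 → ℝ)
    (p : Point) (α ν : Fin 4) : ℝ :=
  partialD (fun q => X q ν) p α + ∑ β, christoffel g p ν α β * X p β

/-- `∇_α S^{μν}`. -/
noncomputable def covTen (g : Point → Matrix (Fin 4) (Fin 4) ℝ)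
    (S : Point → Fin 4 → Fin 4 → ℝ) (p : Point) (α μ ν : Fin 4) : ℝ :=
  partialD (fun q => S q μ ν) p α
    + ∑ β, (christoffel g p μ α β * S p β ν + christoffel g p ν α β * S p μ β)

/-! ### Algebraic tensors built from the metric and a state at a point -/

/-- `u_ν`. -/
def velLow (g : Matrix (Fin 4) (Fin 4) ℝ) (s : State) (ν : Fin 4) : ℝ :=
  ∑ β, g ν β * s (.vel β)

/-- `π^μ_ν`. -/
def shearMix (g : Matrix (Fin 4) (Fin 4) ℝ) (s : State) (μ ν : Fin 4) : ℝ :=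
  ∑ β, s (.shear μ β) * g β ν

/-- `Δ^{μν} = g^{μν} + u^μ u^ν`. -/
noncomputable def projUp (g : Matrix (Fin 4) (Fin 4) ℝ) (s : State) (μ ν : Fin 4) : ℝ :=
  g⁻¹ μ ν + s (.vel μ) * s (.vel ν)

/-- `Δ^μ_ν = δ^μ_ν + u^μ u_ν`. -/
def projMix (g : Matrix (Fin 4) (Fin 4) ℝ) (s : State) (μ ν : Fin 4) : ℝ :=
  (1 : Matrix (Fin 4) (Fin 4) ℝ) μ ν + s (.vel μ) * velLow g s ν

/-- `Δ_{μν} = g_{μν} + u_μ u_ν`. -/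
def projLow (g : Matrix (Fin 4) (Fin 4) ℝ) (s : State) (μ ν : Fin 4) : ℝ :=
  g μ ν + velLow g s μ * velLow g s ν

/-- `Δ^{μν}_{ρσ} = (Δ^μ_ρ Δ^ν_σ + Δ^μ_σ Δ^ν_ρ) / 2 - Δ^{μν} Δ_{ρσ} / 3`. -/
noncomputable def projTraceless (g : Matrix (Fin 4) (Fin 4) ℝ) (s : State)
    (μ ν ρ σ : Fin 4) : ℝ :=
  (1 / 2) * (projMix g s μ ρ * projMix g s ν σ + projMix g s μ σ * projMix g s ν ρ)
    - (1 / 3) * projUp g s μ ν * projLow g s ρ σ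

/-- The algebraic constraints: `u^α u_α = -1`, and `π^{μν}` is symmetric, orthogonal to `u` and
traceless. -/
def Constraints (g : Matrix (Fin 4) (Fin 4) ℝ) (s : State) : Prop :=
  ∑ ν, velLow g s ν * s (.vel ν) = -1 ∧
  (∀ μ ν, s (.shear μ ν) = s (.shear ν μ)) ∧
  (∀ μ, ∑ α, velLow g s α * s (.shear α μ) = 0) ∧
  ∑ μ, shearMix g s μ μ = 0

/-- `E = ε + P + Π`. -/
def enthalpy (M : Model) (s : State) : ℝ :=
  s .energy + M.pressure (s .energy, s .baryon) + s .bulk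

/-- `∂P/∂ε`. -/
noncomputable def dPdEnergy (M : Model) (s : State) : ℝ :=
  fderiv ℝ M.pressure (s .energy, s .baryon) (1, 0)

/-- `∂P/∂n`. -/
noncomputable def dPdBaryon (M : Model) (s : State) : ℝ :=
  fderiv ℝ M.pressure (s .energy, s .baryon) (0, 1)

/-! ### The equations of motion in covariant form -/

/-- `T^{μν} = ε u^μ u^ν + (P + Π) Δ^{μν} + π^{μν}`. -/
noncomputable def stress (M : Model) (g : Point → Matrix (Fin 4) (Fin 4) ℝ) (U : Point → State)
    (p : Point) (μ ν : Fin 4) : ℝ :=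
  U p .energy * U p (.vel μ) * U p (.vel ν)
    + (M.pressure (U p .energy, U p .baryon) + U p .bulk) * projUp (g p) (U p) μ ν
    + U p (.shear μ ν)

/-- `J^μ = n u^μ`. -/
def current (U : Point → State) (p : Point) (μ : Fin 4) : ℝ :=
  U p .baryon * U p (.vel μ)

/-- `∇_α u^ν`. -/
noncomputable def gradVel (g : Point → Matrix (Fin 4) (Fin 4) ℝ) (U : Point → State)
    (p : Point) (α ν : Fin 4) : ℝ :=
  covVec g (fun q ν' => U q (.vel ν')) p α ν

/-- The expansion `∇_α u^α`. -/
noncomputable def expansion (g : Point → Matrix (Fin 4) (Fin 4) ℝ) (U : Point → State)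
    (p : Point) : ℝ :=
  ∑ α, gradVel g U p α α

/-- The shear tensor `σ^{μν} = Δ^{μν}_{αβ} ∇^α u^β`. -/
noncomputable def sigma (g : Point → Matrix (Fin 4) (Fin 4) ℝ) (U : Point → State)
    (p : Point) (μ ν : Fin 4) : ℝ :=
  ∑ α, ∑ β, projTraceless (g p) (U p) μ ν α β * ∑ γ, (g p)⁻¹ α γ * gradVel g U p γ β

/-- `σ^μ_ν`. -/
noncomputable def sigmaMix (g : Point → Matrix (Fin 4) (Fin 4) ℝ) (U : Point → State)
    (p : Point) (μ ν : Fin 4) : ℝ :=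
  ∑ β, sigma g U p μ β * g p β ν

/-- The Israel-Stewart-type equations of motion at `p`: energy, momentum and baryon number
conservation, and the relaxation equations for `Π` and `π^{μν}`. -/
def EquationsOfMotionAt (M : Model) (g : Point → Matrix (Fin 4) (Fin 4) ℝ) (U : Point → State)
    (p : Point) : Prop :=
  (∑ α, velLow (g p) (U p) α * ∑ β, covTen g (stress M g U) p β α β = 0) ∧
  (∀ μ, ∑ α, projMix (g p) (U p) μ α * ∑ β, covTen g (stress M g U) p β α β = 0) ∧
  (∑ α, covVec g (current U) p α α = 0) ∧
  ((M.transport p (U p)).tauBulk * ∑ α, U p (.vel α) * partialD (fun q => U q .bulk) p α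
      + U p .bulk
    = -(M.transport p (U p)).zeta * expansion g U p
      - (M.transport p (U p)).deltaBulk * U p .bulk * expansion g U p
      - (M.transport p (U p)).lamBulkShear *
          ∑ α, ∑ β, shearMix (g p) (U p) α β * sigmaMix g U p β α) ∧
  (∀ μ ν, (M.transport p (U p)).tauShear *
        (∑ β, ∑ γ, projTraceless (g p) (U p) μ ν β γ *
          ∑ α, U p (.vel α) * covTen g (fun q β' γ' => U q (.shear β' γ')) p α β γ)
      + U p (.shear μ ν)
    = -2 * (M.transport p (U p)).eta * sigma g U p μ ν
      - (M.transport p (U p)).deltaShear * U p (.shear μ ν) * expansion g U p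
      - (M.transport p (U p)).tauShearShear *
          (∑ β, ∑ γ, projTraceless (g p) (U p) μ ν β γ *
            ∑ α, U p (.shear α β) * sigmaMix g U p γ α)
      - (M.transport p (U p)).lamShearBulk * U p .bulk * sigma g U p μ ν)

/-! ### The first-order quasilinear system `(𝔸^α ∂_α + 𝔹) U = 0` -/

/-- The coefficient of `∇_α u^l` in `σ^{μν}`, where `u_ν ∇_α u^ν = 0` has been used to write
`σ^{μν} = (Δ^{μα} ∇_α u^ν + Δ^{να} ∇_α u^μ) / 2 - Δ^{μν} ∇_α u^α / 3`. -/
noncomputable def sigmaCoeff (g : Matrix (Fin 4) (Fin 4) ℝ) (s : State)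
    (μ ν α l : Fin 4) : ℝ :=
  (1 / 2) * (projUp g s μ α * (1 : Matrix (Fin 4) (Fin 4) ℝ) ν l
      + projUp g s ν α * (1 : Matrix (Fin 4) (Fin 4) ℝ) μ l)
    - (1 / 3) * projUp g s μ ν * (1 : Matrix (Fin 4) (Fin 4) ℝ) α l

/-- The matrices `𝔸^α(U)`. Their rows are the principal parts of the equations of motion, after the
constraints have been used in the form `u_ν ∇_α u^ν = 0` and `u_μ ∇_α π^{μν} = -π^{μν} ∇_α u_μ`:
* momentum: `E u^α ∇_α u^μ + Δ^{μα} ∇_α (P + Π) + ∇_α π^{μα} - u^μ π^α_ν ∇_α u^ν`,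
* energy: `u^α ∇_α ε + E ∇_α u^α + π^α_ν ∇_α u^ν`,
* baryon number: `u^α ∇_α n + n ∇_α u^α`,
* bulk: `τ_Π u^α ∇_α Π + (ζ + δ_{ΠΠ} Π) ∇_α u^α + λ_{Ππ} π^α_ν ∇_α u^ν`,
* shear: `τ_π (u^α ∇_α π^{μν} - (u^μ π^ν_l + u^ν π^μ_l) u^α ∇_α u^l) + (2 η + λ_{πΠ} Π) σ^{μν}
  + δ_{ππ} π^{μν} ∇_α u^α + τ_{ππ} ((π^μ_r σ^{rν} + π^ν_r σ^{rμ}) / 2 - Δ^{μν} π^α_l ∇_α u^l / 3)`. -/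
noncomputable def principal (M : Model) (g : Matrix (Fin 4) (Fin 4) ℝ) (p : Point) (s : State)
    (α : Fin 4) : Matrix Comp Comp ℝ :=
  Matrix.of fun I J => match I, J with
  | .vel μ, .vel l =>
      enthalpy M s * s (.vel α) * (1 : Matrix (Fin 4) (Fin 4) ℝ) μ l
        - s (.vel μ) * shearMix g s α l
  | .vel μ, .energy => dPdEnergy M s * projUp g s μ α
  | .vel μ, .baryon => dPdBaryon M s * projUp g s μ α
  | .vel μ, .bulk => projUp g s μ α
  | .vel μ, .shear β γ =>
      (1 : Matrix (Fin 4) (Fin 4) ℝ) μ β * (1 : Matrix (Fin 4) (Fin 4) ℝ) α γ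
  | .energy, .vel l =>
      enthalpy M s * (1 : Matrix (Fin 4) (Fin 4) ℝ) α l + shearMix g s α l
  | .energy, .energy => s (.vel α)
  | .baryon, .vel l => s .baryon * (1 : Matrix (Fin 4) (Fin 4) ℝ) α l
  | .baryon, .baryon => s (.vel α)
  | .bulk, .vel l =>
      ((M.transport p s).zeta + (M.transport p s).deltaBulk * s .bulk)
          * (1 : Matrix (Fin 4) (Fin 4) ℝ) α l
        + (M.transport p s).lamBulkShear * shearMix g s α l
  | .bulk, .bulk => (M.transport p s).tauBulk * s (.vel α)
  | .shear μ ν, .vel l =>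
      -(M.transport p s).tauShear * s (.vel α)
          * (s (.vel μ) * shearMix g s ν l + s (.vel ν) * shearMix g s μ l)
        + (2 * (M.transport p s).eta + (M.transport p s).lamShearBulk * s .bulk)
          * sigmaCoeff g s μ ν α l
        + (M.transport p s).deltaShear * s (.shear μ ν) * (1 : Matrix (Fin 4) (Fin 4) ℝ) α l
        + (M.transport p s).tauShearShear *
          ((1 / 2) * ∑ r, (shearMix g s μ r * sigmaCoeff g s r ν α l
              + shearMix g s ν r * sigmaCoeff g s r μ α l)
            - (1 / 3) * projUp g s μ ν * shearMix g s α l)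
  | .shear μ ν, .shear β γ =>
      (M.transport p s).tauShear * s (.vel α)
        * ((1 : Matrix (Fin 4) (Fin 4) ℝ) μ β * (1 : Matrix (Fin 4) (Fin 4) ℝ) ν γ)
  | _, _ => 0

/-- The matrix `C_α` with `∇_α U = ∂_α U + C_α U`, made of Christoffel symbols. -/
noncomputable def connection (g : Point → Matrix (Fin 4) (Fin 4) ℝ) (p : Point)
    (α : Fin 4) : Matrix Comp Comp ℝ :=
  Matrix.of fun I J => match I, J with
  | .vel ν, .vel β => christoffel g p ν α β
  | .shear μ ν, .shear β γ =>
      christoffel g p μ α β * (1 : Matrix (Fin 4) (Fin 4) ℝ) ν γ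
        + (1 : Matrix (Fin 4) (Fin 4) ℝ) μ β * christoffel g p ν α γ
  | _, _ => 0

/-- The matrix of the relaxation terms `Π` and `π^{μν}`. -/
def relaxation : Matrix Comp Comp ℝ :=
  Matrix.diagonal fun I => match I with
  | .bulk => 1
  | .shear _ _ => 1
  | _ => 0

/-- The matrix `𝔹` of the terms without derivatives of `U`. -/
noncomputable def lowerOrder (M : Model) (g : Point → Matrix (Fin 4) (Fin 4) ℝ) (p : Point)
    (s : State) : Matrix Comp Comp ℝ :=
  ∑ α, principal M (g p) p s α * connection g p α + relaxation

/-- `(𝔸^α ∂_α + 𝔹) U = 0` at `p`. -/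
def QuasilinearAt (M : Model) (g : Point → Matrix (Fin 4) (Fin 4) ℝ) (U : Point → State)
    (p : Point) : Prop :=
  ∑ α, (principal M (g p) p (U p) α).mulVec (fun J => partialD (fun q => U q J) p α)
    + (lowerOrder M g p (U p)).mulVec (U p) = 0

/-! ### Characteristics and causality -/

/-- The characteristic determinant `det (𝔸^α φ_α)` at a real covector. -/
noncomputable def charDet (M : Model) (g : Matrix (Fin 4) (Fin 4) ℝ) (p : Point) (s : State)
    (φ : Fin 4 → ℝ) : ℝ :=
  (∑ α, φ α • principal M g p s α).det

/-- The characteristic determinant `det (𝔸^α φ_α)` at a complex covector. -/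
noncomputable def charDetC (M : Model) (g : Matrix (Fin 4) (Fin 4) ℝ) (p : Point) (s : State)
    (φ : Fin 4 → ℂ) : ℂ :=
  (∑ α, φ α • (principal M g p s α).map (fun a => (a : ℂ))).det

/-- Causality at a point: for all real `φ_1, φ_2, φ_3`, all complex roots `φ_0` of
`det (𝔸^α φ_α) = 0` are real, and the covector `φ` is then non-timelike, `φ^α φ_α ≥ 0`. -/
def CausalAt (M : Model) (g : Matrix (Fin 4) (Fin 4) ℝ) (p : Point) (s : State) : Prop :=
  ∀ (k : Fin 3 → ℝ) (z : ℂ),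
    charDetC M g p s (Fin.cons z fun i => (k i : ℂ)) = 0 →
      z.im = 0 ∧
      0 ≤ ∑ α, ∑ β, g⁻¹ α β * (Fin.cons z.re k : Fin 4 → ℝ) α * (Fin.cons z.re k : Fin 4 → ℝ) β

/-! ### The algebraic conditions -/

/-- `e_0, e_1, e_2, e_3` is an orthonormal basis of eigenvectors of `π^μ_ν`, with `e_0 = u` and
eigenvalues `Λ_0, Λ_1, Λ_2, Λ_3`. -/
def IsEigenframe (g : Matrix (Fin 4) (Fin 4) ℝ) (s : State) (e : Fin 4 → Fin 4 → ℝ)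
    (L : Fin 4 → ℝ) : Prop :=
  (∀ μ, e 0 μ = s (.vel μ)) ∧
  (∀ A B, ∑ μ, ∑ ν, g μ ν * e A μ * e B ν = minkowski A B) ∧
  (∀ A μ, ∑ ν, shearMix g s μ ν * e A ν = L A * e A μ)

/-- `x = u^α φ_α`. -/
def freq (s : State) (φ : Fin 4 → ℝ) : ℝ := ∑ α, s (.vel α) * φ α

/-- `v^μ = Δ^{μα} φ_α`. -/
noncomputable def spatial (g : Matrix (Fin 4) (Fin 4) ℝ) (s : State) (φ : Fin 4 → ℝ)
    (μ : Fin 4) : ℝ :=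
  ∑ α, projUp g s μ α * φ α

/-- `v² = v^μ v_μ`. -/
noncomputable def spatialSq (g : Matrix (Fin 4) (Fin 4) ℝ) (s : State) (φ : Fin 4 → ℝ) : ℝ :=
  ∑ μ, ∑ ν, g μ ν * spatial g s φ μ * spatial g s φ ν

/-- The numbers `v̂_a² = (v^a)² / v²`, `a = 1, 2, 3`, where `v^a` are the components of `v^μ` in the
orthonormal basis `e`. -/
noncomputable def directionSq (g : Matrix (Fin 4) (Fin 4) ℝ) (s : State) (e : Fin 4 → Fin 4 → ℝ)
    (φ : Fin 4 → ℝ) (a : Fin 3) : ℝ :=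
  (∑ μ, ∑ ν, g μ ν * e a.succ μ * spatial g s φ ν) ^ 2 / spatialSq g s φ

/-- All values of `(v̂_1², v̂_2², v̂_3²)`, parametrized by `χ², κ² ∈ [0, 1]`. -/
def angles (chiSq kappaSq : ℝ) : Fin 3 → ℝ :=
  ![chiSq * kappaSq, chiSq * (1 - kappaSq), 1 - chiSq]

/-- `((2 η + λ_{πΠ} Π) / 2 + τ_{ππ} Λ_{v̂²} / 4) / (τ_π E)` with `Λ_{v̂²} = ∑_a Λ_a v̂_a²`, as a function
of `w_a = v̂_a²`. -/
noncomputable def shearSpeedSq (M : Model) (p : Point) (s : State) (L : Fin 4 → ℝ)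
    (w : Fin 3 → ℝ) : ℝ :=
  ((1 / 2) * (2 * (M.transport p s).eta + (M.transport p s).lamShearBulk * s .bulk)
      + (1 / 4) * (M.transport p s).tauShearShear * ∑ a : Fin 3, L a.succ * w a)
    / ((M.transport p s).tauShear * enthalpy M s)

/-- The `3 × 3` matrix whose characteristic polynomial is the cubic `P_3`, as a function of
`w_a = v̂_a²`. -/
noncomputable def cubicMatrix (M : Model) (p : Point) (s : State) (L : Fin 4 → ℝ)
    (w : Fin 3 → ℝ) : Matrix (Fin 3) (Fin 3) ℝ :=
  Matrix.of fun a b =>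
    (w b * (dPdEnergy M s * (enthalpy M s + L b.succ) + dPdBaryon M s * s .baryon
          + ((M.transport p s).zeta + (M.transport p s).deltaBulk * s .bulk
              + (M.transport p s).lamBulkShear * L b.succ) / (M.transport p s).tauBulk
          + ((1 / 6) * (2 * (M.transport p s).eta + (M.transport p s).lamShearBulk * s .bulk)
              + (M.transport p s).deltaShear * L a.succ
              - (1 / 12) * (M.transport p s).tauShearShear * (L a.succ + L b.succ))
            / (M.transport p s).tauShear)
      + (1 : Matrix (Fin 3) (Fin 3) ℝ) a b *
          (((1 / 2) * (2 * (M.transport p s).eta + (M.transport p s).lamShearBulk * s .bulk)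
              + (1 / 4) * (M.transport p s).tauShearShear
                * (L a.succ + ∑ c : Fin 3, L c.succ * w c))
            / (M.transport p s).tauShear))
    / (enthalpy M s + L a.succ)

/-- The coefficient `A_2`: the trace. -/
noncomputable def coeffA2 (M : Model) (p : Point) (s : State) (L : Fin 4 → ℝ)
    (w : Fin 3 → ℝ) : ℝ :=
  (cubicMatrix M p s L w).trace

/-- The coefficient `A_1`: the sum of the principal `2 × 2` minors. -/
noncomputable def coeffA1 (M : Model) (p : Point) (s : State) (L : Fin 4 → ℝ)
    (w : Fin 3 → ℝ) : ℝ :=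
  let N := cubicMatrix M p s L w
  (N 0 0 * N 1 1 - N 0 1 * N 1 0) + (N 0 0 * N 2 2 - N 0 2 * N 2 0)
    + (N 1 1 * N 2 2 - N 1 2 * N 2 1)

/-- The coefficient `A_0`: the determinant. -/
noncomputable def coeffA0 (M : Model) (p : Point) (s : State) (L : Fin 4 → ℝ)
    (w : Fin 3 → ℝ) : ℝ :=
  (cubicMatrix M p s L w).det

/-- The cubic `P_3(y) = y³ - A_2 y² + A_1 y - A_0` in `y = x̂²`. -/
noncomputable def cubicP3 (M : Model) (p : Point) (s : State) (L : Fin 4 → ℝ)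
    (w : Fin 3 → ℝ) : Cubic ℝ :=
  ⟨1, -coeffA2 M p s L w, coeffA1 M p s L w, -coeffA0 M p s L w⟩

/-- The five algebraic conditions, for all angles. -/
def Conditions (M : Model) (p : Point) (s : State) (L : Fin 4 → ℝ) : Prop :=
  ∀ chiSq ∈ Set.Icc (0 : ℝ) 1, ∀ kappaSq ∈ Set.Icc (0 : ℝ) 1,
    let w := angles chiSq kappaSq
    0 ≤ (cubicP3 M p s L w).discr ∧
    (0 ≤ coeffA2 M p s L w / 3 ∧ coeffA2 M p s L w / 3 ≤ 1 ∧
      0 ≤ coeffA1 M p s L w ∧ 0 ≤ coeffA0 M p s L w) ∧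
    0 ≤ 1 - coeffA2 M p s L w + coeffA1 M p s L w - coeffA0 M p s L w ∧
    0 ≤ 1 - (2 / 3) * coeffA2 M p s L w + (1 / 3) * coeffA1 M p s L w ∧
    (0 ≤ shearSpeedSq M p s L w ∧ shearSpeedSq M p s L w ≤ 1)

end IsraelStewart

open IsraelStewart

/-!
The proof has three parts.

*The characteristic determinant.* In `𝔸^α φ_α` the block of the 19 fields other than the velocity
is diagonal, with entries proportional to `x = u^α φ_α`. For `x ≠ 0` these fields are eliminated
by a Schur complement (`charDet_eq_reduced`), which leaves a `4 × 4` matrix acting on `δu`. In the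
eigenframe of `π` its `u`-row is diagonal (`IsEigenframe.sum_reducedSymbol`), which splits off the
factor `x̂² - c`; the remaining `3 × 3` block is a diagonal multiple of `x̂² - N`, except that it
has `v̂_a v̂_b` in place of `v̂_b²`, which does not affect the determinant
(`det_diagonal_sub_weighted`, `det_frameSymbol_spatial`). Along the lines `ψ + z c`, with `c` dual
to `u`, both sides of the resulting formula are polynomials in `z`, so it extends to `x = 0` and
to complex `z` (`Regular.charDetC_line`).

*Causality.* Causality says that the determinant is hyperbolic in the direction of `dx⁰` and has
no timelike real zeros (`causalAt_iff`), whereas the factorization is adapted to the direction of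
`u`. Both directions are timelike, up to a sign they are joined by timelike covectors, and by
Gårding's theorem (`HyperbolicIn.of_join`) hyperbolicity in one is hyperbolicity in the other.
Gårding's theorem is proved by moving the zeros `t` of `i ε a + s ψ + t b` in `s`: they never meet
the real axis, and at `s = 0` they lie in the lower half-plane; the limit `ε → 0` is controlled by
a lower bound for a polynomial without zeros in the upper half-plane (`norm_det_le_of_roots`). In
the direction of `u`, hyperbolicity without timelike zeros means that the roots `x̂²` of the two
nontrivial factors lie in `[0, 1]` for all directions `w`. For a real cubic that is a nonnegative
discriminant together with the signs of its coefficients as a polynomial in `y` and in `1 - y`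
(`rootsInUnit_iff`).

*Equivalence of the systems.* With metric compatibility and the Leibniz rule, the derivatives of
the constraints give `u_ν ∇_α u^ν = 0`, `u_μ ∇_α π^{μν} = -π^{μν} ∇_α u_μ` and
`g_{μν} ∇_α π^{μν} = 0`. By these identities every equation of motion equals,
up to sign, one row of the quasilinear system (`equationsOfMotionAt_iff`).
-/

namespace IsraelStewart
open Matrix

/-! ### Eigenframes of the shear stress -/

/-- The component `φ(e_A)` of a covector in a frame. -/
def frameComp (e : Fin 4 → Fin 4 → ℝ) (φ : Fin 4 → ℝ) (A : Fin 4) : ℝ := ∑ α, e A α * φ α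

/-- The matrix whose columns are the frame vectors. -/
def frameMatrix (e : Fin 4 → Fin 4 → ℝ) : Matrix (Fin 4) (Fin 4) ℝ := Matrix.of fun μ A => e A μ

lemma minkowski_mul_self : minkowski * minkowski = 1 := by
  rw [minkowski, diagonal_mul_diagonal, ← diagonal_one]
  congr 1
  ext i
  fin_cases i <;> simp

section Frame
variable {g : Matrix (Fin 4) (Fin 4) ℝ} {s : State} {e : Fin 4 → Fin 4 → ℝ} {L : Fin 4 → ℝ}

lemma IsEigenframe.gram (h : IsEigenframe g s e L) :
    (frameMatrix e)ᵀ * g * frameMatrix e = minkowski := by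
  ext A B
  rw [← h.2.1 A B]
  simp only [Matrix.mul_apply, transpose_apply, frameMatrix, of_apply, Finset.sum_mul]
  rw [Finset.sum_comm]
  refine Finset.sum_congr rfl fun μ _ => Finset.sum_congr rfl fun ν _ => by ring

lemma IsEigenframe.inv_mul (h : IsEigenframe g s e L) :
    (minkowski * (frameMatrix e)ᵀ * g) * frameMatrix e = 1 := by
  rw [Matrix.mul_assoc, Matrix.mul_assoc, ← Matrix.mul_assoc _ g, h.gram, minkowski_mul_self]

lemma IsEigenframe.det_ne_zero (h : IsEigenframe g s e L) : (frameMatrix e).det ≠ 0 := by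
  intro h0
  have := congrArg Matrix.det h.inv_mul
  rw [det_mul, h0, mul_zero, det_one] at this
  exact zero_ne_one this

lemma IsEigenframe.inv_eq (h : IsEigenframe g s e L) :
    g⁻¹ = frameMatrix e * minkowski * (frameMatrix e)ᵀ := by
  refine Matrix.inv_eq_left_inv ?_
  have := mul_eq_one_comm.mp h.inv_mul
  rw [← this]
  simp only [Matrix.mul_assoc]

lemma IsEigenframe.isUnit_det (h : IsEigenframe g s e L) : IsUnit g.det := by
  refine (Matrix.isUnit_iff_isUnit_det _).mp (IsUnit.of_mul_eq_one_right
    (frameMatrix e * minkowski * (frameMatrix e)ᵀ) ?_)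
  have := mul_eq_one_comm.mp h.inv_mul
  rw [← this]
  simp only [Matrix.mul_assoc]

lemma IsEigenframe.inv_apply (h : IsEigenframe g s e L) (μ ν : Fin 4) :
    g⁻¹ μ ν = -(e 0 μ * e 0 ν) + e 1 μ * e 1 ν + e 2 μ * e 2 ν + e 3 μ * e 3 ν := by
  rw [h.inv_eq]
  simp [Matrix.mul_apply, Fin.sum_univ_four, frameMatrix, minkowski, diagonal]

lemma IsEigenframe.projUp_apply (h : IsEigenframe g s e L) (μ ν : Fin 4) :
    projUp g s μ ν = ∑ a : Fin 3, e a.succ μ * e a.succ ν := by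
  rw [projUp, h.inv_apply, ← h.1, ← h.1, Fin.sum_univ_three]
  simp only [Fin.succ_zero_eq_one, Fin.succ_one_eq_two, Fin.reduceSucc]
  ring

lemma IsEigenframe.eigenvalue_zero (h : IsEigenframe g s e L) (hs : Constraints g s) :
    L 0 = 0 := by
  obtain ⟨h1, h2, h3, -⟩ := hs
  have key : ∀ μ, L 0 * s (.vel μ) = 0 := by
    intro μ
    rw [← h.1, ← h.2.2 0 μ, ← h3 μ]
    simp only [shearMix, velLow, h.1, Finset.sum_mul]
    rw [Finset.sum_comm]
    refine Finset.sum_congr rfl fun μ _ => Finset.sum_congr rfl fun ν _ => by rw [h2]; ring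
  by_contra h0
  have hu : ∀ μ, s (.vel μ) = 0 := fun μ => (mul_eq_zero.mp (key μ)).resolve_left h0
  simp [hu] at h1

lemma shear_eq_mul_inv (hg : IsUnit g.det) (μ ν : Fin 4) :
    s (.shear μ ν) = ∑ β, shearMix g s μ β * g⁻¹ β ν := by
  have h : (Matrix.of fun μ ν => s (.shear μ ν)) * g * g⁻¹ = Matrix.of fun μ ν => s (.shear μ ν) :=
    by rw [Matrix.mul_assoc, Matrix.mul_nonsing_inv _ hg, Matrix.mul_one]
  have := congrFun (congrFun h μ) ν
  rw [Matrix.mul_apply] at this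
  simpa [Matrix.mul_apply, shearMix] using this.symm

lemma IsEigenframe.shear_apply (h : IsEigenframe g s e L) (hs : Constraints g s) (μ ν : Fin 4) :
    s (.shear μ ν) = ∑ a : Fin 3, L a.succ * e a.succ μ * e a.succ ν := by
  have h0 := h.2.2 0 μ
  have h1 := h.2.2 1 μ
  have h2 := h.2.2 2 μ
  have h3 := h.2.2 3 μ
  rw [h.eigenvalue_zero hs] at h0
  rw [shear_eq_mul_inv (s := s) h.isUnit_det, Fin.sum_univ_three]
  simp only [h.inv_apply, Fin.sum_univ_four, Fin.succ_zero_eq_one, Fin.succ_one_eq_two,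
    Fin.reduceSucc] at *
  linear_combination -e 0 ν * h0 + e 1 ν * h1 + e 2 ν * h2 + e 3 ν * h3

lemma IsEigenframe.spatial_apply (h : IsEigenframe g s e L) (φ : Fin 4 → ℝ) (μ : Fin 4) :
    spatial g s φ μ = ∑ a : Fin 3, frameComp e φ a.succ * e a.succ μ := by
  simp only [spatial, h.projUp_apply, frameComp, Finset.sum_mul]
  rw [Finset.sum_comm]
  refine Finset.sum_congr rfl fun μ _ => Finset.sum_congr rfl fun ν _ => by ring

lemma IsEigenframe.freq_eq (h : IsEigenframe g s e L) (φ : Fin 4 → ℝ) :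
    freq s φ = frameComp e φ 0 := by
  simp only [freq, frameComp, h.1]

lemma IsEigenframe.frame_inner_spatial (h : IsEigenframe g s e L) (φ : Fin 4 → ℝ) (a : Fin 3) :
    ∑ μ, ∑ ν, g μ ν * e a.succ μ * spatial g s φ ν = frameComp e φ a.succ := by
  have : ∀ μ ν, g μ ν * e a.succ μ * spatial g s φ ν
      = ∑ b : Fin 3, frameComp e φ b.succ * (g μ ν * e a.succ μ * e b.succ ν) := by
    intro μ ν
    rw [h.spatial_apply, Finset.mul_sum]
    exact Finset.sum_congr rfl fun b _ => by ring
  simp only [this]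
  simp only [Finset.sum_comm (s := (Finset.univ : Finset (Fin 4))) (t := (Finset.univ : Finset (Fin 3))),
    ← Finset.mul_sum, h.2.1]
  fin_cases a <;> simp [Fin.sum_univ_three, minkowski, diagonal]

lemma IsEigenframe.spatialSq_eq (h : IsEigenframe g s e L) (φ : Fin 4 → ℝ) :
    spatialSq g s φ = ∑ a : Fin 3, frameComp e φ a.succ ^ 2 := by
  have : ∀ μ ν, g μ ν * spatial g s φ μ * spatial g s φ ν
      = ∑ b : Fin 3, frameComp e φ b.succ * (g μ ν * e b.succ μ * spatial g s φ ν) := by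
    intro μ ν
    conv_lhs => rw [h.spatial_apply φ μ]
    rw [Finset.mul_sum, Finset.sum_mul]
    exact Finset.sum_congr rfl fun b _ => by ring
  simp only [spatialSq, this]
  simp only [Finset.sum_comm (s := (Finset.univ : Finset (Fin 4))) (t := (Finset.univ : Finset (Fin 3))),
    ← Finset.mul_sum, h.frame_inner_spatial, sq]

lemma IsEigenframe.directionSq_eq (h : IsEigenframe g s e L) (φ : Fin 4 → ℝ) (a : Fin 3) :
    directionSq g s e φ a = frameComp e φ a.succ ^ 2 / spatialSq g s φ := by
  rw [directionSq, h.frame_inner_spatial]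

lemma IsEigenframe.inv_quadratic (h : IsEigenframe g s e L) (φ : Fin 4 → ℝ) :
    ∑ α, ∑ β, g⁻¹ α β * φ α * φ β
      = -frameComp e φ 0 ^ 2 + ∑ a : Fin 3, frameComp e φ a.succ ^ 2 := by
  simp only [h.inv_apply, frameComp, Fin.sum_univ_four, Fin.sum_univ_three,
    Fin.succ_zero_eq_one, Fin.succ_one_eq_two, Fin.reduceSucc]
  ring

/-- Every choice of frame components belongs to a covector. -/
lemma IsEigenframe.exists_covector (h : IsEigenframe g s e L) (c : Fin 4 → ℝ) :
    ∃ φ, ∀ A, frameComp e φ A = c A := by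
  have hu : IsUnit ((frameMatrix e)ᵀ).det := by
    rw [det_transpose]; exact isUnit_iff_ne_zero.mpr h.det_ne_zero
  refine ⟨((frameMatrix e)ᵀ)⁻¹ *ᵥ c, fun A => ?_⟩
  have := congrFun (Matrix.mulVec_mulVec c (frameMatrix e)ᵀ ((frameMatrix e)ᵀ)⁻¹) A
  rw [Matrix.mul_nonsing_inv _ hu, one_mulVec] at this
  rw [← this]
  simp [frameComp, Matrix.mulVec, dotProduct, frameMatrix]

end Frame
end IsraelStewart

namespace IsraelStewart
open Matrix

/-! ### Elimination of all fields except the velocity -/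

/-- The components with the velocity separated from the fields on which the principal part acts
diagonally. -/
def compEquiv : Comp ≃ Fin 4 ⊕ (Fin 3 ⊕ Fin 4 × Fin 4) where
  toFun
    | .vel ν => .inl ν
    | .energy => .inr (.inl 0)
    | .baryon => .inr (.inl 1)
    | .bulk => .inr (.inl 2)
    | .shear μ ν => .inr (.inr (μ, ν))
  invFun
    | .inl ν => .vel ν
    | .inr (.inl 0) => .energy
    | .inr (.inl 1) => .baryon
    | .inr (.inl 2) => .bulk
    | .inr (.inr (μ, ν)) => .shear μ ν
  left_inv := by rintro (_ | _) <;> rfl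
  right_inv := by
    rintro (_ | i | _)
    · rfl
    · fin_cases i <;> rfl
    · rfl

lemma sum_comp {R : Type*} [AddCommMonoid R] (f : Comp → R) :
    ∑ J, f J = ∑ ν, f (.vel ν) + (f .energy + f .baryon + f .bulk
      + ∑ μ, ∑ ν, f (.shear μ ν)) := by
  rw [← Equiv.sum_comp compEquiv.symm, Fintype.sum_sum_type, Fintype.sum_sum_type,
    Fintype.sum_prod_type, Fin.sum_univ_three]
  rfl

lemma det_fromBlocks_diagonal {m n : Type*} [Fintype m] [Fintype n] [DecidableEq m]
    [DecidableEq n] (A : Matrix m m ℝ) (B : Matrix m n ℝ) (C : Matrix n m ℝ) (d : n → ℝ)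
    (hd : ∀ i, d i ≠ 0) :
    (fromBlocks A B C (diagonal d)).det
      = (∏ i, d i) * (A - B * diagonal (fun i => (d i)⁻¹) * C).det := by
  have h : diagonal d * diagonal (fun i => (d i)⁻¹) = 1 := by
    rw [diagonal_mul_diagonal, ← diagonal_one]
    congr 1
    ext i
    exact mul_inv_cancel₀ (hd i)
  let _ : Invertible (diagonal d) := ⟨diagonal (fun i => (d i)⁻¹), mul_eq_one_comm.mp h, h⟩
  have h' : ⅟(diagonal d) = diagonal (fun i => (d i)⁻¹) := rfl
  rw [det_fromBlocks₂₂, det_diagonal, h']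

/-- The coefficient `2η + λ_{πΠ} Π`. -/
def shearCoeff (M : Model) (p : Point) (s : State) : ℝ :=
  2 * (M.transport p s).eta + (M.transport p s).lamShearBulk * s .bulk

/-- The matrix `𝔸^α φ_α`. -/
noncomputable def symbol (M : Model) (g : Matrix (Fin 4) (Fin 4) ℝ) (p : Point) (s : State)
    (φ : Fin 4 → ℝ) : Matrix Comp Comp ℝ :=
  ∑ α, φ α • principal M g p s α

/-- `(φ_α π^α_l)`. -/
def covShear (g : Matrix (Fin 4) (Fin 4) ℝ) (s : State) (φ : Fin 4 → ℝ) (l : Fin 4) : ℝ :=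
  ∑ α, φ α * shearMix g s α l

/-- `x` times the Schur complement of the velocity block of `𝔸^α φ_α`, the matrix that acts on
`δu` after all other fields have been eliminated. -/
noncomputable def reducedSymbol (M : Model) (g : Matrix (Fin 4) (Fin 4) ℝ) (p : Point) (s : State)
    (φ : Fin 4 → ℝ) : Matrix (Fin 4) (Fin 4) ℝ :=
  let t := M.transport p s
  let x := freq s φ
  let v := spatial g s φ
  let q := covShear g s φ
  let δ := (1 : Matrix (Fin 4) (Fin 4) ℝ)
  let vv := ∑ α, φ α * v α
  let qv := ∑ α, q α * v α
  Matrix.of fun μ l =>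
    enthalpy M s * x ^ 2 * δ μ l + x ^ 2 * shearMix g s μ l
    - v μ * ((dPdEnergy M s * enthalpy M s + dPdBaryon M s * s .baryon
          + (t.zeta + t.deltaBulk * s .bulk) / t.tauBulk) * φ l
        + (dPdEnergy M s + t.lamBulkShear / t.tauBulk) * q l)
    - (shearCoeff M p s * (1 / 2 * vv * δ μ l + 1 / 6 * v μ * φ l)
        + t.deltaShear * (∑ γ, s (.shear μ γ) * φ γ) * φ l
        + t.tauShearShear * (1 / 2 * (1 / 6 * (∑ r, shearMix g s μ r * v r) * φ l
              + 1 / 2 * vv * shearMix g s μ l + 1 / 2 * qv * δ μ l + 1 / 2 * v μ * q l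
              - 1 / 3 * (∑ r, projUp g s r μ * q r) * φ l)
            - 1 / 3 * v μ * q l)) / t.tauShear

variable {M : Model} {g : Matrix (Fin 4) (Fin 4) ℝ} {p : Point} {s : State} {φ : Fin 4 → ℝ}

lemma symbol_apply (I J : Comp) : symbol M g p s φ I J = ∑ α, φ α * principal M g p s α I J := by
  simp [symbol, Matrix.sum_apply]

lemma sum_mul_one_apply (f : Fin 4 → ℝ) (l : Fin 4) :
    ∑ α, f α * (1 : Matrix (Fin 4) (Fin 4) ℝ) α l = f l := by
  simp [Matrix.one_apply]

lemma sum_mul_sigmaCoeff (μ ν l : Fin 4) :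
    ∑ α, φ α * sigmaCoeff g s μ ν α l
      = 1 / 2 * (spatial g s φ μ * (1 : Matrix (Fin 4) (Fin 4) ℝ) ν l
          + spatial g s φ ν * (1 : Matrix (Fin 4) (Fin 4) ℝ) μ l)
        - 1 / 3 * projUp g s μ ν * φ l := by
  conv_rhs => rw [← sum_mul_one_apply φ l]
  simp only [sigmaCoeff, spatial, Fin.sum_univ_four]
  ring

lemma symbol_vel_vel (μ l : Fin 4) :
    symbol M g p s φ (.vel μ) (.vel l) = enthalpy M s * freq s φ *
      (1 : Matrix (Fin 4) (Fin 4) ℝ) μ l - s (.vel μ) * covShear g s φ l := by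
  simp only [symbol_apply, principal, of_apply, freq, covShear, Fin.sum_univ_four]
  ring

lemma symbol_energy_vel (l : Fin 4) :
    symbol M g p s φ .energy (.vel l) = enthalpy M s * φ l + covShear g s φ l := by
  conv_rhs => rw [← sum_mul_one_apply φ l]
  simp only [symbol_apply, principal, of_apply, covShear, Fin.sum_univ_four]
  ring

lemma symbol_baryon_vel (l : Fin 4) :
    symbol M g p s φ .baryon (.vel l) = s .baryon * φ l := by
  conv_rhs => rw [← sum_mul_one_apply φ l]
  simp only [symbol_apply, principal, of_apply, Fin.sum_univ_four]
  ring

lemma symbol_bulk_vel (l : Fin 4) :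
    symbol M g p s φ .bulk (.vel l) =
      ((M.transport p s).zeta + (M.transport p s).deltaBulk * s .bulk) * φ l
        + (M.transport p s).lamBulkShear * covShear g s φ l := by
  conv_rhs => rw [← sum_mul_one_apply φ l]
  simp only [symbol_apply, principal, of_apply, covShear, Fin.sum_univ_four]
  ring

lemma symbol_shear_vel (μ ν l : Fin 4) :
    symbol M g p s φ (.shear μ ν) (.vel l) =
      -(M.transport p s).tauShear * freq s φ
          * (s (.vel μ) * shearMix g s ν l + s (.vel ν) * shearMix g s μ l)
        + shearCoeff M p s * (∑ α, φ α * sigmaCoeff g s μ ν α l)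
        + (M.transport p s).deltaShear * s (.shear μ ν) * φ l
        + (M.transport p s).tauShearShear *
          (1 / 2 * ∑ r, (shearMix g s μ r * (∑ α, φ α * sigmaCoeff g s r ν α l)
              + shearMix g s ν r * (∑ α, φ α * sigmaCoeff g s r μ α l))
            - 1 / 3 * projUp g s μ ν * covShear g s φ l) := by
  conv_rhs => rw [← sum_mul_one_apply φ l]
  simp only [symbol_apply, principal, of_apply, covShear, freq, shearCoeff, Fin.sum_univ_four]
  ring

lemma symbol_vel_energy (μ : Fin 4) :
    symbol M g p s φ (.vel μ) .energy = dPdEnergy M s * spatial g s φ μ := by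
  simp only [symbol_apply, principal, of_apply, spatial, Fin.sum_univ_four]
  ring

lemma symbol_vel_baryon (μ : Fin 4) :
    symbol M g p s φ (.vel μ) .baryon = dPdBaryon M s * spatial g s φ μ := by
  simp only [symbol_apply, principal, of_apply, spatial, Fin.sum_univ_four]
  ring

lemma symbol_vel_bulk (μ : Fin 4) :
    symbol M g p s φ (.vel μ) .bulk = spatial g s φ μ := by
  simp only [symbol_apply, principal, of_apply, spatial, Fin.sum_univ_four]
  ring

lemma symbol_vel_shear (μ β γ : Fin 4) :
    symbol M g p s φ (.vel μ) (.shear β γ) = (1 : Matrix (Fin 4) (Fin 4) ℝ) μ β * φ γ := by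
  conv_rhs => rw [← sum_mul_one_apply φ γ]
  simp only [symbol_apply, principal, of_apply, Fin.sum_univ_four]
  ring

/-- The contraction of the shear row with `φ`, which is what the elimination of `δπ` feeds into
the momentum rows. -/
lemma sum_mul_symbol_shear_vel (μ l : Fin 4) :
    ∑ γ, φ γ * symbol M g p s φ (.shear μ γ) (.vel l) =
      -(M.transport p s).tauShear * freq s φ
          * (s (.vel μ) * covShear g s φ l + freq s φ * shearMix g s μ l)
      + (shearCoeff M p s * (1 / 2 * (∑ α, φ α * spatial g s φ α) *
            (1 : Matrix (Fin 4) (Fin 4) ℝ) μ l + 1 / 6 * spatial g s φ μ * φ l)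
        + (M.transport p s).deltaShear * (∑ γ, s (.shear μ γ) * φ γ) * φ l
        + (M.transport p s).tauShearShear * (1 / 2 *
              (1 / 6 * (∑ r, shearMix g s μ r * spatial g s φ r) * φ l
              + 1 / 2 * (∑ α, φ α * spatial g s φ α) * shearMix g s μ l
              + 1 / 2 * (∑ α, covShear g s φ α * spatial g s φ α) *
                (1 : Matrix (Fin 4) (Fin 4) ℝ) μ l
              + 1 / 2 * spatial g s φ μ * covShear g s φ l
              - 1 / 3 * (∑ r, projUp g s r μ * covShear g s φ r) * φ l)
            - 1 / 3 * spatial g s φ μ * covShear g s φ l)) := by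
  have h1 : ∀ r, ∑ γ, φ γ * ∑ α, φ α * sigmaCoeff g s r γ α l
      = 1 / 2 * (∑ α, φ α * spatial g s φ α) * (1 : Matrix (Fin 4) (Fin 4) ℝ) r l
        + 1 / 6 * spatial g s φ r * φ l := by
    intro r
    have h := sum_mul_one_apply φ l
    have h' : spatial g s φ r = ∑ γ, projUp g s r γ * φ γ := rfl
    simp only [sum_mul_sigmaCoeff]
    simp only [Fin.sum_univ_four] at *
    linear_combination 1 / 2 * spatial g s φ r * h + 1 / 3 * φ l * h'
  have h2 : ∑ γ, φ γ * ∑ r, shearMix g s μ r * ∑ α, φ α * sigmaCoeff g s r γ α l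
      = 1 / 6 * (∑ r, shearMix g s μ r * spatial g s φ r) * φ l
        + 1 / 2 * (∑ α, φ α * spatial g s φ α) * shearMix g s μ l := by
    have h : ∑ γ, φ γ * ∑ r, shearMix g s μ r * ∑ α, φ α * sigmaCoeff g s r γ α l
        = ∑ r, shearMix g s μ r * ∑ γ, φ γ * ∑ α, φ α * sigmaCoeff g s r γ α l := by
      generalize (fun r γ => ∑ α, φ α * sigmaCoeff g s r γ α l) = f
      simp only [Finset.mul_sum]
      rw [Finset.sum_comm]
      exact Finset.sum_congr rfl fun _ _ => Finset.sum_congr rfl fun _ _ =>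
        Finset.sum_congr rfl fun _ _ => by ring
    rw [h]
    simp only [h1]
    conv_rhs => rw [← sum_mul_one_apply (shearMix g s μ) l]
    simp only [Fin.sum_univ_four]
    ring
  have h3 : ∑ γ, φ γ * ∑ r, shearMix g s γ r * ∑ α, φ α * sigmaCoeff g s r μ α l
      = 1 / 2 * (∑ α, covShear g s φ α * spatial g s φ α) *
            (1 : Matrix (Fin 4) (Fin 4) ℝ) μ l
        + 1 / 2 * spatial g s φ μ * covShear g s φ l
        - 1 / 3 * (∑ r, projUp g s r μ * covShear g s φ r) * φ l := by
    have h : ∑ γ, φ γ * ∑ r, shearMix g s γ r * ∑ α, φ α * sigmaCoeff g s r μ α l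
        = ∑ r, covShear g s φ r * ∑ α, φ α * sigmaCoeff g s r μ α l := by
      simp only [covShear, Finset.sum_mul]
      rw [Finset.sum_comm]
      simp only [Finset.mul_sum]
      exact Finset.sum_congr rfl fun _ _ => Finset.sum_congr rfl fun _ _ =>
        Finset.sum_congr rfl fun _ _ => by ring
    rw [h]
    simp only [sum_mul_sigmaCoeff]
    conv_rhs => rw [← sum_mul_one_apply (covShear g s φ) l]
    simp only [Fin.sum_univ_four]
    ring
  have hsplit : ∀ (f : Fin 4 → Fin 4 → ℝ) (c x K k k' b q : ℝ), ∑ γ, φ γ *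
      (-c * x * (s (.vel μ) * shearMix g s γ l + s (.vel γ) * shearMix g s μ l)
        + K * f μ γ + k * s (.shear μ γ) * b
        + k' * (1 / 2 * ∑ r, (shearMix g s μ r * f r γ + shearMix g s γ r * f r μ)
            - 1 / 3 * projUp g s μ γ * q))
      = -c * x * (s (.vel μ) * (∑ γ, φ γ * shearMix g s γ l)
          + (∑ γ, s (.vel γ) * φ γ) * shearMix g s μ l)
        + K * (∑ γ, φ γ * f μ γ) + k * (∑ γ, s (.shear μ γ) * φ γ) * b
        + k' * (1 / 2 * (∑ γ, φ γ * ∑ r, shearMix g s μ r * f r γ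
            + ∑ γ, φ γ * ∑ r, shearMix g s γ r * f r μ)
            - 1 / 3 * (∑ γ, projUp g s μ γ * φ γ) * q) := by
    intros
    simp only [Fin.sum_univ_four]
    ring
  have h4 : ∑ γ, projUp g s μ γ * φ γ = spatial g s φ μ := rfl
  have h5 : ∑ α, φ α * shearMix g s α l = covShear g s φ l := rfl
  have h6 : ∑ α, s (.vel α) * φ α = freq s φ := rfl
  simp only [symbol_shear_vel]
  rw [hsplit (fun r γ => ∑ α, φ α * sigmaCoeff g s r γ α l), h1, h2, h3, h4, h5, h6]
  ring

lemma prod_compEquiv (x a b : ℝ) :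
    ∏ i : Fin 3 ⊕ Fin 4 × Fin 4, Sum.elim ![x, x, a * x] (fun _ => b * x) i
      = a * b ^ 16 * x ^ 19 := by
  simp [Fintype.prod_sum_type, Fin.prod_univ_three]
  ring

/-- Elimination of `δε, δn, δΠ, δπ`. -/
lemma charDet_eq_reduced (hb : (M.transport p s).tauBulk ≠ 0)
    (ht : (M.transport p s).tauShear ≠ 0) (hx : freq s φ ≠ 0) :
    charDet M g p s φ = (M.transport p s).tauBulk * (M.transport p s).tauShear ^ 16
      * freq s φ ^ 15 * (reducedSymbol M g p s φ).det := by
  have hd : ∀ i, Sum.elim ![freq s φ, freq s φ, (M.transport p s).tauBulk * freq s φ]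
      (fun _ : Fin 4 × Fin 4 => (M.transport p s).tauShear * freq s φ) i ≠ 0 := by
    rintro (i | i)
    · fin_cases i <;> simp [hx, hb]
    · simp [hx, ht]
  set A := (symbol M g p s φ).submatrix compEquiv.symm compEquiv.symm with hA
  have hblock : A.toBlocks₂₂ = diagonal (Sum.elim
      ![freq s φ, freq s φ, (M.transport p s).tauBulk * freq s φ]
      (fun _ : Fin 4 × Fin 4 => (M.transport p s).tauShear * freq s φ)) := by
    ext i j
    rcases i with i | ⟨μ, ν⟩ <;> rcases j with j | ⟨β, γ⟩
    · fin_cases i <;> fin_cases j <;>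
      simp [hA, toBlocks₂₂, symbol_apply, compEquiv, principal, freq, Finset.mul_sum, mul_comm,
        mul_left_comm, mul_assoc]
    · fin_cases i <;> simp [hA, toBlocks₂₂, symbol_apply, compEquiv, principal]
    · fin_cases j <;> simp [hA, toBlocks₂₂, symbol_apply, compEquiv, principal]
    · by_cases h1 : μ = β <;> by_cases h2 : ν = γ <;>
      simp [hA, toBlocks₂₂, symbol_apply, compEquiv, principal, freq, h1, h2, Finset.mul_sum,
        mul_comm, mul_left_comm, mul_assoc, Matrix.one_apply]
  have hS : freq s φ • (A.toBlocks₁₁ - A.toBlocks₁₂ * diagonal (fun i => (Sum.elim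
      ![freq s φ, freq s φ, (M.transport p s).tauBulk * freq s φ]
      (fun _ : Fin 4 × Fin 4 => (M.transport p s).tauShear * freq s φ) i)⁻¹) * A.toBlocks₂₁)
      = reducedSymbol M g p s φ := by
    ext μ l
    have hsh : ∀ k : ℝ, ∑ β, ∑ γ, symbol M g p s φ (.vel μ) (.shear β γ) * k
        * symbol M g p s φ (.shear β γ) (.vel l)
        = k * ∑ γ, φ γ * symbol M g p s φ (.shear μ γ) (.vel l) := by
      intro k
      rw [Finset.sum_eq_single μ]
      · rw [Finset.mul_sum]
        refine Finset.sum_congr rfl fun γ _ => ?_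
        rw [symbol_vel_shear, Matrix.one_apply_eq]
        ring
      · intro β _ hβ
        refine Finset.sum_eq_zero fun γ _ => ?_
        rw [symbol_vel_shear, Matrix.one_apply_ne hβ.symm]
        ring
      · simp
    have hexp : (A.toBlocks₁₂ * diagonal (fun i => (Sum.elim
        ![freq s φ, freq s φ, (M.transport p s).tauBulk * freq s φ]
        (fun _ : Fin 4 × Fin 4 => (M.transport p s).tauShear * freq s φ) i)⁻¹)
          * A.toBlocks₂₁) μ l
        = symbol M g p s φ (.vel μ) .energy * (freq s φ)⁻¹ * symbol M g p s φ .energy (.vel l)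
        + symbol M g p s φ (.vel μ) .baryon * (freq s φ)⁻¹ * symbol M g p s φ .baryon (.vel l)
        + symbol M g p s φ (.vel μ) .bulk * ((M.transport p s).tauBulk * freq s φ)⁻¹
          * symbol M g p s φ .bulk (.vel l)
        + ∑ β, ∑ γ, symbol M g p s φ (.vel μ) (.shear β γ)
          * ((M.transport p s).tauShear * freq s φ)⁻¹
          * symbol M g p s φ (.shear β γ) (.vel l) := by
      rw [Matrix.mul_apply]
      simp only [mul_diagonal]
      rw [Fintype.sum_sum_type, Fin.sum_univ_three, Fintype.sum_prod_type]
      rfl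
    have h11 : A.toBlocks₁₁ μ l = symbol M g p s φ (.vel μ) (.vel l) := rfl
    rw [Matrix.smul_apply, Matrix.sub_apply, hexp, hsh, sum_mul_symbol_shear_vel, h11, symbol_vel_vel,
      symbol_vel_energy, symbol_vel_baryon, symbol_vel_bulk, symbol_energy_vel, symbol_baryon_vel,
      symbol_bulk_vel]
    simp only [reducedSymbol, of_apply, smul_eq_mul]
    field_simp
    ring
  have h1 : charDet M g p s φ = A.det := by
    rw [hA, det_submatrix_equiv_self]; rfl
  rw [h1, ← fromBlocks_toBlocks A, hblock, det_fromBlocks_diagonal _ _ _ _ hd, prod_compEquiv,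
    ← hS, det_smul, Fintype.card_fin]
  ring
end IsraelStewart

namespace IsraelStewart
open Matrix

/-! ### The reduced symbol in the eigenframe -/

/-- The coefficient of `w_b` in the numerator of the entry `N_{ab}` of `cubicMatrix`. -/
noncomputable def couplingCoeff (M : Model) (p : Point) (s : State) (L : Fin 4 → ℝ)
    (A B : Fin 4) : ℝ :=
  dPdEnergy M s * (enthalpy M s + L B) + dPdBaryon M s * s .baryon
    + ((M.transport p s).zeta + (M.transport p s).deltaBulk * s .bulk
        + (M.transport p s).lamBulkShear * L B) / (M.transport p s).tauBulk
    + (1 / 6 * shearCoeff M p s + (M.transport p s).deltaShear * L A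
        - 1 / 12 * (M.transport p s).tauShearShear * (L A + L B)) / (M.transport p s).tauShear

/-- The diagonal part of the reduced symbol in the eigenframe, as a function of the eigenvalue
`Λ_A`, of `x²`, of `|v|²` and of `∑ Λ_a v_a²`. -/
noncomputable def diagonalCoeff (M : Model) (p : Point) (s : State) (l xx vv qv : ℝ) : ℝ :=
  (enthalpy M s + l) * xx - (1 / 2 * shearCoeff M p s * vv
    + 1 / 4 * (M.transport p s).tauShearShear * (l * vv + qv)) / (M.transport p s).tauShear

/-- The reduced symbol in the eigenframe, where the covector has components `f`; its first row is
diagonal because `u` is an eigenvector of `π` with eigenvalue `0`. -/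
noncomputable def frameSymbol (M : Model) (p : Point) (s : State) (L f : Fin 4 → ℝ) :
    Matrix (Fin 4) (Fin 4) ℝ :=
  Matrix.of fun A B =>
    (1 : Matrix (Fin 4) (Fin 4) ℝ) A B * diagonalCoeff M p s (L A) (f 0 ^ 2)
        (∑ a : Fin 3, f a.succ ^ 2) (∑ a : Fin 3, L a.succ * f a.succ ^ 2)
      - (if A = 0 then 0 else f A) * f B * couplingCoeff M p s L A B

variable {M : Model} {g : Matrix (Fin 4) (Fin 4) ℝ} {p : Point} {s : State} {φ : Fin 4 → ℝ}
  {e : Fin 4 → Fin 4 → ℝ} {L : Fin 4 → ℝ}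

lemma IsEigenframe.sum_covShear (h : IsEigenframe g s e L) (B : Fin 4) :
    ∑ l, covShear g s φ l * e B l = L B * frameComp e φ B := by
  simp only [covShear, frameComp, Finset.sum_mul, Finset.mul_sum]
  rw [Finset.sum_comm]
  refine Finset.sum_congr rfl fun α _ => ?_
  have := h.2.2 B α
  rw [show L B * (e B α * φ α) = φ α * (L B * e B α) by ring, ← this, Finset.mul_sum]
  exact Finset.sum_congr rfl fun _ _ => by ring

/-- `frameSymbol` is the matrix of the reduced symbol in the eigenframe. -/
lemma IsEigenframe.sum_reducedSymbol (h : IsEigenframe g s e L) (hs : Constraints g s)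
    (μ B : Fin 4) :
    ∑ l, reducedSymbol M g p s φ μ l * e B l
      = ∑ A, e A μ * frameSymbol M p s L (frameComp e φ) A B := by
  have hvv : ∑ α, φ α * spatial g s φ α = ∑ a : Fin 3, frameComp e φ a.succ ^ 2 := by
    simp only [h.spatial_apply, Finset.mul_sum]
    rw [Finset.sum_comm]
    refine Finset.sum_congr rfl fun a _ => ?_
    rw [sq]
    conv_rhs => rw [frameComp, Finset.sum_mul]
    exact Finset.sum_congr rfl fun _ _ => by rw [frameComp]; ring
  have hqv : ∑ α, covShear g s φ α * spatial g s φ α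
      = ∑ a : Fin 3, L a.succ * frameComp e φ a.succ ^ 2 := by
    simp only [h.spatial_apply, Finset.mul_sum]
    rw [Finset.sum_comm]
    refine Finset.sum_congr rfl fun a _ => ?_
    rw [sq, ← mul_assoc, ← h.sum_covShear, Finset.sum_mul]
    exact Finset.sum_congr rfl fun _ _ => by ring
  have hsv : ∑ γ, s (.shear μ γ) * φ γ
      = ∑ a : Fin 3, L a.succ * frameComp e φ a.succ * e a.succ μ := by
    simp only [h.shear_apply hs, Finset.sum_mul]
    rw [Finset.sum_comm]
    refine Finset.sum_congr rfl fun a _ => ?_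
    rw [frameComp, Finset.mul_sum, Finset.sum_mul]
    exact Finset.sum_congr rfl fun _ _ => by ring
  have hpv : ∑ r, shearMix g s μ r * spatial g s φ r
      = ∑ a : Fin 3, L a.succ * frameComp e φ a.succ * e a.succ μ := by
    simp only [h.spatial_apply, Finset.mul_sum]
    rw [Finset.sum_comm]
    refine Finset.sum_congr rfl fun a _ => ?_
    rw [mul_assoc, mul_left_comm, ← h.2.2 a.succ μ, Finset.mul_sum]
    exact Finset.sum_congr rfl fun _ _ => by ring
  have hdq : ∑ r, projUp g s r μ * covShear g s φ r
      = ∑ a : Fin 3, L a.succ * frameComp e φ a.succ * e a.succ μ := by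
    simp only [h.projUp_apply, Finset.sum_mul]
    rw [Finset.sum_comm]
    refine Finset.sum_congr rfl fun a _ => ?_
    rw [← h.sum_covShear, Finset.sum_mul]
    exact Finset.sum_congr rfl fun _ _ => by ring
  have hsplit : ∀ a b c d : ℝ, ∑ l, (a * (1 : Matrix (Fin 4) (Fin 4) ℝ) μ l
      + b * shearMix g s μ l + c * φ l + d * covShear g s φ l) * e B l
      = a * e B μ + b * (L B * e B μ) + c * frameComp e φ B + d * (L B * frameComp e φ B) := by
    intro a b c d
    rw [← h.2.2 B μ, ← h.sum_covShear, frameComp]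
    have : e B μ = ∑ l, (1 : Matrix (Fin 4) (Fin 4) ℝ) μ l * e B l := by simp [Matrix.one_apply]
    conv_rhs => rw [this]
    simp only [Finset.mul_sum, ← Finset.sum_add_distrib]
    exact Finset.sum_congr rfl fun _ _ => by ring
  have hv := h.spatial_apply φ μ
  have hcoef : ∀ l, reducedSymbol M g p s φ μ l
      = (enthalpy M s * frameComp e φ 0 ^ 2 - (1 / 2 * shearCoeff M p s *
            (∑ a : Fin 3, frameComp e φ a.succ ^ 2) + 1 / 4 * (M.transport p s).tauShearShear
            * ∑ a : Fin 3, L a.succ * frameComp e φ a.succ ^ 2) / (M.transport p s).tauShear)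
          * (1 : Matrix (Fin 4) (Fin 4) ℝ) μ l
        + (frameComp e φ 0 ^ 2 - 1 / 4 * (M.transport p s).tauShearShear
            * (∑ a : Fin 3, frameComp e φ a.succ ^ 2) / (M.transport p s).tauShear)
          * shearMix g s μ l
        + (-(spatial g s φ μ * (dPdEnergy M s * enthalpy M s + dPdBaryon M s * s .baryon
            + ((M.transport p s).zeta + (M.transport p s).deltaBulk * s .bulk)
              / (M.transport p s).tauBulk))
            - (1 / 6 * shearCoeff M p s * spatial g s φ μ
              + ((M.transport p s).deltaShear - 1 / 12 * (M.transport p s).tauShearShear)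
                * ∑ a : Fin 3, L a.succ * frameComp e φ a.succ * e a.succ μ)
              / (M.transport p s).tauShear) * φ l
        + (-(spatial g s φ μ * (dPdEnergy M s
              + (M.transport p s).lamBulkShear / (M.transport p s).tauBulk))
            + 1 / 12 * (M.transport p s).tauShearShear * spatial g s φ μ
              / (M.transport p s).tauShear) * covShear g s φ l := by
    intro l
    simp only [reducedSymbol, of_apply]
    rw [hvv, hqv, hsv, hpv, hdq, h.freq_eq]
    ring
  simp only [hcoef]
  rw [hsplit, hv]
  have hR : ∑ A, e A μ * frameSymbol M p s L (frameComp e φ) A B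
      = e B μ * diagonalCoeff M p s (L B) (frameComp e φ 0 ^ 2)
          (∑ a : Fin 3, frameComp e φ a.succ ^ 2) (∑ a : Fin 3, L a.succ * frameComp e φ a.succ ^ 2)
        - ∑ a : Fin 3, e a.succ μ * (frameComp e φ a.succ * frameComp e φ B
          * couplingCoeff M p s L a.succ B) := by
    simp only [frameSymbol, of_apply, mul_sub, Finset.sum_sub_distrib]
    congr 1
    · simp [Matrix.one_apply]
    · rw [Fin.sum_univ_succ]
      simp
  rw [hR]
  simp only [Fin.sum_univ_three, diagonalCoeff, couplingCoeff]
  ring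

lemma det_reducedSymbol (h : IsEigenframe g s e L) (hs : Constraints g s) :
    (reducedSymbol M g p s φ).det = (frameSymbol M p s L (frameComp e φ)).det := by
  have hm : reducedSymbol M g p s φ * frameMatrix e
      = frameMatrix e * frameSymbol M p s L (frameComp e φ) := by
    ext μ B
    simpa only [Matrix.mul_apply, frameMatrix, of_apply] using h.sum_reducedSymbol hs μ B
  have := congrArg Matrix.det hm
  rw [det_mul, det_mul, mul_comm] at this
  exact mul_left_cancel₀ h.det_ne_zero this

lemma det_frameSymbol (f : Fin 4 → ℝ) :
    (frameSymbol M p s L f).det = diagonalCoeff M p s (L 0) (f 0 ^ 2)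
        (∑ a : Fin 3, f a.succ ^ 2) (∑ a : Fin 3, L a.succ * f a.succ ^ 2)
      * ((frameSymbol M p s L f).submatrix Fin.succ Fin.succ).det := by
  rw [det_succ_row_zero, Finset.sum_eq_single 0]
  · simp [frameSymbol]
  · intro b _ hb
    simp [frameSymbol, Matrix.one_apply_ne hb.symm]
  · simp

/-- In each term of the determinant an index occurs as often as a row as it does as a column of `Y`,
so the weights `ξ_a ξ_b` can be replaced by `ξ_b²`, even where some `ξ_a` vanishes. -/
lemma det_diagonal_sub_weighted (d ξ : Fin 3 → ℝ) (Y : Fin 3 → Fin 3 → ℝ) :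
    (Matrix.of fun a b => (1 : Matrix (Fin 3) (Fin 3) ℝ) a b * d a - ξ a * ξ b * Y a b).det
      = (Matrix.of fun a b =>
          (1 : Matrix (Fin 3) (Fin 3) ℝ) a b * d a - ξ b ^ 2 * Y a b).det := by
  simp [det_fin_three]
  ring

lemma eval_cubicP3 (w : Fin 3 → ℝ) (y : ℝ) :
    (cubicP3 M p s L w).toPoly.eval y = (y • (1 : Matrix (Fin 3) (Fin 3) ℝ)
      - cubicMatrix M p s L w).det := by
  simp [cubicP3, Cubic.toPoly, coeffA2, coeffA1, coeffA0, det_fin_three, Matrix.trace,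
    Fin.sum_univ_three]
  ring

/-- The spatial block factors into `diag(|v|² (E + Λ_a))` and `x̂² - N`, whose determinant is the
cubic. -/
lemma det_frameSymbol_spatial (hE : ∀ A, enthalpy M s + L A ≠ 0) (f : Fin 4 → ℝ) {vv : ℝ}
    (hvv : vv = ∑ a : Fin 3, f a.succ ^ 2) (hv : vv ≠ 0) :
    ((frameSymbol M p s L f).submatrix Fin.succ Fin.succ).det
      = vv ^ 3 * (∏ k : Fin 3, (enthalpy M s + L k.succ))
        * (cubicP3 M p s L (fun a => f a.succ ^ 2 / vv)).toPoly.eval (f 0 ^ 2 / vv) := by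
  set Y : Fin 3 → Fin 3 → ℝ := fun a b => couplingCoeff M p s L a.succ b.succ
  set d : Fin 3 → ℝ := fun a => diagonalCoeff M p s (L a.succ) (f 0 ^ 2) vv
    (∑ a : Fin 3, L a.succ * f a.succ ^ 2)
  have h1 : (frameSymbol M p s L f).submatrix Fin.succ Fin.succ = Matrix.of fun a b =>
      (1 : Matrix (Fin 3) (Fin 3) ℝ) a b * d a - f a.succ * f b.succ * Y a b := by
    ext a b
    simp [frameSymbol, Matrix.one_apply, d, Y, hvv]
  have h2 : (Matrix.of fun a b =>
      (1 : Matrix (Fin 3) (Fin 3) ℝ) a b * d a - f b.succ ^ 2 * Y a b)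
      = diagonal (fun a : Fin 3 => vv * (enthalpy M s + L a.succ))
        * ((f 0 ^ 2 / vv) • (1 : Matrix (Fin 3) (Fin 3) ℝ)
          - cubicMatrix M p s L (fun a => f a.succ ^ 2 / vv)) := by
    ext a b
    have hEa := hE a.succ
    have hw : ∑ c : Fin 3, L c.succ * (f c.succ ^ 2 / vv)
        = (∑ c : Fin 3, L c.succ * f c.succ ^ 2) / vv := by
      rw [Finset.sum_div]
      exact Finset.sum_congr rfl fun _ _ => by ring
    rw [diagonal_mul]
    simp only [Matrix.sub_apply, Matrix.smul_apply, cubicMatrix, of_apply, d, Y, diagonalCoeff,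
      couplingCoeff, hw, smul_eq_mul]
    rw [shearCoeff]
    generalize (1 : Matrix (Fin 3) (Fin 3) ℝ) a b = δ
    have hcancel : ∀ V r n : ℝ, V * (enthalpy M s + L a.succ) * (r - n / (enthalpy M s + L a.succ))
        = V * ((enthalpy M s + L a.succ) * r - n) := by
      intros
      field_simp
    rw [hcancel]
    generalize (∑ c : Fin 3, L c.succ * f c.succ ^ 2) = q
    have e1 : f b.succ ^ 2 = vv * (f b.succ ^ 2 / vv) := by field_simp
    have e2 : q = vv * (q / vv) := by field_simp
    have e3 : f 0 ^ 2 = vv * (f 0 ^ 2 / vv) := by field_simp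
    generalize f b.succ ^ 2 / vv = w at *
    generalize q / vv = q' at *
    generalize f 0 ^ 2 / vv = y at *
    rw [e1, e2, e3]
    ring
  rw [h1, det_diagonal_sub_weighted d (fun a => f a.succ) Y, h2, det_mul, det_diagonal,
    ← eval_cubicP3, Finset.prod_mul_distrib]
  simp

/-- The characteristic determinant in terms of the components of `φ` in the eigenframe. -/
lemma charDet_eq (h : IsEigenframe g s e L) (hs : Constraints g s)
    (hb : (M.transport p s).tauBulk ≠ 0) (ht : (M.transport p s).tauShear ≠ 0)
    (hx : frameComp e φ 0 ≠ 0) :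
    charDet M g p s φ = (M.transport p s).tauBulk * (M.transport p s).tauShear ^ 16
      * frameComp e φ 0 ^ 15 * (diagonalCoeff M p s 0 (frameComp e φ 0 ^ 2)
        (∑ a : Fin 3, frameComp e φ a.succ ^ 2)
        (∑ a : Fin 3, L a.succ * frameComp e φ a.succ ^ 2)
      * ((frameSymbol M p s L (frameComp e φ)).submatrix Fin.succ Fin.succ).det) := by
  rw [← h.freq_eq] at hx ⊢
  rw [charDet_eq_reduced hb ht hx, det_reducedSymbol h hs, det_frameSymbol,
    h.eigenvalue_zero hs, h.freq_eq]

end IsraelStewart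

namespace IsraelStewart
open Matrix Filter Topology

/-! ### Gårding's theorem for matrix pencils -/

section Pencil
variable {ι n : Type*} [Fintype ι]

/-- The matrix `∑ φ_α A^α` at a complex covector. -/
def pencil (A : ι → Matrix n n ℝ) (φ : ι → ℂ) : Matrix n n ℂ :=
  ∑ α, φ α • (A α).map (fun a => (a : ℂ))

lemma pencil_add_smul (A : ι → Matrix n n ℝ) (φ ψ : ι → ℂ) (z : ℂ) :
    pencil A (fun i => φ i + z * ψ i) = pencil A φ + z • pencil A ψ := by
  simp only [pencil, Finset.smul_sum, ← Finset.sum_add_distrib, add_smul, smul_smul]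

lemma pencil_mul (A : ι → Matrix n n ℝ) (φ : ι → ℂ) (z : ℂ) :
    pencil A (fun i => z * φ i) = z • pencil A φ := by
  simp only [pencil, Finset.smul_sum, smul_smul]

lemma continuous_pencil (A : ι → Matrix n n ℝ) : Continuous (pencil A) :=
  continuous_finsetSum _ fun α _ => (continuous_apply α).smul continuous_const

variable [Fintype n] [DecidableEq n]

lemma pow_im_le_norm_prod (S : Multiset ℂ) (hS : ∀ r ∈ S, r.im ≤ 0) {z : ℂ} (hz : 0 ≤ z.im) :
    z.im ^ Multiset.card S ≤ ‖(S.map fun r => z - r).prod‖ := by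
  induction S using Multiset.induction_on with
  | empty => simp
  | cons r S ih =>
    rw [Multiset.map_cons, Multiset.prod_cons, norm_mul, Multiset.card_cons, pow_succ']
    have h1 : z.im ≤ ‖z - r‖ := by
      have h2 := Complex.abs_im_le_norm (z - r)
      have h3 := hS r (Multiset.mem_cons_self r S)
      rw [Complex.sub_im] at h2
      linarith [le_abs_self (z.im - r.im)]
    exact mul_le_mul h1 (ih fun r hr => hS r (Multiset.mem_cons_of_mem hr)) (by positivity)
      (norm_nonneg _)

lemma det_add_smul (C : Matrix n n ℂ) {B : Matrix n n ℂ} (hB : B.det ≠ 0) (z : ℂ) :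
    (C + z • B).det = B.det * (scalar n z - -(B⁻¹ * C)).det := by
  rw [← det_mul, mul_sub, mul_neg, ← Matrix.mul_assoc,
    Matrix.mul_nonsing_inv _ (isUnit_iff_ne_zero.mpr hB), Matrix.one_mul, sub_neg_eq_add, add_comm]
  congr 2
  ext i j
  simp [scalar_apply, mul_diagonal, mul_comm]

/-- A polynomial `z ↦ det (C + z B)` without zeros in the upper half-plane is bounded below there
in terms of its leading coefficient. -/
lemma norm_det_le_of_roots (C : Matrix n n ℂ) {B : Matrix n n ℂ} (hB : B.det ≠ 0)
    (h : ∀ z : ℂ, (C + z • B).det = 0 → z.im ≤ 0) {z : ℂ} (hz : 0 ≤ z.im) :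
    ‖B.det‖ * z.im ^ Fintype.card n ≤ ‖(C + z • B).det‖ := by
  have hev : ∀ z : ℂ, (C + z • B).det = B.det * (-(B⁻¹ * C)).charpoly.eval z := fun z => by
    rw [det_add_smul C hB, eval_charpoly]
  have hs := IsAlgClosed.splits (-(B⁻¹ * C)).charpoly
  have hroots : ∀ r ∈ (-(B⁻¹ * C)).charpoly.roots, r.im ≤ 0 := by
    intro r hr
    refine h r ?_
    rw [hev, (Polynomial.mem_roots'.mp hr).2.eq_zero, mul_zero]
  have hcard : Multiset.card (-(B⁻¹ * C)).charpoly.roots = Fintype.card n := by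
    rw [← hs.natDegree_eq_card_roots, charpoly_natDegree_eq_dim]
  have heval : (-(B⁻¹ * C)).charpoly.eval z
      = ((-(B⁻¹ * C)).charpoly.roots.map fun r => z - r).prod := by
    conv_lhs => rw [hs.eq_prod_roots_of_monic (charpoly_monic _)]
    rw [Polynomial.eval_multiset_prod, Multiset.map_map]
    simp
  rw [hev, norm_mul, heval, ← hcard]
  exact mul_le_mul_of_nonneg_left (pow_im_le_norm_prod _ hroots hz) (norm_nonneg _)

/-- Zeros are bounded by the entries of `B⁻¹ C`, by diagonal dominance. -/
lemma norm_le_of_det_eq_zero (C : Matrix n n ℂ) {B : Matrix n n ℂ} (hB : B.det ≠ 0) {z : ℂ}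
    (h : (C + z • B).det = 0) : ‖z‖ ≤ ∑ i, ∑ j, ‖(B⁻¹ * C) i j‖ := by
  by_contra! hlt
  rw [det_add_smul C hB] at h
  refine det_ne_zero_of_sum_row_lt_diag (fun k => ?_) ((mul_eq_zero.mp h).resolve_left hB)
  have h1 : ∑ j ∈ Finset.univ.erase k, ‖(scalar n z - -(B⁻¹ * C)) k j‖
      = ∑ j ∈ Finset.univ.erase k, ‖(B⁻¹ * C) k j‖ := by
    refine Finset.sum_congr rfl fun j hj => ?_
    have : k ≠ j := (Finset.ne_of_mem_erase hj).symm
    simp [diagonal_apply_ne _ this]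
  have h2 : ∑ j, ‖(B⁻¹ * C) k j‖ ≤ ∑ i, ∑ j, ‖(B⁻¹ * C) i j‖ :=
    Finset.single_le_sum (f := fun i => ∑ j, ‖(B⁻¹ * C) i j‖)
      (fun i _ => Finset.sum_nonneg fun j _ => norm_nonneg _) (Finset.mem_univ k)
  rw [← Finset.add_sum_erase _ _ (Finset.mem_univ k)] at h2
  have h3 : ‖z‖ ≤ ‖(scalar n z - -(B⁻¹ * C)) k k‖ + ‖(B⁻¹ * C) k k‖ := by
    have : z = (scalar n z - -(B⁻¹ * C)) k k - (B⁻¹ * C) k k := by simp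
    conv_lhs => rw [this]
    exact norm_sub_le _ _
  linarith

/-- The zeros of a continuous family of polynomials with constant leading coefficient cannot leave
the lower half-plane without crossing the real axis. -/
lemma det_ne_zero_of_homotopy (C : ℝ → Matrix n n ℂ) (hC : Continuous C) {B : Matrix n n ℂ}
    (hB : B.det ≠ 0) (hreal : ∀ (s t : ℝ), (C s + (t : ℂ) • B).det ≠ 0)
    (h0 : ∀ z : ℂ, 0 ≤ z.im → (C 0 + z • B).det ≠ 0) (s : ℝ) (z : ℂ) (hz : 0 ≤ z.im) :
    (C s + z • B).det ≠ 0 := by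
  set V : Set ℝ := {s | ∀ z : ℂ, 0 ≤ z.im → (C s + z • B).det ≠ 0} with hV
  have hcont : ∀ z : ℂ, Continuous fun s => (C s + z • B).det := fun z =>
    (hC.add continuous_const).matrix_det
  -- Closed: membership is equivalent to the lower bounds of `norm_det_le_of_roots`.
  have hcl : IsClosed V := by
    have : V = ⋂ (z : ℂ) (_ : 0 ≤ z.im),
        {s | ‖B.det‖ * z.im ^ Fintype.card n ≤ ‖(C s + z • B).det‖} := by
      ext s
      simp only [hV, Set.mem_ofPred_eq, Set.mem_iInter]
      constructor
      · intro h z hz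
        exact norm_det_le_of_roots _ hB (fun z hz => not_lt.mp fun hlt => h z hlt.le hz) hz
      · intro h z hz hdet
        have h1 := h z hz
        rcases hz.eq_or_lt with h2 | h2
        · refine hreal s z.re ?_
          rwa [show ((z.re : ℝ) : ℂ) = z from Complex.ext rfl (by simpa using h2)]
        · rw [hdet, norm_zero] at h1
          have : 0 < ‖B.det‖ := norm_pos_iff.mpr hB
          exact absurd h1 (not_le.mpr (by positivity))
    rw [this]
    exact isClosed_iInter fun z => isClosed_iInter fun _ =>
      isClosed_le continuous_const (hcont z).norm
  -- Open: zeros in the closed upper half-plane stay bounded and accumulate at such a zero.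
  have hop : IsOpen V := by
    rw [← isClosed_compl_iff]
    refine IsSeqClosed.isClosed fun u l hu hul => ?_
    have hu' : ∀ k, ∃ z : ℂ, 0 ≤ z.im ∧ (C (u k) + z • B).det = 0 := by
      intro k
      simpa [hV] using hu k
    choose w hw hdet using hu'
    have hR : Continuous fun s => ∑ i, ∑ j, ‖(B⁻¹ * C s) i j‖ := by
      refine continuous_finsetSum _ fun i _ => continuous_finsetSum _ fun j _ => ?_
      exact ((continuous_const.matrix_mul hC).matrix_elem i j).norm
    obtain ⟨K, hK⟩ := ((hR.tendsto l).comp hul).isBoundedUnder_le.bddAbove_range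
    have hb : ∀ k, w k ∈ Metric.closedBall (0 : ℂ) K := fun k => by
      rw [mem_closedBall_zero_iff]
      exact (norm_le_of_det_eq_zero _ hB (hdet k)).trans (hK (Set.mem_range_self k))
    obtain ⟨z, -, σ, hσ, hz⟩ := (isCompact_closedBall (0 : ℂ) K).tendsto_subseq hb
    have him : 0 ≤ z.im := ge_of_tendsto' ((Complex.continuous_im.tendsto z).comp hz)
      fun k => hw (σ k)
    have hlim : Tendsto (fun k => (C (u (σ k)) + w (σ k) • B).det) atTop
        (𝓝 (C l + z • B).det) := by
      have hc : Continuous fun q : ℝ × ℂ => (C q.1 + q.2 • B).det :=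
        ((hC.comp continuous_fst).add (continuous_snd.smul continuous_const)).matrix_det
      exact (hc.tendsto (l, z)).comp ((hul.comp hσ.tendsto_atTop).prodMk_nhds hz)
    simp only [hdet] at hlim
    intro hl
    exact hl z him (tendsto_nhds_unique hlim tendsto_const_nhds)
  have : V = Set.univ := IsClopen.eq_univ ⟨hcl, hop⟩ ⟨0, h0⟩
  exact (this ▸ Set.mem_univ s : s ∈ V) z hz

lemma pencil_det_mul (A : ι → Matrix n n ℝ) (φ : ι → ℂ) (z : ℂ) :
    (pencil A fun i => z * φ i).det = z ^ Fintype.card n * (pencil A φ).det := by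
  rw [pencil_mul, det_smul]

lemma pencil_det_conj (A : ι → Matrix n n ℝ) (φ : ι → ℂ) :
    (pencil A fun i => (starRingEnd ℂ) (φ i)).det = (starRingEnd ℂ) (pencil A φ).det := by
  rw [RingHom.map_det]
  congr 1
  ext i j
  simp [pencil, Matrix.sum_apply]

lemma pencil_det_ofReal (A : ι → Matrix n n ℝ) (φ : ι → ℝ) :
    (pencil A fun i => (φ i : ℂ)).det = ((∑ α, φ α • A α).det : ℝ) := by
  rw [← Complex.ofRealHom_eq_coe, RingHom.map_det]
  congr 1
  ext i j
  simp [pencil, Matrix.sum_apply]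

/-- Hyperbolicity of `φ ↦ det (∑ φ_α A^α)` in the direction `a`: on the lines `ψ + z a` with real
`ψ`, all zeros are real. -/
def HyperbolicIn (A : ι → Matrix n n ℝ) (a : ι → ℝ) : Prop :=
  ∀ (ψ : ι → ℝ) (z : ℂ), (pencil A fun i => (ψ i : ℂ) + z * (a i : ℂ)).det = 0 → z.im = 0

/-- Gårding's theorem: hyperbolicity passes from `a` to every direction `b` that can be joined to
`a` through covectors where the determinant does not vanish. -/
theorem HyperbolicIn.of_join {A : ι → Matrix n n ℝ} {a b : ι → ℝ} (ha : HyperbolicIn A a)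
    (hab : ∀ τ : ℝ, 0 ≤ τ → (∑ i, (a i + τ * b i) • A i).det ≠ 0)
    (hb : (∑ i, b i • A i).det ≠ 0) : HyperbolicIn A b := by
  set m := Fintype.card n
  have hB : (pencil A fun i => (b i : ℂ)).det ≠ 0 := by
    rw [pencil_det_ofReal]; exact_mod_cast hb
  -- No zeros `t` of `i ε a + s ψ + t b` in the closed upper half-plane.
  have key : ∀ (ψ : ι → ℝ) (ε : ℝ), 0 < ε → ∀ z : ℂ, 0 ≤ z.im →
      (pencil A (fun i => (ψ i : ℂ) + (ε * Complex.I) * (a i : ℂ))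
        + z • pencil A fun i => (b i : ℂ)).det ≠ 0 := by
    intro ψ ε hε z hz
    have hhom := det_ne_zero_of_homotopy
      (fun s : ℝ => pencil A (fun i => (s * ψ i : ℂ) + (ε * Complex.I) * (a i : ℂ)))
      ((continuous_pencil A).comp (by fun_prop)) hB ?_ ?_ 1 z hz
    · simpa using hhom
    · intro s t h
      rw [← pencil_add_smul] at h
      have := ha (fun i => s * ψ i + t * b i) (ε * Complex.I) (by
        rw [← h]
        congr 2
        ext i
        push_cast
        ring)
      simp at this
      exact hε.ne' this
    · intro z hz h
      -- At `s = 0` a zero is `z = i ε / ρ` with `ρ` real, and `ρ > 0` is excluded by `hab`.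
      rw [← pencil_add_smul] at h
      have hz0 : z ≠ 0 := by
        rintro rfl
        have h1 := hab 0 le_rfl
        have h2 := pencil_det_mul A (fun i => (a i : ℂ)) (ε * Complex.I)
        rw [pencil_det_ofReal] at h2
        simp only [Complex.ofReal_zero, zero_mul, zero_add, add_zero] at h h1
        rw [h] at h2
        have h3 : ((ε : ℂ) * Complex.I) ^ Fintype.card n ≠ 0 :=
          pow_ne_zero _ (mul_ne_zero (by exact_mod_cast hε.ne') Complex.I_ne_zero)
        exact h1 (by exact_mod_cast ((mul_eq_zero.mp h2.symm).resolve_left h3))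
      have h1 : (pencil A fun i => z * ((b i : ℂ) + (ε * Complex.I / z) * (a i : ℂ))).det = 0 := by
        rw [← h]
        congr 2
        ext i
        field_simp
        push_cast
        ring
      rw [pencil_det_mul] at h1
      have h2 := (mul_eq_zero.mp h1).resolve_left (pow_ne_zero _ hz0)
      have h3 := ha b _ h2
      obtain ⟨ρ, hρ⟩ : ∃ ρ : ℝ, (ρ : ℂ) = ε * Complex.I / z :=
        ⟨_, Complex.ext rfl (by simpa using h3.symm)⟩
      have hρ0 : ρ ≠ 0 := by
        rintro rfl
        have : (ε : ℂ) * Complex.I / z ≠ 0 :=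
          div_ne_zero (mul_ne_zero (by exact_mod_cast hε.ne') Complex.I_ne_zero) hz0
        exact this (by simpa using hρ.symm)
      have him : ρ * z.im = ε := by
        have h4 : (ρ : ℂ) * z = ε * Complex.I := by rw [hρ]; field_simp
        simpa using congrArg Complex.im h4
      have hρpos : 0 < ρ := by
        by_contra hneg
        nlinarith
      refine hab ρ⁻¹ (by positivity) ?_
      have h5 : (pencil A fun i => ((ρ⁻¹ : ℝ) : ℂ) * ((b i : ℂ) + ρ * (a i : ℂ))).det = 0 := by
        rw [pencil_det_mul, hρ, h2, mul_zero]
      have h6 : (fun i => ((ρ⁻¹ : ℝ) : ℂ) * ((b i : ℂ) + ρ * (a i : ℂ)))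
          = fun i => ((a i + ρ⁻¹ * b i : ℝ) : ℂ) := by
        ext i
        have : (ρ : ℂ) ≠ 0 := by exact_mod_cast hρ0
        push_cast
        field_simp
        ring
      rw [h6, pencil_det_ofReal] at h5
      exact_mod_cast h5
  -- Letting `ε → 0` preserves the lower bound in the open upper half-plane.
  have upper : ∀ (ψ : ι → ℝ) (z : ℂ), 0 < z.im →
      (pencil A fun i => (ψ i : ℂ) + z * (b i : ℂ)).det ≠ 0 := by
    intro ψ z hz h
    have hc : Continuous fun ε : ℝ => ‖(pencil A (fun i => (ψ i : ℂ) + (ε * Complex.I) * (a i : ℂ))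
        + z • pencil A fun i => (b i : ℂ)).det‖ :=
      ((((continuous_pencil A).comp (by fun_prop)).add continuous_const).matrix_det).norm
    have hlim : Tendsto (fun ε : ℝ => ‖(pencil A (fun i => (ψ i : ℂ) + (ε * Complex.I) * (a i : ℂ))
        + z • pencil A fun i => (b i : ℂ)).det‖) (𝓝[>] 0) (𝓝 0) := by
      refine ((hc.tendsto 0).mono_left nhdsWithin_le_nhds).congr' (Eventually.of_forall fun _ => rfl)
        |>.trans ?_
      rw [pencil_add_smul] at h
      simp [h]
    have hle : ‖(pencil A fun i => (b i : ℂ)).det‖ * z.im ^ m ≤ 0 :=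
      ge_of_tendsto hlim (eventually_mem_nhdsWithin.mono fun ε hε =>
        norm_det_le_of_roots _ hB
          (fun w hw => not_lt.mp fun hlt => key ψ ε hε w hlt.le hw) hz.le)
    have : 0 < ‖(pencil A fun i => (b i : ℂ)).det‖ := norm_pos_iff.mpr hB
    exact absurd hle (not_le.mpr (by positivity))
  intro ψ z h
  rcases lt_trichotomy z.im 0 with hz | hz | hz
  · refine absurd ?_ (upper ψ ((starRingEnd ℂ) z) (by simpa using hz))
    have := pencil_det_conj A fun i => (ψ i : ℂ) + z * (b i : ℂ)
    rw [h, map_zero] at this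
    simpa using this
  · exact hz
  · exact absurd h (upper ψ z hz)
end Pencil
end IsraelStewart

namespace IsraelStewart
open Matrix Filter Topology Polynomial

/-! ### Real cubics with all roots in `[0, 1]` -/

/-- All complex roots of a monic real cubic are real and lie in `[0, 1]`. -/
def RootsInUnit (A2 A1 A0 : ℝ) : Prop :=
  ∀ z : ℂ, z ^ 3 - A2 * z ^ 2 + A1 * z - A0 = 0 → z.im = 0 ∧ 0 ≤ z.re ∧ z.re ≤ 1

lemma exists_real_root (A2 A1 A0 : ℝ) : ∃ r : ℝ, r ^ 3 - A2 * r ^ 2 + A1 * r - A0 = 0 := by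
  -- The cubic changes sign on `[-B, B]`.
  set B : ℝ := 1 + |A2| + |A1| + |A0| with hB
  have hf : Continuous fun r : ℝ => r ^ 3 - A2 * r ^ 2 + A1 * r - A0 := by fun_prop
  have h2 := abs_nonneg A2
  have h1 := abs_nonneg A1
  have h0 := abs_nonneg A0
  have hB1 : 1 ≤ B := by linarith
  have hBB : B ≤ B ^ 2 := by nlinarith
  have e2 : |A2| * B ^ 2 ≥ A2 * B ^ 2 ∧ |A2| * B ^ 2 ≥ -A2 * B ^ 2 :=
    ⟨mul_le_mul_of_nonneg_right (le_abs_self _) (by positivity),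
      mul_le_mul_of_nonneg_right (neg_le_abs _) (by positivity)⟩
  have e1 : |A1| * B ^ 2 ≥ A1 * B ∧ |A1| * B ^ 2 ≥ -A1 * B :=
    ⟨by nlinarith [le_abs_self A1], by nlinarith [neg_le_abs A1]⟩
  have e0 : |A0| * B ^ 2 ≥ A0 ∧ |A0| * B ^ 2 ≥ -A0 :=
    ⟨by nlinarith [le_abs_self A0], by nlinarith [neg_le_abs A0]⟩
  have e3 : B ^ 3 = B ^ 2 + |A2| * B ^ 2 + |A1| * B ^ 2 + |A0| * B ^ 2 := by
    rw [show B ^ 3 = B * B ^ 2 by ring]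
    nth_rewrite 1 [hB]
    ring
  have hneg : (-B) ^ 3 - A2 * (-B) ^ 2 + A1 * (-B) - A0 ≤ 0 := by nlinarith [sq_nonneg B]
  have hpos : 0 ≤ B ^ 3 - A2 * B ^ 2 + A1 * B - A0 := by nlinarith [sq_nonneg B]
  obtain ⟨r, -, hr⟩ := intermediate_value_Icc (by linarith : -B ≤ B) hf.continuousOn ⟨hneg, hpos⟩
  exact ⟨r, hr⟩

lemma discr_monic (A2 A1 A0 : ℝ) : (⟨1, -A2, A1, -A0⟩ : Cubic ℝ).discr
    = A2 ^ 2 * A1 ^ 2 - 4 * A1 ^ 3 - 4 * A2 ^ 3 * A0 - 27 * A0 ^ 2 + 18 * A2 * A1 * A0 := by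
  simp only [Cubic.discr]
  ring

/-- A real cubic with nonnegative discriminant splits over the reals: with a real root `r` split
off, the discriminant is that of the quadratic cofactor times the square of its value at `r`. -/
lemma exists_three_roots {A2 A1 A0 : ℝ} (h : 0 ≤ (⟨1, -A2, A1, -A0⟩ : Cubic ℝ).discr) :
    ∃ a b c : ℝ, A2 = a + b + c ∧ A1 = a * b + a * c + b * c ∧ A0 = a * b * c := by
  obtain ⟨r, hr⟩ := exists_real_root A2 A1 A0
  have hA0 : A0 = r * (A1 - A2 * r + r ^ 2) := by linarith
  set q := (A2 - r) ^ 2 - 4 * (A1 - A2 * r + r ^ 2) with hq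
  have hd : (⟨1, -A2, A1, -A0⟩ : Cubic ℝ).discr = q * (3 * r ^ 2 - 2 * A2 * r + A1) ^ 2 := by
    rw [discr_monic, hA0, hq]
    ring
  have hq0 : 0 ≤ q := by
    by_contra! hneg
    have h1 : 3 * r ^ 2 - 2 * A2 * r + A1 ≠ 0 := by
      nlinarith [sq_nonneg (2 * r - (A2 - r))]
    rw [hd] at h
    have : 0 < (3 * r ^ 2 - 2 * A2 * r + A1) ^ 2 := by positivity
    nlinarith
  have hs := Real.sq_sqrt hq0
  refine ⟨r, ((A2 - r) + √q) / 2, ((A2 - r) - √q) / 2, by ring, ?_, ?_⟩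
  · linear_combination (-1 / 4) * hq + (1 / 4) * hs
  · rw [hA0]
    linear_combination (-1 / 4) * r * hq + (1 / 4) * r * hs

/-- For a real-rooted cubic, roots in `[0, 1]` amount to sign conditions on the coefficients in `y`
and in `1 - y`. -/
lemma rootsInUnit_iff (A2 A1 A0 : ℝ) : RootsInUnit A2 A1 A0 ↔
    0 ≤ (⟨1, -A2, A1, -A0⟩ : Cubic ℝ).discr ∧
    (0 ≤ A2 / 3 ∧ A2 / 3 ≤ 1 ∧ 0 ≤ A1 ∧ 0 ≤ A0) ∧
    0 ≤ 1 - A2 + A1 - A0 ∧ 0 ≤ 1 - (2 / 3) * A2 + (1 / 3) * A1 := by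
  constructor
  · intro h
    have hdisc : 0 ≤ (⟨1, -A2, A1, -A0⟩ : Cubic ℝ).discr := by
      obtain ⟨r, hr⟩ := exists_real_root A2 A1 A0
      have hA0 : A0 = r * (A1 - A2 * r + r ^ 2) := by linarith
      set q := (A2 - r) ^ 2 - 4 * (A1 - A2 * r + r ^ 2) with hq
      have hd : (⟨1, -A2, A1, -A0⟩ : Cubic ℝ).discr
          = q * (3 * r ^ 2 - 2 * A2 * r + A1) ^ 2 := by
        rw [discr_monic, hA0, hq]
        ring
      rw [hd]
      refine mul_nonneg ?_ (sq_nonneg _)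
      -- Otherwise the quadratic cofactor has a zero with imaginary part `√(-q) / 2`.
      by_contra! hneg
      have hs := Real.sq_sqrt (by linarith : 0 ≤ -q)
      have h0 : 0 < √(-q) := Real.sqrt_pos.mpr (by linarith)
      have h1 := (h (((A2 - r) / 2 : ℝ) + ((√(-q) / 2 : ℝ) : ℂ) * Complex.I) ?_).1
      · simp at h1
        exact h0.ne' h1
      · have hsc : ((√(-q) : ℝ) : ℂ) ^ 2 = -(((A2 - r) ^ 2 - 4 * (A1 - A2 * r + r ^ 2) : ℝ) : ℂ) := by
          rw [← hq]; exact_mod_cast hs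
        have hA0c : (A0 : ℂ) = r * (A1 - A2 * r + r ^ 2) := by exact_mod_cast hA0
        rw [hA0c]
        push_cast at hsc ⊢
        have hI := Complex.I_sq
        set S : ℂ := ((√(-q) : ℝ) : ℂ)
        set Z : ℂ := (A2 - r) / 2 + S / 2 * Complex.I with hZ
        have hquad : Z ^ 2 - (A2 - r) * Z + (A1 - A2 * r + r ^ 2) = 0 := by
          rw [hZ]
          linear_combination (1 / 4) * S ^ 2 * hI - (1 / 4) * hsc
        linear_combination (Z - r) * hquad
    obtain ⟨a, b, c, rfl, rfl, rfl⟩ := exists_three_roots hdisc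
    have hroot : ∀ r : ℝ, (r = a ∨ r = b ∨ r = c) → 0 ≤ r ∧ r ≤ 1 := by
      intro r hr
      have := (h r (by
        rcases hr with rfl | rfl | rfl <;> push_cast <;> ring)).2
      simpa using this
    obtain ⟨ha, ha'⟩ := hroot a (by simp)
    obtain ⟨hb, hb'⟩ := hroot b (by simp)
    obtain ⟨hc, hc'⟩ := hroot c (by simp)
    have hab := mul_nonneg ha hb
    have hac := mul_nonneg ha hc
    have hbc := mul_nonneg hb hc
    have hab' := mul_nonneg (sub_nonneg.mpr ha') (sub_nonneg.mpr hb')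
    have hac' := mul_nonneg (sub_nonneg.mpr ha') (sub_nonneg.mpr hc')
    have hbc' := mul_nonneg (sub_nonneg.mpr hb') (sub_nonneg.mpr hc')
    refine ⟨hdisc, ⟨by linarith, by linarith, by linarith, mul_nonneg hab hc⟩, ?_, by linarith⟩
    linarith [mul_nonneg hab' (sub_nonneg.mpr hc')]
  · rintro ⟨hdisc, ⟨h2, h2', h1, h0⟩, h3, h4⟩ z hz
    obtain ⟨a, b, c, hA2, hA1, hA0⟩ := exists_three_roots hdisc
    -- A zero outside `[0, 1]` is excluded by the signs of the coefficients in `y` and in `1 - y`.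
    have hreal : ∀ r : ℝ, r ^ 3 - A2 * r ^ 2 + A1 * r - A0 = 0 → 0 ≤ r ∧ r ≤ 1 := by
      intro r hr
      constructor
      · by_contra! hneg
        have e1 : 0 < (-r) ^ 3 := pow_pos (by linarith) 3
        have e2 : 0 ≤ A2 * r ^ 2 := mul_nonneg (by linarith) (sq_nonneg r)
        have e3 : 0 ≤ A1 * -r := mul_nonneg h1 (by linarith)
        nlinarith
      · by_contra! hgt
        have e1 : 0 < (r - 1) ^ 3 := pow_pos (by linarith) 3
        have e2 : 0 ≤ (3 - A2) * (r - 1) ^ 2 := mul_nonneg (by linarith) (sq_nonneg _)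
        have e3 : 0 ≤ (3 - 2 * A2 + A1) * (r - 1) := mul_nonneg (by linarith) (by linarith)
        nlinarith
    have hfac : (z - a) * (z - b) * (z - c) = 0 := by
      rw [← hz, hA2, hA1, hA0]
      push_cast
      ring
    have hz' : z = a ∨ z = b ∨ z = c := by
      simpa [sub_eq_zero, or_assoc] using hfac
    have hreal' : ∀ r : ℝ, (r = a ∨ r = b ∨ r = c) → 0 ≤ r ∧ r ≤ 1 := by
      intro r hr
      refine hreal r ?_
      rw [hA2, hA1, hA0]
      rcases hr with rfl | rfl | rfl <;> ring
    rcases hz' with rfl | rfl | rfl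
    · exact ⟨by simp, by simpa using hreal' a (by simp)⟩
    · exact ⟨by simp, by simpa using hreal' b (by simp)⟩
    · exact ⟨by simp, by simpa using hreal' c (by simp)⟩
end IsraelStewart

namespace IsraelStewart
open Matrix Filter Topology Polynomial

/-! ### The characteristic determinant as a product -/

variable {M : Model} {g : Matrix (Fin 4) (Fin 4) ℝ} {p : Point} {s : State} {φ : Fin 4 → ℝ}
  {e : Fin 4 → Fin 4 → ℝ} {L : Fin 4 → ℝ}

/-- `|v|²` in terms of the components of a covector. -/
def spaceSq (f : Fin 4 → ℝ) : ℝ := ∑ a : Fin 3, f a.succ ^ 2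

/-- The squared direction cosines `v̂_a²`, with the junk value `0` for `v = 0`. -/
noncomputable def cosSq (f : Fin 4 → ℝ) (a : Fin 3) : ℝ := f a.succ ^ 2 / spaceSq f

lemma spaceSq_nonneg (f : Fin 4 → ℝ) : 0 ≤ spaceSq f :=
  Finset.sum_nonneg fun _ _ => sq_nonneg _

lemma frameComp_add_mul (e : Fin 4 → Fin 4 → ℝ) (φ ψ : Fin 4 → ℝ) (t : ℝ) (A : Fin 4) :
    frameComp e (fun i => φ i + t * ψ i) A = frameComp e φ A + t * frameComp e ψ A := by
  simp only [frameComp, Fin.sum_univ_four]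
  ring

lemma diagonalCoeff_zero (hE : enthalpy M s ≠ 0) (f : Fin 4 → ℝ) (hv : spaceSq f ≠ 0) :
    diagonalCoeff M p s 0 (f 0 ^ 2) (spaceSq f) (∑ a : Fin 3, L a.succ * f a.succ ^ 2)
      = enthalpy M s * spaceSq f
        * (f 0 ^ 2 / spaceSq f - shearSpeedSq M p s L (cosSq f)) := by
  have hw : ∑ c : Fin 3, L c.succ * cosSq f c
      = (∑ c : Fin 3, L c.succ * f c.succ ^ 2) / spaceSq f := by
    rw [Finset.sum_div]
    exact Finset.sum_congr rfl fun _ _ => by rw [cosSq]; ring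
  simp only [diagonalCoeff, shearSpeedSq, hw, shearCoeff]
  -- For `τ_π = 0` the viscous terms on both sides are quotients by zero and vanish.
  by_cases ht : (M.transport p s).tauShear = 0
  · simp only [ht, div_zero, zero_mul]
    field_simp
    ring
  · field_simp
    ring

/-- An eigenframe and the nondegeneracy assumptions at a point, under which the characteristic
determinant factorizes. -/
structure Regular (M : Model) (g : Matrix (Fin 4) (Fin 4) ℝ) (p : Point) (s : State)
    (e : Fin 4 → Fin 4 → ℝ) (L : Fin 4 → ℝ) : Prop where
  frame : IsEigenframe g s e L
  constr : Constraints g s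
  tauBulk_ne : (M.transport p s).tauBulk ≠ 0
  tauShear_ne : (M.transport p s).tauShear ≠ 0
  enthalpy_add_ne : ∀ A, enthalpy M s + L A ≠ 0

lemma Regular.enthalpy_ne (h : Regular M g p s e L) : enthalpy M s ≠ 0 := by
  have := h.enthalpy_add_ne 0
  rwa [h.frame.eigenvalue_zero h.constr, add_zero] at this

/-- The constant factor of the characteristic determinant. -/
noncomputable def leadingCoeff (M : Model) (p : Point) (s : State) (L : Fin 4 → ℝ) (vv : ℝ) : ℝ :=
  enthalpy M s * (M.transport p s).tauBulk * (M.transport p s).tauShear ^ 16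
    * (∏ k : Fin 3, (enthalpy M s + L k.succ)) * vv ^ 4

lemma Regular.leadingCoeff_ne (h : Regular M g p s e L) {vv : ℝ} (hv : vv ≠ 0) :
    leadingCoeff M p s L vv ≠ 0 :=
  mul_ne_zero (mul_ne_zero (mul_ne_zero (mul_ne_zero h.enthalpy_ne h.tauBulk_ne)
    (pow_ne_zero _ h.tauShear_ne)) (Finset.prod_ne_zero_iff.mpr fun _ _ => h.enthalpy_add_ne _))
    (pow_ne_zero _ hv)

lemma Regular.charDet_of_freq_ne (h : Regular M g p s e L) (hx : frameComp e φ 0 ≠ 0)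
    (hv : spaceSq (frameComp e φ) ≠ 0) :
    charDet M g p s φ = leadingCoeff M p s L (spaceSq (frameComp e φ)) * frameComp e φ 0 ^ 15
      * (frameComp e φ 0 ^ 2 / spaceSq (frameComp e φ)
          - shearSpeedSq M p s L (cosSq (frameComp e φ)))
      * (cubicP3 M p s L (cosSq (frameComp e φ))).toPoly.eval
          (frameComp e φ 0 ^ 2 / spaceSq (frameComp e φ)) := by
  rw [charDet_eq h.frame h.constr h.tauBulk_ne h.tauShear_ne hx,
    det_frameSymbol_spatial h.enthalpy_add_ne (frameComp e φ) rfl hv]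
  change _ * (diagonalCoeff M p s 0 _ (spaceSq (frameComp e φ)) _ * (spaceSq (frameComp e φ) ^ 3
    * _ * (cubicP3 M p s L (cosSq (frameComp e φ))).toPoly.eval
      (frameComp e φ 0 ^ 2 / spaceSq (frameComp e φ)))) = _
  rw [diagonalCoeff_zero h.enthalpy_ne _ hv, leadingCoeff]
  ring

/-- Covectors proportional to `u` are not characteristic. -/
lemma Regular.charDet_ne_of_spaceSq_eq_zero (h : Regular M g p s e L)
    (hx : frameComp e φ 0 ≠ 0) (hv : spaceSq (frameComp e φ) = 0) : charDet M g p s φ ≠ 0 := by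
  have h0 : ∀ a : Fin 3, frameComp e φ a.succ = 0 := fun a => by
    have := (Finset.sum_eq_zero_iff_of_nonneg fun _ _ => sq_nonneg _).mp hv a (Finset.mem_univ a)
    exact pow_eq_zero_iff (two_ne_zero) |>.mp this
  have hsub : (frameSymbol M p s L (frameComp e φ)).submatrix Fin.succ Fin.succ
      = diagonal fun a : Fin 3 => (enthalpy M s + L a.succ) * frameComp e φ 0 ^ 2 := by
    ext a b
    simp [frameSymbol, h0, diagonalCoeff, Matrix.one_apply, diagonal_apply]
  rw [charDet_eq h.frame h.constr h.tauBulk_ne h.tauShear_ne hx, hsub, det_diagonal]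
  simp only [h0, diagonalCoeff]
  have hp : (∏ i : Fin 3, (enthalpy M s + L i.succ) * frameComp e φ 0 ^ 2) ≠ 0 :=
    Finset.prod_ne_zero_iff.mpr fun k _ => mul_ne_zero (h.enthalpy_add_ne _) (pow_ne_zero _ hx)
  refine mul_ne_zero (mul_ne_zero (mul_ne_zero h.tauBulk_ne (pow_ne_zero _ h.tauShear_ne))
    (pow_ne_zero _ hx)) (mul_ne_zero ?_ hp)
  simpa using ⟨h.enthalpy_ne, hx⟩

/-- The characteristic determinant on the complex line `ψ + z c`, where `c` is the covector dual to
`u` in the frame. It follows from the real formula because both sides are polynomials in `z`. -/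
lemma Regular.charDetC_line (h : Regular M g p s e L) {ψ c : Fin 4 → ℝ}
    (hc : ∀ A, frameComp e c A = (Pi.single 0 1 : Fin 4 → ℝ) A)
    (hv : spaceSq (frameComp e ψ) ≠ 0) (z : ℂ) :
    charDetC M g p s (fun i => (ψ i : ℂ) + z * (c i : ℂ))
      = leadingCoeff M p s L (spaceSq (frameComp e ψ)) * (frameComp e ψ 0 + z) ^ 15
        * ((frameComp e ψ 0 + z) ^ 2 / spaceSq (frameComp e ψ)
            - shearSpeedSq M p s L (cosSq (frameComp e ψ)))
        * (((frameComp e ψ 0 + z) ^ 2 / spaceSq (frameComp e ψ)) ^ 3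
          - coeffA2 M p s L (cosSq (frameComp e ψ))
            * ((frameComp e ψ 0 + z) ^ 2 / spaceSq (frameComp e ψ)) ^ 2
          + coeffA1 M p s L (cosSq (frameComp e ψ))
            * ((frameComp e ψ 0 + z) ^ 2 / spaceSq (frameComp e ψ))
          - coeffA0 M p s L (cosSq (frameComp e ψ))) := by
  set f := frameComp e ψ with hf
  set Y : ℝ[X] := C (spaceSq f)⁻¹ * (C (f 0) + X) ^ 2 with hY
  have hpoly : (∑ α, (C (ψ α) + C (c α) * X) • (principal M g p s α).map (C : ℝ →+* ℝ[X])).det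
      = C (leadingCoeff M p s L (spaceSq f)) * (C (f 0) + X) ^ 15
        * (Y - C (shearSpeedSq M p s L (cosSq f)))
        * (Y ^ 3 - C (coeffA2 M p s L (cosSq f)) * Y ^ 2
          + C (coeffA1 M p s L (cosSq f)) * Y - C (coeffA0 M p s L (cosSq f))) := by
    refine Polynomial.eq_of_infinite_eval_eq _ _ ((Set.finite_singleton (-f 0)).infinite_compl.mono
      fun t ht => ?_)
    have hfc : ∀ A, frameComp e (fun i => ψ i + t * c i) A
        = f A + t * (Pi.single 0 1 : Fin 4 → ℝ) A := fun A => by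
      rw [frameComp_add_mul, hc]
    have hs : ∀ a : Fin 3, frameComp e (fun i => ψ i + t * c i) a.succ = f a.succ := fun a => by
      rw [hfc]; simp
    have h0 : frameComp e (fun i => ψ i + t * c i) 0 = f 0 + t := by rw [hfc]; simp
    have hsp : spaceSq (frameComp e fun i => ψ i + t * c i) = spaceSq f := by
      simp only [spaceSq, hs]
    have hcos : cosSq (frameComp e fun i => ψ i + t * c i) = cosSq f := by
      ext a; simp only [cosSq, hs, hsp]
    have hx : frameComp e (fun i => ψ i + t * c i) 0 ≠ 0 := by
      rw [h0]
      intro h1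
      exact ht (by rw [Set.mem_singleton_iff]; linarith)
    have key := h.charDet_of_freq_ne hx (by rwa [hsp])
    rw [hsp, hcos, h0] at key
    have hl : (∑ α, (C (ψ α) + C (c α) * X) • (principal M g p s α).map (C : ℝ →+* ℝ[X])).det.eval t
        = charDet M g p s fun i => ψ i + t * c i := by
      rw [charDet, ← coe_evalRingHom, RingHom.map_det]
      congr 1
      ext i j
      simp [Matrix.sum_apply]
      exact Finset.sum_congr rfl fun _ _ => by ring
    simp only [Set.mem_ofPred_eq]
    rw [hl, key, hY]
    simp [cubicP3, Cubic.toPoly]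
    ring
  have hev := congrArg (Polynomial.eval₂RingHom Complex.ofRealHom z) hpoly
  rw [RingHom.map_det] at hev
  have hl : charDetC M g p s (fun i => (ψ i : ℂ) + z * (c i : ℂ))
      = ((Polynomial.eval₂RingHom Complex.ofRealHom z).mapMatrix
        (∑ α, (C (ψ α) + C (c α) * X) • (principal M g p s α).map (C : ℝ →+* ℝ[X]))).det := by
    rw [charDetC]
    congr 1
    ext i j
    simp [Matrix.sum_apply]
    exact Finset.sum_congr rfl fun _ _ => by ring
  rw [hl, hev, hY]
  simp only [map_mul, map_add, map_sub, map_pow, coe_eval₂RingHom, eval₂_C, eval₂_X,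
    Complex.ofRealHom_eq_coe, Complex.ofReal_inv]
  ring

/-- The characteristic determinant at a real covector with `v² ≠ 0`. -/
lemma Regular.charDet_eq_mul (h : Regular M g p s e L) (hv : spaceSq (frameComp e φ) ≠ 0) :
    charDet M g p s φ = leadingCoeff M p s L (spaceSq (frameComp e φ)) * frameComp e φ 0 ^ 15
      * (frameComp e φ 0 ^ 2 / spaceSq (frameComp e φ)
          - shearSpeedSq M p s L (cosSq (frameComp e φ)))
      * (cubicP3 M p s L (cosSq (frameComp e φ))).toPoly.eval
          (frameComp e φ 0 ^ 2 / spaceSq (frameComp e φ)) := by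
  -- The formula on the line at `z = 0` also covers `x = 0`.
  obtain ⟨c, hc⟩ := h.frame.exists_covector (Pi.single 0 1)
  have h0 := h.charDetC_line hc hv 0
  have h1 := pencil_det_ofReal (principal M g p s) φ
  have h2 : charDetC M g p s (fun i => (φ i : ℂ) + 0 * (c i : ℂ)) = (charDet M g p s φ : ℝ) := by
    rw [charDet, ← h1]
    simp [charDetC, pencil]
  rw [h2] at h0
  have h3 : (cubicP3 M p s L (cosSq (frameComp e φ))).toPoly.eval
      (frameComp e φ 0 ^ 2 / spaceSq (frameComp e φ))
      = (frameComp e φ 0 ^ 2 / spaceSq (frameComp e φ)) ^ 3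
        - coeffA2 M p s L (cosSq (frameComp e φ))
          * (frameComp e φ 0 ^ 2 / spaceSq (frameComp e φ)) ^ 2
        + coeffA1 M p s L (cosSq (frameComp e φ))
          * (frameComp e φ 0 ^ 2 / spaceSq (frameComp e φ))
        - coeffA0 M p s L (cosSq (frameComp e φ)) := by
    simp [cubicP3, Cubic.toPoly]
    ring
  rw [h3]
  rw [add_zero] at h0
  exact_mod_cast h0

/-! ### Causality -/

/-- `φ^α φ_α`. -/
noncomputable def normSq (g : Matrix (Fin 4) (Fin 4) ℝ) (φ : Fin 4 → ℝ) : ℝ :=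
  ∑ α, ∑ β, g⁻¹ α β * φ α * φ β

lemma IsEigenframe.normSq_eq (h : IsEigenframe g s e L) (φ : Fin 4 → ℝ) :
    normSq g φ = -frameComp e φ 0 ^ 2 + spaceSq (frameComp e φ) := h.inv_quadratic φ

/-- The characteristic determinant has no timelike real zeros. -/
def NoTimelikeZeros (M : Model) (g : Matrix (Fin 4) (Fin 4) ℝ) (p : Point) (s : State) : Prop :=
  ∀ φ, normSq g φ < 0 → charDet M g p s φ ≠ 0

lemma charDetC_ofReal (φ : Fin 4 → ℝ) :
    charDetC M g p s (fun i => (φ i : ℂ)) = (charDet M g p s φ : ℝ) :=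
  pencil_det_ofReal (principal M g p s) φ

/-- Causality is hyperbolicity in the direction of `dx⁰` together with the absence of timelike
zeros. -/
lemma causalAt_iff : CausalAt M g p s ↔
    HyperbolicIn (principal M g p s) (Pi.single 0 1) ∧ NoTimelikeZeros M g p s := by
  have hcons : ∀ (ψ : Fin 4 → ℝ) (z : ℂ),
      (Fin.cons ((ψ 0 : ℂ) + z) fun i : Fin 3 => (ψ i.succ : ℂ) : Fin 4 → ℂ)
        = fun i => (ψ i : ℂ) + z * ((Pi.single 0 1 : Fin 4 → ℝ) i : ℂ) := by
    intro ψ z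
    ext i
    refine Fin.cases ?_ (fun j => ?_) i
    · simp
    · simp
  constructor
  · intro h
    refine ⟨fun ψ z hz => ?_, fun φ hφ h0 => ?_⟩
    · have := (h (fun i => ψ i.succ) (ψ 0 + z) (by rw [hcons]; exact hz)).1
      simpa using this
    · have h1 : (Fin.cons ((φ 0 : ℝ) : ℂ) fun i : Fin 3 => (φ i.succ : ℂ) : Fin 4 → ℂ)
          = fun i => (φ i : ℂ) := by
        simpa using hcons φ 0
      have h2 := (h (fun i => φ i.succ) (φ 0 : ℝ) (by
        rw [h1, charDetC_ofReal, h0, Complex.ofReal_zero])).2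
      have h3 : (Fin.cons ((φ 0 : ℝ) : ℂ).re fun i : Fin 3 => φ i.succ : Fin 4 → ℝ) = φ :=
        Fin.cons_self_tail φ
      rw [h3] at h2
      exact absurd hφ (not_lt.mpr h2)
  · rintro ⟨hyp, hN⟩ k z hz
    have him : z.im = 0 := by
      have h1 := hcons (Fin.cons 0 k) z
      simp only [Fin.cons_zero, Fin.cons_succ, Complex.ofReal_zero, zero_add] at h1
      refine hyp (Fin.cons 0 k) z ?_
      rw [h1] at hz
      exact hz
    refine ⟨him, ?_⟩
    by_contra! hlt
    refine hN _ hlt ?_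
    have h1 : (Fin.cons z fun i : Fin 3 => (k i : ℂ) : Fin 4 → ℂ)
        = fun i => ((Fin.cons z.re k : Fin 4 → ℝ) i : ℂ) := by
      ext i
      refine Fin.cases ?_ (fun j => ?_) i
      · exact Complex.ext rfl (by simpa using him)
      · simp
    rw [h1, charDetC_ofReal] at hz
    exact_mod_cast hz

lemma HyperbolicIn.neg {A : Fin 4 → Matrix Comp Comp ℝ} {a : Fin 4 → ℝ} (h : HyperbolicIn A a) :
    HyperbolicIn A fun i => -a i := by
  intro ψ z hz
  have := h ψ (-z) (by
    rw [← hz]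
    congr 2
    ext i
    push_cast
    ring)
  simpa using this

/-- Without timelike zeros, hyperbolicity in the direction of the fluid velocity and in that of
`dx⁰` are equivalent. -/
lemma Regular.hyperbolicIn_iff (h : Regular M g p s e L) (ht : g⁻¹ 0 0 < 0)
    (hN : NoTimelikeZeros M g p s) {c : Fin 4 → ℝ}
    (hc : ∀ A, frameComp e c A = (Pi.single 0 1 : Fin 4 → ℝ) A) :
    HyperbolicIn (principal M g p s) (Pi.single 0 1) ↔ HyperbolicIn (principal M g p s) c := by
  have hc0 : frameComp e c 0 = 1 := by rw [hc]; simp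
  have hcs : ∀ a : Fin 3, frameComp e c a.succ = 0 := fun a => by rw [hc]; simp
  have hcc : normSq g c < 0 := by
    rw [h.frame.normSq_eq, spaceSq]
    simp [hc0, hcs]
  -- Two covectors in the same half of the light cone are joined by timelike covectors.
  have join : ∀ b, normSq g b < 0 → 0 < frameComp e b 0 →
      (HyperbolicIn (principal M g p s) b ↔ HyperbolicIn (principal M g p s) c) := by
    intro b hb hb0
    have hb' := hb
    rw [h.frame.normSq_eq] at hb'
    constructor
    · refine fun hyp => hyp.of_join (fun τ hτ => hN _ ?_) (hN c hcc)
      have hs : ∀ a : Fin 3, frameComp e (fun i => b i + τ * c i) a.succ = frameComp e b a.succ :=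
        fun a => by rw [frameComp_add_mul, hcs]; ring
      rw [h.frame.normSq_eq, spaceSq]
      simp only [hs]
      rw [← spaceSq, frameComp_add_mul, hc0]
      nlinarith [mul_nonneg hτ hb0.le, sq_nonneg τ]
    · refine fun hyp => hyp.of_join (fun τ hτ => hN _ ?_) (hN b hb)
      have hs : ∀ a : Fin 3, frameComp e (fun i => c i + τ * b i) a.succ
          = τ * frameComp e b a.succ := fun a => by rw [frameComp_add_mul, hcs]; ring
      rw [h.frame.normSq_eq, spaceSq]
      simp only [hs, mul_pow]
      rw [← Finset.mul_sum, ← spaceSq, frameComp_add_mul, hc0]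
      nlinarith [mul_nonneg hτ hb0.le, mul_nonneg (sq_nonneg τ) (neg_nonneg.mpr hb'.le)]
  have hn : normSq g (Pi.single 0 1) < 0 := by
    rw [normSq, Finset.sum_eq_single 0, Finset.sum_eq_single 0]
    · simpa using ht
    · intro β _ hβ; simp [hβ]
    · simp
    · intro α _ hα; simp [hα]
    · simp
  have hne : frameComp e (Pi.single 0 1) 0 ≠ 0 := by
    intro h0
    rw [h.frame.normSq_eq, h0] at hn
    linarith [spaceSq_nonneg (frameComp e (Pi.single 0 1))]
  rcases lt_or_gt_of_ne hne with hneg | hpos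
  · have hcomp : ∀ A, frameComp e (fun i => -(Pi.single 0 1 : Fin 4 → ℝ) i) A
        = -frameComp e (Pi.single 0 1) A := fun A => by simp [frameComp, Finset.sum_neg_distrib]
    rw [← join (fun i => -(Pi.single 0 1 : Fin 4 → ℝ) i) (by simpa [normSq] using hn)
      (by rw [hcomp]; linarith)]
    exact ⟨fun h => h.neg, fun h => by simpa using h.neg⟩
  · exact join _ hn hpos

lemma exists_angles {w : Fin 3 → ℝ} (hw : ∀ a, 0 ≤ w a) (hsum : ∑ a, w a = 1) :
    ∃ χ ∈ Set.Icc (0 : ℝ) 1, ∃ κ ∈ Set.Icc (0 : ℝ) 1, angles χ κ = w := by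
  rw [Fin.sum_univ_three] at hsum
  have h0 := hw 0
  have h1 := hw 1
  have h2 := hw 2
  -- If `w 0 + w 1 = 0` then the quotient takes the junk value `0`, which is admissible.
  refine ⟨w 0 + w 1, ⟨by linarith, by linarith⟩, w 0 / (w 0 + w 1),
    ⟨by positivity, div_le_one_of_le₀ (by linarith) (by linarith)⟩, ?_⟩
  have hm : (w 0 + w 1) * (w 0 / (w 0 + w 1)) = w 0 := by
    by_cases h : w 0 + w 1 = 0
    · rw [h, zero_mul]; linarith
    · field_simp
  ext i
  fin_cases i
  · simpa [angles] using hm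
  · simp [angles, mul_sub, hm]
  · simp [angles]; linarith

lemma angles_nonneg {χ κ : ℝ} (hχ : χ ∈ Set.Icc (0 : ℝ) 1) (hκ : κ ∈ Set.Icc (0 : ℝ) 1)
    (a : Fin 3) : 0 ≤ angles χ κ a := by
  fin_cases a
  · exact mul_nonneg hχ.1 hκ.1
  · exact mul_nonneg hχ.1 (sub_nonneg.mpr hκ.2)
  · exact sub_nonneg.mpr hχ.2

lemma sum_angles (χ κ : ℝ) : ∑ a, angles χ κ a = 1 := by
  simp [angles, Fin.sum_univ_three]
  ring

/-- The conditions say that, for all directions, the roots of the two nontrivial factors of the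
characteristic determinant are real and in `[0, 1]`. -/
lemma conditions_iff : Conditions M p s L ↔ ∀ w : Fin 3 → ℝ, (∀ a, 0 ≤ w a) → ∑ a, w a = 1 →
    RootsInUnit (coeffA2 M p s L w) (coeffA1 M p s L w) (coeffA0 M p s L w) ∧
      0 ≤ shearSpeedSq M p s L w ∧ shearSpeedSq M p s L w ≤ 1 := by
  constructor
  · intro h w hw hsum
    obtain ⟨χ, hχ, κ, hκ, rfl⟩ := exists_angles hw hsum
    obtain ⟨h1, h2, h3, h4, h5⟩ := h χ hχ κ hκ
    exact ⟨(rootsInUnit_iff _ _ _).mpr ⟨h1, h2, h3, h4⟩, h5⟩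
  · intro h χ hχ κ hκ
    obtain ⟨h1, h5⟩ := h _ (angles_nonneg hχ hκ) (sum_angles χ κ)
    obtain ⟨h1, h2, h3, h4⟩ := (rootsInUnit_iff _ _ _).mp h1
    exact ⟨h1, h2, h3, h4, h5⟩

lemma im_eq_zero_of_sq {z : ℂ} (him : (z ^ 2).im = 0) (hre : 0 ≤ (z ^ 2).re) : z.im = 0 := by
  simp only [sq, Complex.mul_im, Complex.mul_re] at him hre
  by_contra h
  have h1 : z.re = 0 := by
    have : z.re * z.im = 0 := by linarith
    exact (mul_eq_zero.mp this).resolve_right h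
  rw [h1] at hre
  nlinarith [mul_self_pos.mpr h]

/-- The conditions at `w` follow from the line through the unit spatial covector with components
`√(w_a)`. -/
lemma Regular.conditions_of_hyperbolic (h : Regular M g p s e L) {c : Fin 4 → ℝ}
    (hc : ∀ A, frameComp e c A = (Pi.single 0 1 : Fin 4 → ℝ) A)
    (hyp : HyperbolicIn (principal M g p s) c) (hN : NoTimelikeZeros M g p s) :
    Conditions M p s L := by
  rw [conditions_iff]
  intro w hw hsum
  obtain ⟨ψ, hψ⟩ := h.frame.exists_covector (Fin.cons 0 fun a => √(w a))
  have hψ0 : frameComp e ψ 0 = 0 := by rw [hψ]; simp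
  have hψa : ∀ a : Fin 3, frameComp e ψ a.succ ^ 2 = w a := fun a => by
    rw [hψ, Fin.cons_succ, Real.sq_sqrt (hw a)]
  have hv : spaceSq (frameComp e ψ) = 1 := by simp only [spaceSq, hψa, hsum]
  have hcos : cosSq (frameComp e ψ) = w := by
    ext a; rw [cosSq, hv, hψa, div_one]
  have key : ∀ z : ℂ, (z ^ 2 - shearSpeedSq M p s L w) * ((z ^ 2) ^ 3
      - coeffA2 M p s L w * (z ^ 2) ^ 2 + coeffA1 M p s L w * z ^ 2 - coeffA0 M p s L w) = 0 →
      (z ^ 2).im = 0 ∧ 0 ≤ (z ^ 2).re ∧ (z ^ 2).re ≤ 1 := by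
    intro z hz
    have hline := h.charDetC_line hc (ψ := ψ) (by rw [hv]; exact one_ne_zero) z
    rw [hv, hcos, hψ0] at hline
    simp only [Complex.ofReal_one, Complex.ofReal_zero, zero_add, div_one] at hline
    rw [mul_assoc, hz, mul_zero] at hline
    have him : z.im = 0 := hyp ψ z hline
    have hzr : z = (z.re : ℂ) := Complex.ext rfl (by simpa using him)
    have hre : (z ^ 2).re = z.re ^ 2 := by rw [sq, Complex.mul_re, him]; ring
    refine ⟨by rw [sq, Complex.mul_im, him]; ring, by rw [hre]; positivity, ?_⟩
    by_contra! hgt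
    rw [hre] at hgt
    refine hN (fun i => ψ i + z.re * c i) ?_ ?_
    · have hs : ∀ a : Fin 3, frameComp e (fun i => ψ i + z.re * c i) a.succ
          = frameComp e ψ a.succ := fun a => by rw [frameComp_add_mul, hc]; simp
      have h0 : frameComp e (fun i => ψ i + z.re * c i) 0 = z.re := by
        rw [frameComp_add_mul, hc, hψ0]; simp
      rw [h.frame.normSq_eq, spaceSq, h0]
      simp only [hs]
      rw [← spaceSq, hv]
      linarith
    · have h1 := charDetC_ofReal (M := M) (g := g) (p := p) (s := s) fun i => ψ i + z.re * c i
      rw [hzr] at hline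
      push_cast at h1
      rw [hline] at h1
      exact_mod_cast h1.symm
  refine ⟨fun y hy => ?_, ?_⟩
  · obtain ⟨z, rfl⟩ := IsAlgClosed.exists_pow_nat_eq y two_pos
    exact key z (by rw [hy, mul_zero])
  · obtain ⟨z, hz⟩ := IsAlgClosed.exists_pow_nat_eq (shearSpeedSq M p s L w : ℂ) two_pos
    have := (key z (by rw [hz, sub_self, zero_mul])).2
    simpa [hz] using this

lemma sum_cosSq {f : Fin 4 → ℝ} (hv : spaceSq f ≠ 0) : ∑ a, cosSq f a = 1 := by
  simp only [cosSq]
  rw [← Finset.sum_div]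
  exact div_self hv

lemma cosSq_nonneg (f : Fin 4 → ℝ) (a : Fin 3) : 0 ≤ cosSq f a :=
  div_nonneg (sq_nonneg _) (spaceSq_nonneg f)

lemma Regular.noTimelikeZeros (h : Regular M g p s e L) (hcond : Conditions M p s L) :
    NoTimelikeZeros M g p s := by
  intro φ hφ h0
  rw [h.frame.normSq_eq] at hφ
  by_cases hv : spaceSq (frameComp e φ) = 0
  · refine h.charDet_ne_of_spaceSq_eq_zero (fun hx => ?_) hv h0
    rw [hx, hv] at hφ
    norm_num at hφ
  have hvpos : 0 < spaceSq (frameComp e φ) := lt_of_le_of_ne (spaceSq_nonneg _) (Ne.symm hv)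
  obtain ⟨hr, -, hc⟩ := conditions_iff.mp hcond _ (cosSq_nonneg (frameComp e φ)) (sum_cosSq hv)
  have hy : 1 < frameComp e φ 0 ^ 2 / spaceSq (frameComp e φ) := by
    rw [one_lt_div hvpos]; linarith
  rw [h.charDet_eq_mul hv] at h0
  rcases mul_eq_zero.mp h0 with h1 | h1
  · rcases mul_eq_zero.mp h1 with h2 | h2
    · rcases mul_eq_zero.mp h2 with h3 | h3
      · exact h.leadingCoeff_ne hv h3
      · have : frameComp e φ 0 = 0 := pow_eq_zero_iff (by norm_num) |>.mp h3
        rw [this] at hφ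
        linarith [spaceSq_nonneg (frameComp e φ)]
    · linarith
  · generalize frameComp e φ 0 ^ 2 / spaceSq (frameComp e φ) = y at *
    have h2 := (hr (y : ℂ) (by
      have h3 : y ^ 3 - coeffA2 M p s L (cosSq (frameComp e φ)) * y ^ 2
          + coeffA1 M p s L (cosSq (frameComp e φ)) * y
          - coeffA0 M p s L (cosSq (frameComp e φ)) = 0 := by
        rw [← h1]
        simp [cubicP3, Cubic.toPoly]
        ring
      exact_mod_cast h3)).2.2
    rw [Complex.ofReal_re] at h2
    linarith

lemma Regular.hyperbolicIn_velocity (h : Regular M g p s e L) (hcond : Conditions M p s L)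
    {c : Fin 4 → ℝ} (hc : ∀ A, frameComp e c A = (Pi.single 0 1 : Fin 4 → ℝ) A) :
    HyperbolicIn (principal M g p s) c := by
  intro ψ z hz
  by_cases hv : spaceSq (frameComp e ψ) = 0
  -- Then `ψ` is a multiple of `c`, and the only zero on the line is the origin.
  · have hψ : ψ = fun i => frameComp e ψ 0 * c i := by
      have hcomp : ∀ A, frameComp e (fun i => ψ i + -frameComp e ψ 0 * c i) A = 0 := by
        intro A
        rw [frameComp_add_mul, hc]
        refine Fin.cases ?_ (fun a => ?_) A
        · simp
        · have := (Finset.sum_eq_zero_iff_of_nonneg fun _ _ => sq_nonneg _).mp hv a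
            (Finset.mem_univ a)
          have := pow_eq_zero_iff (two_ne_zero) |>.mp this
          simp [this]
      have h1 : (frameMatrix e)ᵀ *ᵥ (fun i => ψ i + -frameComp e ψ 0 * c i) = 0 := by
        ext A
        simpa [frameComp, Matrix.mulVec, dotProduct, frameMatrix] using hcomp A
      have h2 := Matrix.eq_zero_of_mulVec_eq_zero
        (by rw [det_transpose]; exact h.frame.det_ne_zero) h1
      ext i
      have := congrFun h2 i
      simp only [Pi.zero_apply] at this
      linarith
    have h3 : (fun i => (ψ i : ℂ) + z * (c i : ℂ))
        = fun i => ((frameComp e ψ 0 : ℂ) + z) * (c i : ℂ) := by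
      ext i
      conv_lhs => rw [hψ]
      push_cast
      ring
    rw [h3, pencil_det_mul, pencil_det_ofReal] at hz
    have hcne : charDet M g p s c ≠ 0 := by
      refine h.charDet_ne_of_spaceSq_eq_zero (by rw [hc]; simp) ?_
      simp [spaceSq, hc]
    have h4 := (mul_eq_zero.mp hz).resolve_right (by exact_mod_cast hcne)
    have h5 := congrArg Complex.im (pow_eq_zero_iff (by
      exact Fintype.card_pos_iff.mpr ⟨Comp.energy⟩ |>.ne') |>.mp h4)
    simpa using h5
  · have hvpos : 0 < spaceSq (frameComp e ψ) := lt_of_le_of_ne (spaceSq_nonneg _) (Ne.symm hv)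
    obtain ⟨hr, hc0, -⟩ := conditions_iff.mp hcond _ (cosSq_nonneg (frameComp e ψ)) (sum_cosSq hv)
    have hline := h.charDetC_line hc hv z
    rw [show charDetC M g p s (fun i => (ψ i : ℂ) + z * (c i : ℂ)) = 0 from hz] at hline
    set x : ℂ := frameComp e ψ 0 + z with hx
    have him : x.im = z.im := by simp [hx]
    rw [← him]
    have hsq : ∀ y : ℂ, x ^ 2 / spaceSq (frameComp e ψ) = y → y.im = 0 → 0 ≤ y.re →
        x.im = 0 := by
      intro y hy hyim hyre
      have hxy : x ^ 2 = ((spaceSq (frameComp e ψ) : ℝ) : ℂ) * y := by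
        have hvc : ((spaceSq (frameComp e ψ) : ℝ) : ℂ) ≠ 0 := by exact_mod_cast hv
        rw [← hy]
        field_simp
      refine im_eq_zero_of_sq ?_ ?_
      · rw [hxy, Complex.mul_im, hyim]
        simp
      · rw [hxy]
        simpa using mul_nonneg hvpos.le hyre
    rcases mul_eq_zero.mp hline.symm with h1 | h1
    · rcases mul_eq_zero.mp h1 with h2 | h2
      · rcases mul_eq_zero.mp h2 with h3 | h3
        · exact absurd h3 (by exact_mod_cast h.leadingCoeff_ne hv)
        · rw [pow_eq_zero_iff (by norm_num)] at h3
          rw [h3, Complex.zero_im]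
      · exact hsq _ (sub_eq_zero.mp h2) (Complex.ofReal_im _) hc0
    · obtain ⟨h2, h3, -⟩ := hr _ h1
      exact hsq _ rfl h2 h3

/-- Causality at a point is equivalent to the algebraic conditions. -/
theorem Regular.causalAt_iff_conditions (h : Regular M g p s e L) (ht : g⁻¹ 0 0 < 0) :
    CausalAt M g p s ↔ Conditions M p s L := by
  obtain ⟨c, hc⟩ := h.frame.exists_covector (Pi.single 0 1)
  rw [causalAt_iff]
  constructor
  · rintro ⟨hyp, hN⟩
    exact h.conditions_of_hyperbolic hc ((h.hyperbolicIn_iff ht hN hc).mp hyp) hN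
  · intro hcond
    have hN := h.noTimelikeZeros hcond
    exact ⟨(h.hyperbolicIn_iff ht hN hc).mpr (h.hyperbolicIn_velocity hcond hc), hN⟩

end IsraelStewart

namespace IsraelStewart
open Matrix Filter Topology

/-! ### Coordinate derivatives -/

section Calculus
variable {f f' : Point → ℝ} {p : Point} {α : Fin 4}

lemma partialD_add (hf : DifferentiableAt ℝ f p) (hf' : DifferentiableAt ℝ f' p) :
    partialD (fun q => f q + f' q) p α = partialD f p α + partialD f' p α := by
  simp only [partialD]
  rw [fderiv_fun_add hf hf']
  rfl

lemma partialD_mul (hf : DifferentiableAt ℝ f p) (hf' : DifferentiableAt ℝ f' p) :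
    partialD (fun q => f q * f' q) p α = partialD f p α * f' p + f p * partialD f' p α := by
  simp only [partialD]
  rw [fderiv_fun_mul hf hf']
  simp
  ring

lemma partialD_sum {ι : Type*} {s : Finset ι} {F : ι → Point → ℝ}
    (hF : ∀ i ∈ s, DifferentiableAt ℝ (F i) p) :
    partialD (fun q => ∑ i ∈ s, F i q) p α = ∑ i ∈ s, partialD (F i) p α := by
  simp only [partialD]
  rw [fderiv_fun_sum hF]
  simp

lemma partialD_congr (h : f =ᶠ[𝓝 p] f') : partialD f p α = partialD f' p α := by
  simp only [partialD]
  rw [h.fderiv_eq]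

lemma partialD_const (c : ℝ) : partialD (fun _ => c) p α = 0 := by
  simp [partialD]

variable {m n k : Type*}

/-- The entrywise coordinate derivative of a matrix-valued function. -/
noncomputable def matD (F : Point → Matrix m n ℝ) (p : Point) (α : Fin 4) : Matrix m n ℝ :=
  Matrix.of fun i j => partialD (fun q => F q i j) p α

/-- Entrywise differentiability of a matrix-valued function. -/
def MatDiff (F : Point → Matrix m n ℝ) (p : Point) : Prop :=
  ∀ i j, DifferentiableAt ℝ (fun q => F q i j) p

lemma matD_congr {F K : Point → Matrix m n ℝ} (h : F =ᶠ[𝓝 p] K) : matD F p α = matD K p α := by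
  ext i j
  exact partialD_congr (h.mono fun q hq => by simp only [hq])

lemma matD_const (K : Matrix m n ℝ) : matD (fun _ => K) p α = 0 := by
  ext i j
  exact partialD_const _

lemma matD_transpose (F : Point → Matrix m n ℝ) :
    matD (fun q => (F q)ᵀ) p α = (matD F p α)ᵀ := rfl

lemma MatDiff.transpose {F : Point → Matrix m n ℝ} (h : MatDiff F p) :
    MatDiff (fun q => (F q)ᵀ) p := fun i j => h j i

lemma MatDiff.mul [Fintype n] {F : Point → Matrix m n ℝ} {K : Point → Matrix n k ℝ}
    (hF : MatDiff F p) (hK : MatDiff K p) : MatDiff (fun q => F q * K q) p := by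
  intro i j
  simp only [Matrix.mul_apply]
  exact DifferentiableAt.fun_sum fun l _ => (hF i l).mul (hK l j)

lemma matD_mul [Fintype n] {F : Point → Matrix m n ℝ} {K : Point → Matrix n k ℝ}
    (hF : MatDiff F p) (hK : MatDiff K p) :
    matD (fun q => F q * K q) p α = matD F p α * K p + F p * matD K p α := by
  ext i j
  have hsum := partialD_sum (α := α) (s := Finset.univ) (F := fun l q => F q i l * K q l j)
    fun l _ => (hF i l).fun_mul (hK l j)
  simp only [matD, of_apply, Matrix.add_apply, Matrix.mul_apply]
  rw [hsum, ← Finset.sum_add_distrib]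
  exact Finset.sum_congr rfl fun l _ => partialD_mul (hF i l) (hK l j)

lemma MatDiff.det [Fintype n] [DecidableEq n] {F : Point → Matrix n n ℝ} (hF : MatDiff F p) :
    DifferentiableAt ℝ (fun q => (F q).det) p := by
  simp only [det_apply']
  refine DifferentiableAt.fun_sum fun σ _ => (differentiableAt_const _).mul ?_
  have := (HasFDerivAt.finsetProd (u := Finset.univ) (g := fun i q => F q (σ i) i)
    fun i _ => (hF (σ i) i).hasFDerivAt).differentiableAt
  simpa only [Finset.prod_apply] using this

lemma MatDiff.inv [Fintype n] [DecidableEq n] {F : Point → Matrix n n ℝ} (hF : MatDiff F p)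
    (hu : IsUnit (F p).det) : MatDiff (fun q => (F q)⁻¹) p := by
  intro i j
  simp only [Matrix.inv_def, Ring.inverse_eq_inv', Matrix.smul_apply, smul_eq_mul, adjugate_apply]
  refine (hF.det.inv hu.ne_zero).mul (MatDiff.det fun a b => ?_)
  by_cases h : a = j
  · subst h
    simp
  · simpa [updateRow_ne h] using hF a b
end Calculus

/-! ### The Levi-Civita connection -/

section Connection
variable {g : Point → Matrix (Fin 4) (Fin 4) ℝ} {p : Point}

/-- The matrix `(Γ^ν_{αβ})_{νβ}`. -/
noncomputable def christoffelMatrix (g : Point → Matrix (Fin 4) (Fin 4) ℝ) (p : Point)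
    (α : Fin 4) : Matrix (Fin 4) (Fin 4) ℝ :=
  Matrix.of fun ν β => christoffel g p ν α β

/-- The metric near a point of the patch. -/
structure MetricAt (g : Point → Matrix (Fin 4) (Fin 4) ℝ) (p : Point) : Prop where
  diff : MatDiff g p
  symm : ∀ᶠ q in 𝓝 p, (g q).IsSymm
  unit : ∀ᶠ q in 𝓝 p, IsUnit (g q).det

lemma MetricAt.transpose_eq (h : MetricAt g p) : (g p)ᵀ = g p := h.symm.self_of_nhds

lemma MetricAt.isUnit (h : MetricAt g p) : IsUnit (g p).det := h.unit.self_of_nhds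

/-- Metric compatibility, `∇g = 0`. -/
lemma MetricAt.matD_metric (h : MetricAt g p) (α : Fin 4) :
    matD g p α = g p * christoffelMatrix g p α + (christoffelMatrix g p α)ᵀ * g p := by
  have hlow : ∀ μ ν, (g p * christoffelMatrix g p α) μ ν = 1 / 2 *
      (partialD (fun q => g q μ ν) p α + partialD (fun q => g q μ α) p ν
        - partialD (fun q => g q α ν) p μ) := by
    intro μ ν
    set w : Fin 4 → ℝ := fun σ => partialD (fun q => g q σ ν) p α
      + partialD (fun q => g q σ α) p ν - partialD (fun q => g q α ν) p σ
    have h1 : (fun κ => christoffelMatrix g p α κ ν) = (1 / 2 : ℝ) • ((g p)⁻¹ *ᵥ w) := by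
      ext κ
      simp [christoffelMatrix, christoffel, Matrix.mulVec, dotProduct, w]
    have h2 : (g p * christoffelMatrix g p α) μ ν
        = (g p *ᵥ fun κ => christoffelMatrix g p α κ ν) μ := rfl
    rw [h2, h1, mulVec_smul, mulVec_mulVec, mul_nonsing_inv _ h.isUnit, one_mulVec]
    rfl
  have hT : (christoffelMatrix g p α)ᵀ * g p = (g p * christoffelMatrix g p α)ᵀ := by
    rw [transpose_mul, h.transpose_eq]
  have hsymm : ∀ μ ν β, partialD (fun q => g q μ ν) p β = partialD (fun q => g q ν μ) p β :=
    fun μ ν β => partialD_congr (h.symm.mono fun q hq => hq.apply ν μ)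
  ext μ ν
  rw [hT, Matrix.add_apply, transpose_apply, hlow, hlow, hsymm ν μ α, hsymm ν α μ, hsymm μ α ν]
  simp only [matD, of_apply]
  ring

/-- The covariant derivative `∇_α` of a contravariant 2-tensor, as a matrix. -/
noncomputable def covMat (g : Point → Matrix (Fin 4) (Fin 4) ℝ)
    (S : Point → Matrix (Fin 4) (Fin 4) ℝ) (p : Point) (α : Fin 4) : Matrix (Fin 4) (Fin 4) ℝ :=
  matD S p α + christoffelMatrix g p α * S p + S p * (christoffelMatrix g p α)ᵀ

/-- The covariant derivative `∇_α` of a vector, as a column. -/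
noncomputable def covCol (g : Point → Matrix (Fin 4) (Fin 4) ℝ)
    (X : Point → Matrix (Fin 4) (Fin 1) ℝ) (p : Point) (α : Fin 4) : Matrix (Fin 4) (Fin 1) ℝ :=
  matD X p α + christoffelMatrix g p α * X p

lemma covMat_apply (S : Point → Matrix (Fin 4) (Fin 4) ℝ) (α μ ν : Fin 4) :
    covMat g S p α μ ν = covTen g (fun q μ ν => S q μ ν) p α μ ν := by
  simp only [covMat, covTen, Matrix.add_apply, Matrix.mul_apply, transpose_apply, matD, of_apply,
    christoffelMatrix, Finset.sum_add_distrib]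
  rw [add_assoc]
  congr 2
  exact Finset.sum_congr rfl fun _ _ => mul_comm _ _

lemma covCol_apply (X : Point → Matrix (Fin 4) (Fin 1) ℝ) (α ν : Fin 4) :
    covCol g X p α ν 0 = covVec g (fun q ν => X q ν 0) p α ν := by
  simp only [covCol, covVec, Matrix.add_apply, Matrix.mul_apply, matD, of_apply,
    christoffelMatrix]

/-- `∇g⁻¹ = 0`. -/
lemma MetricAt.covMat_inv (h : MetricAt g p) (α : Fin 4) : covMat g (fun q => (g q)⁻¹) p α = 0 := by
  have hd : matD (fun q => g q * (g q)⁻¹) p α = 0 := by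
    rw [matD_congr (h.unit.mono fun q hq => mul_nonsing_inv _ hq), matD_const]
  rw [matD_mul h.diff (h.diff.inv h.isUnit), h.matD_metric] at hd
  have h1 := congrArg (fun X => (g p)⁻¹ * X) hd
  simp only [Matrix.mul_add, Matrix.add_mul, Matrix.mul_assoc, Matrix.mul_zero] at h1
  rw [mul_nonsing_inv _ h.isUnit, Matrix.mul_one, ← Matrix.mul_assoc, ← Matrix.mul_assoc _ (g p),
    nonsing_inv_mul _ h.isUnit, Matrix.one_mul, Matrix.one_mul] at h1
  rw [covMat]
  rw [← h1]
  abel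
end Connection

/-! ### Covariant derivatives of products -/

section Leibniz
variable {g : Point → Matrix (Fin 4) (Fin 4) ℝ} {p : Point}

lemma covTen_add {S T : Point → Fin 4 → Fin 4 → ℝ} {α μ ν : Fin 4}
    (hS : DifferentiableAt ℝ (fun q => S q μ ν) p) (hT : DifferentiableAt ℝ (fun q => T q μ ν) p) :
    covTen g (fun q μ ν => S q μ ν + T q μ ν) p α μ ν
      = covTen g S p α μ ν + covTen g T p α μ ν := by
  simp only [covTen]
  rw [partialD_add hS hT, add_add_add_comm, ← Finset.sum_add_distrib]
  congr 1
  exact Finset.sum_congr rfl fun _ _ => by ring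

lemma covTen_mul {f : Point → ℝ} {S : Point → Fin 4 → Fin 4 → ℝ} {α μ ν : Fin 4}
    (hf : DifferentiableAt ℝ f p) (hS : DifferentiableAt ℝ (fun q => S q μ ν) p) :
    covTen g (fun q μ ν => f q * S q μ ν) p α μ ν
      = partialD f p α * S p μ ν + f p * covTen g S p α μ ν := by
  simp only [covTen]
  rw [partialD_mul hf hS, mul_add, Finset.mul_sum, add_assoc]
  congr 2
  exact Finset.sum_congr rfl fun _ _ => by ring

lemma covTen_prod {X Y : Point → Fin 4 → ℝ} {α μ ν : Fin 4}
    (hX : DifferentiableAt ℝ (fun q => X q μ) p) (hY : DifferentiableAt ℝ (fun q => Y q ν) p) :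
    covTen g (fun q μ ν => X q μ * Y q ν) p α μ ν
      = covVec g X p α μ * Y p ν + X p μ * covVec g Y p α ν := by
  simp only [covTen, covVec]
  rw [partialD_mul hX hY, add_mul, mul_add, Finset.mul_sum, Finset.sum_mul, add_add_add_comm,
    ← Finset.sum_add_distrib]
  congr 1
  exact Finset.sum_congr rfl fun _ _ => by ring

lemma covVec_mul {f : Point → ℝ} {X : Point → Fin 4 → ℝ} {α ν : Fin 4}
    (hf : DifferentiableAt ℝ f p) (hX : DifferentiableAt ℝ (fun q => X q ν) p) :
    covVec g (fun q ν => f q * X q ν) p α ν = partialD f p α * X p ν + f p * covVec g X p α ν := by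
  simp only [covVec]
  rw [partialD_mul hf hX, mul_add, Finset.mul_sum, add_assoc]
  congr 2
  exact Finset.sum_congr rfl fun _ _ => by ring
end Leibniz

/-! ### Derivatives of the constraints -/

section Constraint
variable {g : Point → Matrix (Fin 4) (Fin 4) ℝ} {U : Point → State} {p : Point}

/-- `u` as a column. -/
def velCol (s : State) : Matrix (Fin 4) (Fin 1) ℝ := Matrix.of fun ν _ => s (.vel ν)

/-- `π` as a matrix. -/
def shearMatrix (s : State) : Matrix (Fin 4) (Fin 4) ℝ := Matrix.of fun μ ν => s (.shear μ ν)

/-- The fields near a point of the patch. -/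
structure FieldsAt (g : Point → Matrix (Fin 4) (Fin 4) ℝ) (U : Point → State) (p : Point) :
    Prop where
  metric : MetricAt g p
  diff : DifferentiableAt ℝ U p
  constr : ∀ᶠ q in 𝓝 p, Constraints (g q) (U q)

lemma FieldsAt.diff_comp (h : FieldsAt g U p) (J : Comp) : DifferentiableAt ℝ (fun q => U q J) p :=
  differentiableAt_pi.mp h.diff J

lemma FieldsAt.matDiff_vel (h : FieldsAt g U p) : MatDiff (fun q => velCol (U q)) p :=
  fun _ _ => h.diff_comp _

lemma FieldsAt.matDiff_shear (h : FieldsAt g U p) : MatDiff (fun q => shearMatrix (U q)) p :=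
  fun _ _ => h.diff_comp _

lemma Constraints.vel_mul {G : Matrix (Fin 4) (Fin 4) ℝ} {s : State} (h : Constraints G s) :
    (velCol s)ᵀ * (G * velCol s) = -1 := by
  ext i j
  fin_cases i
  fin_cases j
  have := h.1
  simp only [velLow] at this
  simp only [Matrix.mul_apply, velCol, transpose_apply, of_apply]
  simp only [mul_comm] at this ⊢
  simpa using this

lemma Constraints.shear_transpose {G : Matrix (Fin 4) (Fin 4) ℝ} {s : State}
    (h : Constraints G s) : (shearMatrix s)ᵀ = shearMatrix s := by
  ext μ ν
  exact h.2.1 ν μ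

lemma Constraints.shear_mul {G : Matrix (Fin 4) (Fin 4) ℝ} {s : State} (h : Constraints G s) :
    shearMatrix s * (G * velCol s) = 0 := by
  ext μ j
  rw [Matrix.mul_apply, Matrix.zero_apply, ← h.2.2.1 μ]
  refine Finset.sum_congr rfl fun β _ => ?_
  simp only [shearMatrix, of_apply, Matrix.mul_apply, velCol, velLow]
  rw [h.2.1, mul_comm]

lemma Constraints.trace_shear {G : Matrix (Fin 4) (Fin 4) ℝ} {s : State} (h : Constraints G s) :
    (shearMatrix s * G).trace = 0 := by
  rw [← h.2.2.2]
  rfl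

/-- `u_ν ∇_α u^ν = 0`. -/
lemma FieldsAt.vel_mul_cov (h : FieldsAt g U p) (α : Fin 4) :
    (covCol g (fun q => velCol (U q)) p α)ᵀ * (g p * velCol (U p)) = 0 := by
  have hd : matD (fun q => (velCol (U q))ᵀ * (g q * velCol (U q))) p α = 0 := by
    rw [matD_congr (h.constr.mono fun q hq => hq.vel_mul), matD_const]
  rw [matD_mul h.matDiff_vel.transpose (h.metric.diff.mul h.matDiff_vel), matD_transpose,
    matD_mul h.metric.diff h.matDiff_vel, h.metric.matD_metric] at hd
  set X := (covCol g (fun q => velCol (U q)) p α)ᵀ * (g p * velCol (U p)) with hX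
  have hXX : X + Xᵀ = 0 := by
    rw [← hd, hX]
    simp only [covCol, transpose_mul, transpose_add, transpose_transpose, h.metric.transpose_eq,
      Matrix.mul_add, Matrix.add_mul, Matrix.mul_assoc]
    abel
  ext i j
  fin_cases i
  fin_cases j
  have := congrFun (congrFun hXX 0) 0
  simp only [Matrix.add_apply, transpose_apply, Matrix.zero_apply] at this
  show X 0 0 = 0
  linarith

/-- `u_ν ∇_α π^{μν} = -π^{μν} ∇_α u_ν`. -/
lemma FieldsAt.covMat_shear_mul (h : FieldsAt g U p) (α : Fin 4) :
    covMat g (fun q => shearMatrix (U q)) p α * (g p * velCol (U p))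
      = -(shearMatrix (U p) * (g p * covCol g (fun q => velCol (U q)) p α)) := by
  have hd : matD (fun q => shearMatrix (U q) * (g q * velCol (U q))) p α = 0 := by
    rw [matD_congr (h.constr.mono fun q hq => hq.shear_mul), matD_const]
  rw [matD_mul h.matDiff_shear (h.metric.diff.mul h.matDiff_vel),
    matD_mul h.metric.diff h.matDiff_vel, h.metric.matD_metric] at hd
  have h0 : christoffelMatrix g p α * (shearMatrix (U p) * (g p * velCol (U p))) = 0 := by
    rw [h.constr.self_of_nhds.shear_mul, Matrix.mul_zero]
  rw [eq_neg_iff_add_eq_zero, ← hd]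
  simp only [covMat, covCol, Matrix.mul_add, Matrix.add_mul, Matrix.mul_assoc]
  rw [h0]
  abel

lemma FieldsAt.covMat_shear_transpose (h : FieldsAt g U p) (α : Fin 4) :
    (covMat g (fun q => shearMatrix (U q)) p α)ᵀ = covMat g (fun q => shearMatrix (U q)) p α := by
  have hd : (matD (fun q => shearMatrix (U q)) p α)ᵀ = matD (fun q => shearMatrix (U q)) p α := by
    rw [← matD_transpose]
    exact matD_congr (h.constr.mono fun q hq => hq.shear_transpose)
  simp only [covMat, transpose_add, transpose_mul, transpose_transpose, hd,
    h.constr.self_of_nhds.shear_transpose]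
  abel

lemma FieldsAt.trace_covMat_shear (h : FieldsAt g U p) (α : Fin 4) :
    (covMat g (fun q => shearMatrix (U q)) p α * g p).trace = 0 := by
  have htr : ∀ F : Point → Matrix (Fin 4) (Fin 4) ℝ, MatDiff F p →
      (matD F p α).trace = partialD (fun q => (F q).trace) p α := by
    intro F hF
    simp only [Matrix.trace, diag_apply]
    rw [partialD_sum fun i _ => hF i i]
    rfl
  have hd : (matD (fun q => shearMatrix (U q) * g q) p α).trace = 0 := by
    rw [htr _ (h.matDiff_shear.mul h.metric.diff),
      partialD_congr (h.constr.mono fun q hq => hq.trace_shear), partialD_const]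
  rw [matD_mul h.matDiff_shear h.metric.diff, h.metric.matD_metric] at hd
  rw [← hd]
  simp only [covMat, Matrix.mul_add, Matrix.add_mul, Matrix.mul_assoc, trace_add]
  rw [trace_mul_comm (christoffelMatrix g p α), Matrix.mul_assoc]
  ring
end Constraint
end IsraelStewart

namespace IsraelStewart
open Matrix Filter Topology

/-! ### Projections -/

section Projection
variable {G : Matrix (Fin 4) (Fin 4) ℝ} {s : State}

/-- `Δ^μ_ν` as a matrix. -/
def projMatrix (G : Matrix (Fin 4) (Fin 4) ℝ) (s : State) : Matrix (Fin 4) (Fin 4) ℝ :=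
  1 + velCol s * (G * velCol s)ᵀ

/-- `Δ^{μν}` as a matrix. -/
noncomputable def projUpMatrix (G : Matrix (Fin 4) (Fin 4) ℝ) (s : State) :
    Matrix (Fin 4) (Fin 4) ℝ :=
  G⁻¹ + velCol s * (velCol s)ᵀ

lemma lowCol_apply (ν : Fin 4) (j : Fin 1) : (G * velCol s) ν j = velLow G s ν := by
  simp [Matrix.mul_apply, velCol, velLow]

lemma projMix_eq (μ ν : Fin 4) : projMix G s μ ν = projMatrix G s μ ν := by
  rw [projMatrix, Matrix.add_apply, Matrix.mul_apply, Fin.sum_univ_one, transpose_apply,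
    lowCol_apply]
  rfl

lemma projUp_eq (μ ν : Fin 4) : projUp G s μ ν = projUpMatrix G s μ ν := by
  simp [projUp, projUpMatrix, Matrix.mul_apply, velCol]

lemma shearMix_eq (μ ν : Fin 4) : shearMix G s μ ν = (shearMatrix s * G) μ ν := by
  simp [shearMix, shearMatrix, Matrix.mul_apply]

lemma projLow_eq (μ ν : Fin 4) :
    projLow G s μ ν = (G + G * velCol s * (G * velCol s)ᵀ) μ ν := by
  rw [Matrix.add_apply, Matrix.mul_apply]
  simp [projLow, lowCol_apply]

lemma sum_projTraceless (hG : Gᵀ = G) (X : Matrix (Fin 4) (Fin 4) ℝ) (μ ν : Fin 4) :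
    ∑ β, ∑ γ, projTraceless G s μ ν β γ * X β γ
      = 1 / 2 * ((projMatrix G s * X * (projMatrix G s)ᵀ) μ ν
          + (projMatrix G s * X * (projMatrix G s)ᵀ) ν μ)
        - 1 / 3 * projUp G s μ ν
          * ((G * X).trace + ((G * velCol s)ᵀ * (X * (G * velCol s))).trace) := by
  have h1 : ∀ μ ν, (projMatrix G s * X * (projMatrix G s)ᵀ) μ ν
      = ∑ β, ∑ γ, projMix G s μ β * projMix G s ν γ * X β γ := by
    intro μ ν
    simp only [Matrix.mul_apply, Finset.sum_mul, transpose_apply, projMix_eq]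
    rw [Finset.sum_comm]
    exact Finset.sum_congr rfl fun _ _ => Finset.sum_congr rfl fun _ _ => by ring
  have h2 : (G * X).trace + ((G * velCol s)ᵀ * (X * (G * velCol s))).trace
      = ∑ β, ∑ γ, projLow G s β γ * X β γ := by
    have h3 : ((G * velCol s)ᵀ * (X * (G * velCol s))).trace
        = (G * velCol s * (G * velCol s)ᵀ * X).trace := by
      rw [trace_mul_comm, Matrix.mul_assoc, trace_mul_comm]
    have h4 : (G + G * velCol s * (G * velCol s)ᵀ)ᵀ = G + G * velCol s * (G * velCol s)ᵀ := by
      rw [transpose_add, hG, transpose_mul (G * velCol s), transpose_transpose]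
    rw [h3, ← trace_add, ← Matrix.add_mul, ← h4]
    simp only [Matrix.trace, diag_apply, Matrix.mul_apply, transpose_apply, projLow_eq]
    rw [Finset.sum_comm]
  rw [h2, h1, h1, mul_add, mul_assoc, Finset.mul_sum, Finset.mul_sum, Finset.mul_sum,
    Finset.mul_sum, ← Finset.sum_add_distrib, ← Finset.sum_sub_distrib]
  refine Finset.sum_congr rfl fun β _ => ?_
  rw [Finset.mul_sum, Finset.mul_sum, Finset.mul_sum, Finset.mul_sum,
    ← Finset.sum_add_distrib, ← Finset.sum_sub_distrib]
  refine Finset.sum_congr rfl fun γ _ => ?_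
  rw [projTraceless]
  ring

lemma lowCol_mul_inv (hG : Gᵀ = G) (hu : IsUnit G.det) :
    (G * velCol s)ᵀ * G⁻¹ = (velCol s)ᵀ := by
  rw [transpose_mul, hG, Matrix.mul_assoc, mul_nonsing_inv _ hu, Matrix.mul_one]

lemma projMatrix_mul_inv (hG : Gᵀ = G) (hu : IsUnit G.det) :
    projMatrix G s * G⁻¹ = projUpMatrix G s := by
  rw [projMatrix, Matrix.add_mul, Matrix.one_mul, Matrix.mul_assoc, lowCol_mul_inv hG hu,
    projUpMatrix]

lemma mul_projMatrix_transpose {X : Matrix (Fin 4) (Fin 4) ℝ} (hX : X * (G * velCol s) = 0) :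
    X * (projMatrix G s)ᵀ = X := by
  rw [projMatrix, transpose_add, transpose_mul, transpose_transpose, transpose_one,
    Matrix.mul_add, Matrix.mul_one, ← Matrix.mul_assoc, hX, Matrix.zero_mul, add_zero]

lemma projUpMatrix_transpose (hG : Gᵀ = G) : (projUpMatrix G s)ᵀ = projUpMatrix G s := by
  rw [projUpMatrix, transpose_add, transpose_mul, transpose_transpose, transpose_nonsing_inv, hG]

lemma projUpMatrix_mul_low (hu : IsUnit G.det) (h : Constraints G s) :
    projUpMatrix G s * (G * velCol s) = 0 := by
  rw [projUpMatrix, Matrix.add_mul, ← Matrix.mul_assoc, nonsing_inv_mul _ hu, Matrix.one_mul,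
    Matrix.mul_assoc, h.vel_mul, Matrix.mul_neg, Matrix.mul_one, add_neg_cancel]

lemma Constraints.low_mul_shear (h : Constraints G s) :
    (G * velCol s)ᵀ * shearMatrix s = 0 := by
  have := congrArg Matrix.transpose h.shear_mul
  rwa [transpose_mul, h.shear_transpose, transpose_zero] at this

lemma shear_mul_metric_mul_proj (hu : IsUnit G.det) (h : Constraints G s) :
    shearMatrix s * G * projUpMatrix G s = shearMatrix s := by
  rw [projUpMatrix, Matrix.mul_add, Matrix.mul_assoc _ _ G⁻¹, mul_nonsing_inv _ hu,
    Matrix.mul_one, ← Matrix.mul_assoc, Matrix.mul_assoc (shearMatrix s), h.shear_mul,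
    Matrix.zero_mul, add_zero]

/-- The shear tensor as a function of the matrix `W = (∇_α u^ν)`. -/
noncomputable def sigmaMatrix (G : Matrix (Fin 4) (Fin 4) ℝ) (s : State)
    (W : Matrix (Fin 4) (Fin 4) ℝ) : Matrix (Fin 4) (Fin 4) ℝ :=
  (1 / 2 : ℝ) • (projUpMatrix G s * W + (projUpMatrix G s * W)ᵀ)
    - (1 / 3 * W.trace) • projUpMatrix G s

variable {W : Matrix (Fin 4) (Fin 4) ℝ}

lemma sigmaMatrix_transpose (hG : Gᵀ = G) :
    (sigmaMatrix G s W)ᵀ = sigmaMatrix G s W := by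
  simp only [sigmaMatrix, transpose_sub, transpose_smul, transpose_add, transpose_transpose,
    projUpMatrix_transpose hG]
  rw [add_comm]

lemma sigmaMatrix_mul_low (hG : Gᵀ = G) (hu : IsUnit G.det) (h : Constraints G s)
    (hW : W * (G * velCol s) = 0) : sigmaMatrix G s W * (G * velCol s) = 0 := by
  rw [sigmaMatrix, Matrix.sub_mul, Matrix.smul_mul, Matrix.smul_mul, Matrix.add_mul, transpose_mul,
    projUpMatrix_transpose hG, Matrix.mul_assoc, hW, Matrix.mul_assoc,
    projUpMatrix_mul_low hu h]
  simp

lemma sum_projTraceless_inv_mul (hG : Gᵀ = G) (hu : IsUnit G.det)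
    (hW : W * (G * velCol s) = 0) (μ ν : Fin 4) :
    ∑ β, ∑ γ, projTraceless G s μ ν β γ * (G⁻¹ * W) β γ = sigmaMatrix G s W μ ν := by
  have h0 : G⁻¹ * W * (G * velCol s) = 0 := by rw [Matrix.mul_assoc, hW, Matrix.mul_zero]
  rw [sum_projTraceless hG, Matrix.mul_assoc _ (G⁻¹ * W), mul_projMatrix_transpose h0, h0,
    Matrix.mul_zero, trace_zero, ← Matrix.mul_assoc, ← Matrix.mul_assoc, projMatrix_mul_inv hG hu,
    mul_nonsing_inv _ hu, Matrix.one_mul, projUp_eq]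
  simp only [sigmaMatrix, Matrix.sub_apply, Matrix.smul_apply, Matrix.add_apply, transpose_apply,
    smul_eq_mul]
  ring

/-- `π^{αβ} σ_{αβ} = π^α_ν ∇_α u^ν`. -/
lemma trace_shear_sigma (hG : Gᵀ = G) (hu : IsUnit G.det) (h : Constraints G s) :
    (G * (shearMatrix s * G * sigmaMatrix G s W)).trace = (G * shearMatrix s * W).trace := by
  have h1 := shear_mul_metric_mul_proj hu h
  have h2 : (G * (shearMatrix s * G * (projUpMatrix G s * W)ᵀ)).trace
      = (G * shearMatrix s * W).trace := by
    have e : G * (shearMatrix s * G * (projUpMatrix G s * W)ᵀ)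
        = (projUpMatrix G s * W * (G * shearMatrix s * G))ᵀ := by
      simp only [transpose_mul, hG, h.shear_transpose, Matrix.mul_assoc]
    rw [e, trace_transpose, Matrix.mul_assoc, trace_mul_comm, Matrix.mul_assoc, Matrix.mul_assoc G,
      Matrix.mul_assoc G, h1, trace_mul_comm]
  have h3 : (G * shearMatrix s).trace = 0 := by rw [trace_mul_comm, h.trace_shear]
  rw [sigmaMatrix, Matrix.mul_sub, Matrix.mul_smul, Matrix.mul_smul, Matrix.mul_add, h1,
    Matrix.mul_sub, Matrix.mul_smul, Matrix.mul_smul, Matrix.mul_add, trace_sub, trace_smul,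
    trace_smul, trace_add, h2, h3, ← Matrix.mul_assoc (shearMatrix s * G), h1, ← Matrix.mul_assoc]
  simp only [smul_eq_mul]
  ring

lemma sum_projTraceless_shear_sigma (hG : Gᵀ = G) (hu : IsUnit G.det) (h : Constraints G s)
    (hW : W * (G * velCol s) = 0) (μ ν : Fin 4) :
    ∑ β, ∑ γ, projTraceless G s μ ν β γ * (shearMatrix s * G * sigmaMatrix G s W) β γ
      = 1 / 2 * ((shearMatrix s * G * sigmaMatrix G s W) μ ν
          + (shearMatrix s * G * sigmaMatrix G s W) ν μ)
        - 1 / 3 * projUp G s μ ν * (G * shearMatrix s * W).trace := by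
  have h0 : shearMatrix s * G * sigmaMatrix G s W * (G * velCol s) = 0 := by
    rw [Matrix.mul_assoc, sigmaMatrix_mul_low hG hu h hW, Matrix.mul_zero]
  have h1 : projMatrix G s * (shearMatrix s * G * sigmaMatrix G s W)
      = shearMatrix s * G * sigmaMatrix G s W := by
    rw [projMatrix, Matrix.add_mul, Matrix.one_mul, Matrix.mul_assoc (velCol s),
      ← Matrix.mul_assoc _ (shearMatrix s * G), ← Matrix.mul_assoc _ (shearMatrix s),
      h.low_mul_shear, Matrix.zero_mul, Matrix.zero_mul, Matrix.mul_zero, add_zero]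
  rw [sum_projTraceless hG, h0, h1, mul_projMatrix_transpose h0, trace_shear_sigma hG hu h]
  simp

/-- The projection of `u^α ∇_α π^{βγ}`, where `u_γ ∇_α π^{βγ} = -π^{βγ} ∇_α u_γ` is used in the form
`Y u = -π w` with `w^γ = u^α ∇_α u^γ`. -/
lemma sum_projTraceless_cov_shear (hG : Gᵀ = G) (h : Constraints G s)
    {Y : Matrix (Fin 4) (Fin 4) ℝ} {w : Matrix (Fin 4) (Fin 1) ℝ} (hYT : Yᵀ = Y)
    (htr : (Y * G).trace = 0) (hY : Y * (G * velCol s) = -(shearMatrix s * (G * w)))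
    (μ ν : Fin 4) :
    ∑ β, ∑ γ, projTraceless G s μ ν β γ * Y β γ
      = Y μ ν - (s (.vel μ) * (shearMatrix s * (G * w)) ν 0
          + s (.vel ν) * (shearMatrix s * (G * w)) μ 0) := by
  set z := shearMatrix s * (G * w) with hz
  have hzl : (G * velCol s)ᵀ * z = 0 := by
    rw [hz, ← Matrix.mul_assoc, h.low_mul_shear, Matrix.zero_mul]
  have hYl : (G * velCol s)ᵀ * Y = -zᵀ := by
    have := congrArg Matrix.transpose hY
    rwa [transpose_mul, hYT, transpose_neg] at this
  have hzl' : zᵀ * (G * velCol s) = 0 := by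
    have := congrArg Matrix.transpose hzl
    rwa [transpose_mul, transpose_transpose, transpose_zero] at this
  have hproj : projMatrix G s * Y * (projMatrix G s)ᵀ
      = Y - (velCol s * zᵀ + z * (velCol s)ᵀ) := by
    rw [projMatrix]
    generalize G * velCol s = l at *
    rw [transpose_add, transpose_one, transpose_mul, transpose_transpose,
      Matrix.add_mul, Matrix.one_mul, Matrix.mul_assoc (velCol s), hYl, Matrix.mul_add,
      Matrix.mul_one, Matrix.add_mul, ← Matrix.mul_assoc, hY, ← Matrix.mul_assoc (_ * _) l,
      Matrix.mul_assoc (velCol s), Matrix.neg_mul zᵀ, hzl']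
    simp only [Matrix.neg_mul, Matrix.mul_neg, neg_zero, Matrix.mul_zero, Matrix.zero_mul]
    abel
  have happ : ∀ μ ν, (Y - (velCol s * zᵀ + z * (velCol s)ᵀ)) μ ν
      = Y μ ν - (s (.vel μ) * z ν 0 + s (.vel ν) * z μ 0) := by
    intro μ ν
    simp only [Matrix.sub_apply, Matrix.add_apply, Matrix.mul_apply, Fin.sum_univ_one, velCol,
      of_apply, transpose_apply, Fin.isValue]
    ring
  have hsymm : Y ν μ = Y μ ν := congrFun (congrFun hYT μ) ν
  rw [sum_projTraceless hG, hproj, happ, happ, hsymm, hY, Matrix.mul_neg, hzl, trace_mul_comm, htr]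
  simp
  ring
end Projection
end IsraelStewart

namespace IsraelStewart
open Matrix Filter Topology

/-! ### The rows of the quasilinear system -/

section Equations
variable {M : Model} {g : Point → Matrix (Fin 4) (Fin 4) ℝ} {U : Point → State} {p : Point}

/-- `∇_α U`. -/
noncomputable def covState (g : Point → Matrix (Fin 4) (Fin 4) ℝ) (U : Point → State) (p : Point)
    (α : Fin 4) (J : Comp) : ℝ :=
  partialD (fun q => U q J) p α + (connection g p α *ᵥ U p) J

/-- The left-hand side of the row `I` of the quasilinear system without the relaxation term. -/
noncomputable def principalRow (M : Model) (g : Point → Matrix (Fin 4) (Fin 4) ℝ)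
    (U : Point → State) (p : Point) (I : Comp) : ℝ :=
  ∑ α, ∑ J, principal M (g p) p (U p) α I J * covState g U p α J

lemma quasilinearAt_iff : QuasilinearAt M g U p ↔
    ∀ I, principalRow M g U p I + (relaxation *ᵥ U p) I = 0 := by
  have h : ∑ α, (principal M (g p) p (U p) α).mulVec (fun J => partialD (fun q => U q J) p α)
      + (lowerOrder M g p (U p)).mulVec (U p)
      = fun I => principalRow M g U p I + (relaxation *ᵥ U p) I := by
    have h1 : ∀ α, principal M (g p) p (U p) α *ᵥ covState g U p α
        = (principal M (g p) p (U p) α).mulVec (fun J => partialD (fun q => U q J) p α)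
          + (principal M (g p) p (U p) α * connection g p α) *ᵥ U p := by
      intro α
      rw [← mulVec_mulVec, ← mulVec_add]
      rfl
    have h2 : principalRow M g U p
        = ∑ α, principal M (g p) p (U p) α *ᵥ covState g U p α := by
      ext I
      simp [principalRow, Matrix.mulVec, dotProduct]
    have h3 : (fun I => principalRow M g U p I + (relaxation *ᵥ U p) I)
        = principalRow M g U p + relaxation *ᵥ U p := rfl
    rw [h3, h2, lowerOrder, add_mulVec, sum_mulVec]
    simp only [h1, Finset.sum_add_distrib]
    rw [add_assoc]
  rw [QuasilinearAt, h]
  exact ⟨fun h I => congrFun h I, fun h => funext h⟩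

lemma covState_vel (α ν : Fin 4) : covState g U p α (.vel ν) = gradVel g U p α ν := by
  simp only [covState, gradVel, covVec, Matrix.mulVec, dotProduct]
  rw [sum_comp]
  simp [connection]

lemma covState_energy (α : Fin 4) :
    covState g U p α .energy = partialD (fun q => U q .energy) p α := by
  simp only [covState, Matrix.mulVec, dotProduct]
  rw [sum_comp]
  simp [connection]

lemma covState_baryon (α : Fin 4) :
    covState g U p α .baryon = partialD (fun q => U q .baryon) p α := by
  simp only [covState, Matrix.mulVec, dotProduct]
  rw [sum_comp]
  simp [connection]

lemma covState_bulk (α : Fin 4) :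
    covState g U p α .bulk = partialD (fun q => U q .bulk) p α := by
  simp only [covState, Matrix.mulVec, dotProduct]
  rw [sum_comp]
  simp [connection]

lemma covState_shear (α μ ν : Fin 4) : covState g U p α (.shear μ ν)
    = covTen g (fun q μ ν => U q (.shear μ ν)) p α μ ν := by
  simp only [covState, covTen, Matrix.mulVec, dotProduct]
  rw [sum_comp]
  simp [connection, Matrix.one_apply, add_mul, Finset.sum_add_distrib, ite_mul]

/-- `π^α_ν ∇_α u^ν`. -/
noncomputable def shearGrad (g : Point → Matrix (Fin 4) (Fin 4) ℝ) (U : Point → State)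
    (p : Point) : ℝ :=
  ∑ α, ∑ l, shearMix (g p) (U p) α l * gradVel g U p α l

lemma sum_sum_one_mul (F : Fin 4 → Fin 4 → ℝ) :
    ∑ α, ∑ l, (1 : Matrix (Fin 4) (Fin 4) ℝ) α l * F α l = ∑ α, F α α := by
  simp [Matrix.one_apply]

lemma principalRow_energy : principalRow M g U p .energy
    = ∑ α, U p (.vel α) * partialD (fun q => U q .energy) p α
      + enthalpy M (U p) * expansion g U p + shearGrad g U p := by
  have h := sum_sum_one_mul fun α l => gradVel g U p α l
  simp only [principalRow, sum_comp, principal, of_apply, covState_vel, covState_energy,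
    expansion, shearGrad, ← h, zero_mul, Finset.sum_const_zero, add_zero, add_mul,
    Finset.sum_add_distrib, Finset.mul_sum, mul_assoc]
  ring

lemma principalRow_baryon : principalRow M g U p .baryon
    = ∑ α, U p (.vel α) * partialD (fun q => U q .baryon) p α
      + U p .baryon * expansion g U p := by
  have h := sum_sum_one_mul fun α l => gradVel g U p α l
  simp only [principalRow, sum_comp, principal, of_apply, covState_vel, covState_baryon,
    expansion, ← h, zero_mul, zero_add, Finset.sum_const_zero, add_zero,
    Finset.sum_add_distrib, Finset.mul_sum, mul_assoc]
  ring

lemma principalRow_bulk : principalRow M g U p .bulk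
    = (M.transport p (U p)).tauBulk * ∑ α, U p (.vel α) * partialD (fun q => U q .bulk) p α
      + ((M.transport p (U p)).zeta + (M.transport p (U p)).deltaBulk * U p .bulk)
        * expansion g U p
      + (M.transport p (U p)).lamBulkShear * shearGrad g U p := by
  have h := sum_sum_one_mul fun α l => gradVel g U p α l
  simp only [principalRow, sum_comp, principal, of_apply, covState_vel, covState_bulk,
    expansion, shearGrad, ← h, zero_mul, zero_add, Finset.sum_const_zero, add_zero, add_mul,
    Finset.sum_add_distrib, Finset.mul_sum, mul_assoc]
  ring

lemma principalRow_vel (μ : Fin 4) : principalRow M g U p (.vel μ)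
    = enthalpy M (U p) * ∑ α, U p (.vel α) * gradVel g U p α μ
      - U p (.vel μ) * shearGrad g U p
      + ∑ α, projUp (g p) (U p) μ α * (dPdEnergy M (U p) * partialD (fun q => U q .energy) p α
          + dPdBaryon M (U p) * partialD (fun q => U q .baryon) p α
          + partialD (fun q => U q .bulk) p α)
      + ∑ α, covTen g (fun q μ ν => U q (.shear μ ν)) p α μ α := by
  have h1 : ∑ α, ∑ β, ∑ γ, (1 : Matrix (Fin 4) (Fin 4) ℝ) μ β
        * (1 : Matrix (Fin 4) (Fin 4) ℝ) α γ * covTen g (fun q μ ν => U q (.shear μ ν)) p α β γ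
      = ∑ α, covTen g (fun q μ ν => U q (.shear μ ν)) p α μ α := by
    simp [Matrix.one_apply]
  have h2 : ∑ α, ∑ l, U p (.vel α) * ((1 : Matrix (Fin 4) (Fin 4) ℝ) μ l * gradVel g U p α l)
      = ∑ α, U p (.vel α) * gradVel g U p α μ := by
    simp [Matrix.one_apply]
  simp only [principalRow, sum_comp, principal, of_apply, covState_vel, covState_energy,
    covState_baryon, covState_bulk, covState_shear, shearGrad, Finset.sum_add_distrib, ← h1, ← h2,
    sub_mul, Finset.sum_sub_distrib, mul_add, Finset.mul_sum, mul_assoc, mul_left_comm]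
  ring

lemma sum_sigmaCoeff (μ ν : Fin 4) :
    ∑ α, ∑ l, sigmaCoeff (g p) (U p) μ ν α l * gradVel g U p α l
      = sigmaMatrix (g p) (U p) (Matrix.of (gradVel g U p)) μ ν := by
  have h1 : ∀ μ ν, ∑ α, ∑ l, projUp (g p) (U p) μ α *
      ((1 : Matrix (Fin 4) (Fin 4) ℝ) ν l * gradVel g U p α l)
      = (projUpMatrix (g p) (U p) * Matrix.of (gradVel g U p)) μ ν := by
    intro μ ν
    rw [Matrix.mul_apply]
    simp [Matrix.one_apply, projUp_eq]
  have h2 := sum_sum_one_mul fun α l => gradVel g U p α l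
  simp only [sigmaMatrix, Matrix.sub_apply, Matrix.smul_apply, Matrix.add_apply, transpose_apply,
    smul_eq_mul, ← h1, Matrix.trace, diag_apply, of_apply, ← h2, sigmaCoeff, projUp_eq]
  simp only [sub_mul, add_mul, mul_add, Finset.sum_add_distrib, Finset.sum_sub_distrib,
    Finset.mul_sum, Finset.sum_mul]
  congr 1
  · congr 1 <;> exact Finset.sum_congr rfl fun _ _ => Finset.sum_congr rfl fun _ _ => by ring
  · exact Finset.sum_congr rfl fun _ _ => Finset.sum_congr rfl fun _ _ => by ring

lemma principalRow_shear (μ ν : Fin 4) : principalRow M g U p (.shear μ ν)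
    = (M.transport p (U p)).tauShear
        * (∑ α, U p (.vel α) * covTen g (fun q μ ν => U q (.shear μ ν)) p α μ ν
          - (U p (.vel μ) * ∑ l, shearMix (g p) (U p) ν l * ∑ α, U p (.vel α) * gradVel g U p α l
            + U p (.vel ν) * ∑ l, shearMix (g p) (U p) μ l
                * ∑ α, U p (.vel α) * gradVel g U p α l))
      + (2 * (M.transport p (U p)).eta + (M.transport p (U p)).lamShearBulk * U p .bulk)
        * sigmaMatrix (g p) (U p) (Matrix.of (gradVel g U p)) μ ν
      + (M.transport p (U p)).deltaShear * U p (.shear μ ν) * expansion g U p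
      + (M.transport p (U p)).tauShearShear *
        (1 / 2 * (∑ r, (shearMix (g p) (U p) μ r
              * sigmaMatrix (g p) (U p) (Matrix.of (gradVel g U p)) r ν
            + shearMix (g p) (U p) ν r
              * sigmaMatrix (g p) (U p) (Matrix.of (gradVel g U p)) r μ))
          - 1 / 3 * projUp (g p) (U p) μ ν * shearGrad g U p) := by
  obtain ⟨R, hR⟩ : ∃ R : Fin 4 → Fin 4 → ℝ, ∀ α l, R α l = ∑ r, (shearMix (g p) (U p) μ r
              * (sigmaCoeff (g p) (U p) r ν α l * gradVel g U p α l)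
            + shearMix (g p) (U p) ν r
              * (sigmaCoeff (g p) (U p) r μ α l * gradVel g U p α l)) := ⟨_, fun _ _ => rfl⟩
  have hterm : ∀ α l, principal M (g p) p (U p) α (.shear μ ν) (.vel l) * gradVel g U p α l
      = -(M.transport p (U p)).tauShear * U p (.vel μ)
          * (shearMix (g p) (U p) ν l * (U p (.vel α) * gradVel g U p α l))
        + -(M.transport p (U p)).tauShear * U p (.vel ν)
          * (shearMix (g p) (U p) μ l * (U p (.vel α) * gradVel g U p α l))
        + (2 * (M.transport p (U p)).eta + (M.transport p (U p)).lamShearBulk * U p .bulk)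
          * (sigmaCoeff (g p) (U p) μ ν α l * gradVel g U p α l)
        + (M.transport p (U p)).deltaShear * U p (.shear μ ν)
          * ((1 : Matrix (Fin 4) (Fin 4) ℝ) α l * gradVel g U p α l)
        + (M.transport p (U p)).tauShearShear * (1 / 2) * R α l
        + -(M.transport p (U p)).tauShearShear * (1 / 3) * projUp (g p) (U p) μ ν
          * (shearMix (g p) (U p) α l * gradVel g U p α l) := by
    intro α l
    have h : R α l
        = (∑ r, (shearMix (g p) (U p) μ r * sigmaCoeff (g p) (U p) r ν α l
            + shearMix (g p) (U p) ν r * sigmaCoeff (g p) (U p) r μ α l)) * gradVel g U p α l := by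
      rw [hR, Finset.sum_mul]
      exact Finset.sum_congr rfl fun _ _ => by ring
    rw [h]
    simp only [principal, of_apply]
    ring
  have h1 : ∀ ν, ∑ α, ∑ l, shearMix (g p) (U p) ν l * (U p (.vel α) * gradVel g U p α l)
      = ∑ l, shearMix (g p) (U p) ν l * ∑ α, U p (.vel α) * gradVel g U p α l := by
    intro ν
    rw [Finset.sum_comm]
    simp only [Finset.mul_sum]
  have h2 : ∑ α, ∑ l, R α l
      = ∑ r, (shearMix (g p) (U p) μ r
              * sigmaMatrix (g p) (U p) (Matrix.of (gradVel g U p)) r ν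
            + shearMix (g p) (U p) ν r
              * sigmaMatrix (g p) (U p) (Matrix.of (gradVel g U p)) r μ) := by
    simp only [hR, ← sum_sigmaCoeff, Finset.mul_sum, ← Finset.sum_add_distrib]
    rw [Finset.sum_congr rfl fun α _ => Finset.sum_comm, Finset.sum_comm]
  have h3 := sum_sum_one_mul fun α l => gradVel g U p α l
  have h4 : ∑ α, ∑ β, ∑ γ, principal M (g p) p (U p) α (.shear μ ν) (.shear β γ)
        * covTen g (fun q μ ν => U q (.shear μ ν)) p α β γ
      = (M.transport p (U p)).tauShear
        * ∑ α, U p (.vel α) * covTen g (fun q μ ν => U q (.shear μ ν)) p α μ ν := by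
    simp [principal, Matrix.one_apply, Finset.mul_sum, mul_assoc, ite_mul]
  have h5 : principalRow M g U p (.shear μ ν)
      = ∑ α, ∑ l, principal M (g p) p (U p) α (.shear μ ν) (.vel l) * gradVel g U p α l
        + ∑ α, ∑ β, ∑ γ, principal M (g p) p (U p) α (.shear μ ν) (.shear β γ)
          * covTen g (fun q μ ν => U q (.shear μ ν)) p α β γ := by
    simp only [principalRow, sum_comp, covState_vel, covState_shear, Finset.sum_add_distrib]
    simp [principal]
  rw [h5, h4]
  simp only [hterm, Finset.sum_add_distrib, ← Finset.mul_sum]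
  rw [h1, h1, sum_sigmaCoeff, h2, h3, shearGrad, expansion,
    Finset.sum_add_distrib]
  ring
end Equations
end IsraelStewart

namespace IsraelStewart
open Matrix Filter Topology

/-! ### The equations of motion and the quasilinear system -/

section Equivalence
variable {M : Model} {g : Point → Matrix (Fin 4) (Fin 4) ℝ} {U : Point → State} {p : Point}

lemma covCol_vel (α ν : Fin 4) (j : Fin 1) :
    covCol g (fun q => velCol (U q)) p α ν j = gradVel g U p α ν := by
  fin_cases j
  exact covCol_apply _ α ν

lemma covMat_shear (α μ ν : Fin 4) : covMat g (fun q => shearMatrix (U q)) p α μ ν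
    = covTen g (fun q μ ν => U q (.shear μ ν)) p α μ ν :=
  covMat_apply _ α μ ν

lemma FieldsAt.gradVel_mul_low (h : FieldsAt g U p) :
    Matrix.of (gradVel g U p) * (g p * velCol (U p)) = 0 := by
  ext α j
  have := congrFun (congrFun (h.vel_mul_cov α) 0) j
  rw [Matrix.mul_apply] at this ⊢
  simpa only [transpose_apply, covCol_vel, of_apply, Matrix.zero_apply] using this

lemma sigma_eq (h : FieldsAt g U p) (μ ν : Fin 4) :
    sigma g U p μ ν = sigmaMatrix (g p) (U p) (Matrix.of (gradVel g U p)) μ ν := by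
  rw [← sum_projTraceless_inv_mul h.metric.transpose_eq h.metric.isUnit h.gradVel_mul_low]
  rfl

lemma sigmaMix_eq (h : FieldsAt g U p) (μ ν : Fin 4) : sigmaMix g U p μ ν
    = (sigmaMatrix (g p) (U p) (Matrix.of (gradVel g U p)) * g p) μ ν := by
  simp only [sigmaMix, sigma_eq h, Matrix.mul_apply]

lemma shearGrad_eq (h : FieldsAt g U p) :
    shearGrad g U p = (g p * shearMatrix (U p) * Matrix.of (gradVel g U p)).trace := by
  have h1 : (g p * shearMatrix (U p)) = (shearMatrix (U p) * g p)ᵀ := by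
    rw [transpose_mul, h.metric.transpose_eq, h.constr.self_of_nhds.shear_transpose]
  rw [h1]
  simp only [shearGrad, shearMix_eq, Matrix.trace, diag_apply, Matrix.mul_apply (M := _ᵀ),
    transpose_apply, of_apply]
  rw [Finset.sum_comm]

lemma sum_shearMix_sigmaMix (h : FieldsAt g U p) :
    ∑ α, ∑ β, shearMix (g p) (U p) α β * sigmaMix g U p β α = shearGrad g U p := by
  rw [shearGrad_eq h, ← trace_shear_sigma h.metric.transpose_eq h.metric.isUnit
    h.constr.self_of_nhds, trace_mul_comm, Matrix.mul_assoc (_ * _)]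
  simp only [shearMix_eq, sigmaMix_eq h, Matrix.trace, diag_apply]
  exact Finset.sum_congr rfl fun α _ => (Matrix.mul_apply).symm

lemma partialD_pressure (h : FieldsAt g U p)
    (hP : DifferentiableAt ℝ M.pressure (U p .energy, U p .baryon)) (α : Fin 4) :
    DifferentiableAt ℝ (fun q => M.pressure (U q .energy, U q .baryon) + U q .bulk) p ∧
    partialD (fun q => M.pressure (U q .energy, U q .baryon) + U q .bulk) p α
      = dPdEnergy M (U p) * partialD (fun q => U q .energy) p α
          + dPdBaryon M (U p) * partialD (fun q => U q .baryon) p α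
          + partialD (fun q => U q .bulk) p α := by
  have hc := hP.hasFDerivAt.comp p
    ((h.diff_comp .energy).hasFDerivAt.prodMk (h.diff_comp .baryon).hasFDerivAt)
  have hd : DifferentiableAt ℝ (fun q => M.pressure (U q .energy, U q .baryon)) p :=
    hc.differentiableAt
  refine ⟨hd.add (h.diff_comp .bulk), ?_⟩
  rw [partialD_add hd (h.diff_comp .bulk)]
  congr 1
  have he : fderiv ℝ (fun q => M.pressure (U q .energy, U q .baryon)) p = _ := hc.fderiv
  simp only [partialD, he, dPdEnergy, dPdBaryon, ContinuousLinearMap.comp_apply,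
    ContinuousLinearMap.prod_apply]
  have hlin : ∀ (T : ℝ × ℝ →L[ℝ] ℝ) (x y : ℝ), T (x, y) = T (1, 0) * x + T (0, 1) * y := by
    intro T x y
    have hxy : ((x, y) : ℝ × ℝ) = x • (1, 0) + y • (0, 1) := by simp
    rw [hxy, map_add, map_smul, map_smul, smul_eq_mul, smul_eq_mul]
    ring
  exact hlin _ _ _

lemma covTen_stress (h : FieldsAt g U p)
    (hP : DifferentiableAt ℝ M.pressure (U p .energy, U p .baryon)) (β α ν : Fin 4) :
    covTen g (stress M g U) p β α ν
      = partialD (fun q => U q .energy) p β * (U p (.vel α) * U p (.vel ν))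
        + enthalpy M (U p) * (gradVel g U p β α * U p (.vel ν) + U p (.vel α) * gradVel g U p β ν)
        + (dPdEnergy M (U p) * partialD (fun q => U q .energy) p β
            + dPdBaryon M (U p) * partialD (fun q => U q .baryon) p β
            + partialD (fun q => U q .bulk) p β) * projUp (g p) (U p) α ν
        + covTen g (fun q μ ν => U q (.shear μ ν)) p β α ν := by
  obtain ⟨hd, hp⟩ := partialD_pressure h hP β
  have hu := fun ν => h.diff_comp (.vel ν)
  have hinv := h.metric.diff.inv h.metric.isUnit
  have hs : stress M g U = fun q μ ν =>
      ((U q .energy * (U q (.vel μ) * U q (.vel ν))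
        + (M.pressure (U q .energy, U q .baryon) + U q .bulk)
          * ((g q)⁻¹ μ ν + U q (.vel μ) * U q (.vel ν))) + U q (.shear μ ν)) := by
    ext q μ ν
    rw [stress, projUp]
    ring
  have h0 : covTen g (fun q μ ν => (g q)⁻¹ μ ν) p β α ν = 0 := by
    rw [← covMat_apply, h.metric.covMat_inv, Matrix.zero_apply]
  have huu := (hu α).fun_mul (hu ν)
  have hD := (hinv α ν).fun_add huu
  rw [hs, covTen_add (S := fun q μ ν => U q .energy * (U q (.vel μ) * U q (.vel ν))
        + (M.pressure (U q .energy, U q .baryon) + U q .bulk)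
          * ((g q)⁻¹ μ ν + U q (.vel μ) * U q (.vel ν)))
      (((h.diff_comp .energy).fun_mul huu).fun_add (hd.fun_mul hD)) (h.diff_comp _),
    covTen_add (S := fun q μ ν => U q .energy * (U q (.vel μ) * U q (.vel ν)))
      ((h.diff_comp .energy).fun_mul huu) (hd.fun_mul hD),
    covTen_mul (S := fun q μ ν => U q (.vel μ) * U q (.vel ν)) (h.diff_comp .energy) huu,
    covTen_mul (S := fun q μ ν => (g q)⁻¹ μ ν + U q (.vel μ) * U q (.vel ν)) hd hD,
    covTen_add (S := fun q μ ν => (g q)⁻¹ μ ν) (hinv α ν) huu,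
    covTen_prod (X := fun q μ => U q (.vel μ)) (hu α) (hu ν), h0, hp, projUp, enthalpy]
  simp only [gradVel]
  ring

/-- `∇_β T^{αβ}`. -/
lemma divergence_stress (h : FieldsAt g U p)
    (hP : DifferentiableAt ℝ M.pressure (U p .energy, U p .baryon)) (α : Fin 4) :
    ∑ β, covTen g (stress M g U) p β α β
      = (∑ β, U p (.vel β) * partialD (fun q => U q .energy) p β) * U p (.vel α)
        + enthalpy M (U p) * (∑ β, U p (.vel β) * gradVel g U p β α
            + expansion g U p * U p (.vel α))
        + ∑ β, projUp (g p) (U p) α β * (dPdEnergy M (U p) * partialD (fun q => U q .energy) p β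
            + dPdBaryon M (U p) * partialD (fun q => U q .baryon) p β
            + partialD (fun q => U q .bulk) p β)
        + ∑ β, covTen g (fun q μ ν => U q (.shear μ ν)) p β α β := by
  simp only [covTen_stress h hP, expansion, Fin.sum_univ_four]
  ring

/-- `u_α ∇_β T^{αβ}` is the energy row up to the sign. -/
lemma low_mul_divergence (h : FieldsAt g U p)
    (hP : DifferentiableAt ℝ M.pressure (U p .energy, U p .baryon)) :
    ∑ α, velLow (g p) (U p) α * ∑ β, covTen g (stress M g U) p β α β
      = -principalRow M g U p .energy := by
  have hs := h.constr.self_of_nhds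
  have h1 := hs.1
  have h2 : ∑ α, velLow (g p) (U p) α * ∑ β, U p (.vel β) * gradVel g U p β α = 0 := by
    simp only [Finset.mul_sum]
    rw [Finset.sum_comm]
    refine Finset.sum_eq_zero fun β _ => ?_
    have := congrFun (congrFun h.gradVel_mul_low β) 0
    rw [Matrix.mul_apply] at this
    simp only [lowCol_apply, of_apply, Matrix.zero_apply] at this
    rw [← mul_zero (U p (.vel β)), ← this, Finset.mul_sum]
    exact Finset.sum_congr rfl fun _ _ => by ring
  have h3 : ∀ x : Fin 4 → ℝ, ∑ α, velLow (g p) (U p) α * ∑ β, projUp (g p) (U p) α β * x β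
      = 0 := by
    intro x
    simp only [Finset.mul_sum]
    rw [Finset.sum_comm]
    refine Finset.sum_eq_zero fun β _ => ?_
    have hl : (g p * velCol (U p))ᵀ * projUpMatrix (g p) (U p) = 0 := by
      have := congrArg Matrix.transpose (projUpMatrix_mul_low h.metric.isUnit hs)
      rwa [transpose_mul, projUpMatrix_transpose h.metric.transpose_eq, transpose_zero] at this
    have := congrFun (congrFun hl 0) β
    rw [Matrix.mul_apply] at this
    simp only [lowCol_apply, transpose_apply, ← projUp_eq, Matrix.zero_apply] at this
    rw [← zero_mul (x β), ← this, Finset.sum_mul]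
    exact Finset.sum_congr rfl fun _ _ => by ring
  have h4 : ∑ α, velLow (g p) (U p) α
      * ∑ β, covTen g (fun q μ ν => U q (.shear μ ν)) p β α β = -shearGrad g U p := by
    simp only [Finset.mul_sum]
    rw [Finset.sum_comm, shearGrad, ← Finset.sum_neg_distrib]
    refine Finset.sum_congr rfl fun β _ => ?_
    have := congrFun (congrFun (h.covMat_shear_mul β) β) 0
    rw [Matrix.mul_apply, ← Matrix.mul_assoc, Matrix.neg_apply, Matrix.mul_apply] at this
    simp only [lowCol_apply, covCol_vel, ← shearMix_eq] at this
    rw [← this]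
    refine Finset.sum_congr rfl fun α _ => ?_
    have hsy := congrFun (congrFun (h.covMat_shear_transpose β) α) β
    rw [transpose_apply] at hsy
    rw [hsy, covMat_shear]
    ring
  rw [principalRow_energy]
  simp only [divergence_stress h hP, Fin.sum_univ_four (f := fun α => velLow (g p) (U p) α * _)]
    at h1 h2 h3 h4 ⊢
  have h3 := h3 fun β => dPdEnergy M (U p) * partialD (fun q => U q .energy) p β
            + dPdBaryon M (U p) * partialD (fun q => U q .baryon) p β
            + partialD (fun q => U q .bulk) p β
  linear_combination ((∑ β, U p (.vel β) * partialD (fun q => U q .energy) p β)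
    + enthalpy M (U p) * expansion g U p) * h1 + enthalpy M (U p) * h2 + h3 + h4

/-- `Δ^μ_α ∇_β T^{αβ}` is the momentum row. -/
lemma projMix_mul_divergence (h : FieldsAt g U p)
    (hP : DifferentiableAt ℝ M.pressure (U p .energy, U p .baryon)) (μ : Fin 4) :
    ∑ α, projMix (g p) (U p) μ α * ∑ β, covTen g (stress M g U) p β α β
      = principalRow M g U p (.vel μ) := by
  have h1 : ∀ N : Fin 4 → ℝ, ∑ α, projMix (g p) (U p) μ α * N α
      = N μ + U p (.vel μ) * ∑ α, velLow (g p) (U p) α * N α := by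
    intro N
    simp only [projMix, add_mul, Finset.sum_add_distrib, Finset.mul_sum, mul_assoc]
    simp [Matrix.one_apply]
  rw [h1, low_mul_divergence h hP, divergence_stress h hP, principalRow_energy,
    principalRow_vel]
  ring

lemma divergence_current (h : FieldsAt g U p) :
    ∑ α, covVec g (current U) p α α = principalRow M g U p .baryon := by
  have h1 : ∀ α, covVec g (current U) p α α
      = partialD (fun q => U q .baryon) p α * U p (.vel α) + U p .baryon * gradVel g U p α α :=
    fun α => covVec_mul (X := fun q ν => U q (.vel ν)) (h.diff_comp _) (h.diff_comp _)
  simp only [h1, principalRow_baryon, expansion, Finset.mul_sum, ← Finset.sum_add_distrib]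
  exact Finset.sum_congr rfl fun _ _ => by ring

lemma sum_projTraceless_material (h : FieldsAt g U p) (μ ν : Fin 4) :
    ∑ β, ∑ γ, projTraceless (g p) (U p) μ ν β γ *
        ∑ α, U p (.vel α) * covTen g (fun q β' γ' => U q (.shear β' γ')) p α β γ
      = ∑ α, U p (.vel α) * covTen g (fun q μ ν => U q (.shear μ ν)) p α μ ν
          - (U p (.vel μ) * ∑ l, shearMix (g p) (U p) ν l * ∑ α, U p (.vel α) * gradVel g U p α l
            + U p (.vel ν) * ∑ l, shearMix (g p) (U p) μ l
                * ∑ α, U p (.vel α) * gradVel g U p α l) := by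
  set Y := ∑ α, U p (.vel α) • covMat g (fun q => shearMatrix (U q)) p α with hY
  set w := ∑ α, U p (.vel α) • covCol g (fun q => velCol (U q)) p α with hw
  have hYT : Yᵀ = Y := by
    rw [hY, transpose_sum]
    exact Finset.sum_congr rfl fun α _ => by rw [transpose_smul, h.covMat_shear_transpose]
  have htr : (Y * g p).trace = 0 := by
    rw [hY, Finset.sum_mul, trace_sum]
    exact Finset.sum_eq_zero fun α _ => by
      rw [Matrix.smul_mul, trace_smul, h.trace_covMat_shear, smul_zero]
  have hYl : Y * (g p * velCol (U p)) = -(shearMatrix (U p) * (g p * w)) := by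
    rw [hY, hw, Matrix.sum_mul, Matrix.mul_sum, Matrix.mul_sum, ← Finset.sum_neg_distrib]
    exact Finset.sum_congr rfl fun α _ => by
      rw [Matrix.smul_mul, h.covMat_shear_mul, Matrix.mul_smul, Matrix.mul_smul, smul_neg]
  have hYapp : ∀ μ ν, Y μ ν
      = ∑ α, U p (.vel α) * covTen g (fun q μ ν => U q (.shear μ ν)) p α μ ν := by
    intro μ ν
    simp only [hY, Matrix.sum_apply, Matrix.smul_apply, covMat_shear, smul_eq_mul]
  have hwapp : ∀ μ, (shearMatrix (U p) * (g p * w)) μ 0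
      = ∑ l, shearMix (g p) (U p) μ l * ∑ α, U p (.vel α) * gradVel g U p α l := by
    intro μ
    rw [← Matrix.mul_assoc, Matrix.mul_apply]
    simp only [hw, Matrix.sum_apply, Matrix.smul_apply, covCol_vel, smul_eq_mul, shearMix_eq]
  have := sum_projTraceless_cov_shear h.metric.transpose_eq h.constr.self_of_nhds hYT htr hYl μ ν
  simpa only [hYapp, hwapp] using this

lemma sum_projTraceless_shear_sigmaMix (h : FieldsAt g U p) (μ ν : Fin 4) :
    ∑ β, ∑ γ, projTraceless (g p) (U p) μ ν β γ *
        ∑ α, U p (.shear α β) * sigmaMix g U p γ α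
      = 1 / 2 * (∑ r, (shearMix (g p) (U p) μ r
              * sigmaMatrix (g p) (U p) (Matrix.of (gradVel g U p)) r ν
            + shearMix (g p) (U p) ν r
              * sigmaMatrix (g p) (U p) (Matrix.of (gradVel g U p)) r μ))
          - 1 / 3 * projUp (g p) (U p) μ ν * shearGrad g U p := by
  have hs := h.constr.self_of_nhds
  set σ := sigmaMatrix (g p) (U p) (Matrix.of (gradVel g U p)) with hσ
  have hX : ∀ β γ, ∑ α, U p (.shear α β) * sigmaMix g U p γ α
      = (shearMatrix (U p) * g p * σ) β γ := by
    intro β γ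
    have h1 : shearMatrix (U p) * g p * σ = (shearMatrix (U p))ᵀ * (σ * g p)ᵀ := by
      rw [transpose_mul, hs.shear_transpose, h.metric.transpose_eq,
        sigmaMatrix_transpose h.metric.transpose_eq, Matrix.mul_assoc]
    rw [h1, Matrix.mul_apply]
    simp only [transpose_apply, sigmaMix_eq h, shearMatrix, of_apply, hσ]
  simp only [hX]
  rw [hσ, sum_projTraceless_shear_sigma h.metric.transpose_eq h.metric.isUnit hs
    h.gradVel_mul_low, ← shearGrad_eq h, Finset.sum_add_distrib]
  simp only [Matrix.mul_apply (M := shearMatrix (U p) * g p), shearMix_eq]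

lemma relaxation_mulVec (s : State) (I : Comp) :
    (relaxation *ᵥ s) I = match I with
      | .bulk => s .bulk
      | .shear μ ν => s (.shear μ ν)
      | _ => 0 := by
  rw [relaxation, mulVec_diagonal]
  cases I <;> simp

/-- The equations of motion are the quasilinear system, row by row. -/
theorem equationsOfMotionAt_iff (h : FieldsAt g U p)
    (hP : DifferentiableAt ℝ M.pressure (U p .energy, U p .baryon)) :
    EquationsOfMotionAt M g U p ↔ QuasilinearAt M g U p := by
  have hrows : (∀ I, principalRow M g U p I + (relaxation *ᵥ U p) I = 0) ↔
      principalRow M g U p .energy = 0 ∧ (∀ μ, principalRow M g U p (.vel μ) = 0) ∧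
      principalRow M g U p .baryon = 0 ∧ principalRow M g U p .bulk + U p .bulk = 0 ∧
      ∀ μ ν, principalRow M g U p (.shear μ ν) + U p (.shear μ ν) = 0 := by
    simp only [relaxation_mulVec]
    constructor
    · intro h
      exact ⟨by simpa using h .energy, fun μ => by simpa using h (.vel μ),
        by simpa using h .baryon, h .bulk, fun μ ν => h (.shear μ ν)⟩
    · rintro ⟨h1, h2, h3, h4, h5⟩ (_ | _ | _ | _ | _)
      · simpa using h2 _
      · simpa using h1
      · simpa using h3
      · exact h4
      · exact h5 _ _
  rw [quasilinearAt_iff, hrows, EquationsOfMotionAt, low_mul_divergence h hP,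
    divergence_current (M := M) h, sum_shearMix_sigmaMix h, neg_eq_zero]
  simp only [projMix_mul_divergence h hP, sum_projTraceless_material h,
    sum_projTraceless_shear_sigmaMix h, sigma_eq h]
  refine and_congr_right fun _ => and_congr_right fun _ => and_congr_right fun _ =>
    and_congr ?_ (forall_congr' fun μ => forall_congr' fun ν => ?_)
  · rw [principalRow_bulk, ← sub_eq_zero]
    refine Eq.congr_left ?_
    ring
  · rw [principalRow_shear, ← sub_eq_zero]
    refine Eq.congr_left ?_
    ring
end Equivalence
end IsraelStewart

namespace IsraelStewart
open Matrix Filter Topology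

/-! ### The theorem -/

lemma IsLorentzian.isUnit_det {g : Matrix (Fin 4) (Fin 4) ℝ} (h : IsLorentzian g) :
    IsUnit g.det := by
  obtain ⟨-, b, hb⟩ := h
  rw [isUnit_iff_ne_zero]
  intro h0
  have h1 := congrArg Matrix.det minkowski_mul_self
  rw [← hb] at h1
  simp [det_mul, h0] at h1

/-- The characteristic determinant in the normalized variables `x̂` and `v̂_a²`. -/
lemma Regular.charDet_div {M : Model} {g : Matrix (Fin 4) (Fin 4) ℝ} {p : Point} {s : State}
    {e : Fin 4 → Fin 4 → ℝ} {L : Fin 4 → ℝ} (h : Regular M g p s e L) (φ : Fin 4 → ℝ)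
    (hφ : spatialSq g s φ ≠ 0) :
    charDet M g p s φ / (√(spatialSq g s φ) ^ 23 * ∏ k : Fin 3, (enthalpy M s + L k.succ))
      = enthalpy M s * (M.transport p s).tauBulk * (M.transport p s).tauShear ^ 16
        * (freq s φ / √(spatialSq g s φ)) ^ 15
        * ((freq s φ / √(spatialSq g s φ)) ^ 2 - shearSpeedSq M p s L (directionSq g s e φ))
        * (cubicP3 M p s L (directionSq g s e φ)).toPoly.eval
            ((freq s φ / √(spatialSq g s φ)) ^ 2) := by
  have hsq : spatialSq g s φ = spaceSq (frameComp e φ) := h.frame.spatialSq_eq φ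
  have hw : directionSq g s e φ = cosSq (frameComp e φ) := by
    ext a
    rw [h.frame.directionSq_eq, hsq, cosSq]
  have hprod : (∏ k : Fin 3, (enthalpy M s + L k.succ)) ≠ 0 :=
    Finset.prod_ne_zero_iff.mpr fun _ _ => h.enthalpy_add_ne _
  rw [hw, h.frame.freq_eq, hsq, h.charDet_eq_mul (hsq ▸ hφ)]
  have hv : √(spaceSq (frameComp e φ)) ^ 2 = spaceSq (frameComp e φ) :=
    Real.sq_sqrt (spaceSq_nonneg _)
  have hv0 : √(spaceSq (frameComp e φ)) ≠ 0 := by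
    intro h0
    rw [h0] at hv
    exact hφ (by rw [hsq, ← hv]; norm_num)
  rw [div_pow (frameComp e φ 0) _ 2, hv, leadingCoeff, div_pow]
  have h4 : spaceSq (frameComp e φ) ^ 4 = √(spaceSq (frameComp e φ)) ^ 8 := by
    rw [← hv, Real.sqrt_sq (Real.sqrt_nonneg _)]
    ring
  rw [h4]
  generalize (cubicP3 M p s L (cosSq (frameComp e φ))).toPoly.eval _ = P3
  generalize frameComp e φ 0 ^ 2 / spaceSq (frameComp e φ) - _ = c
  field_simp
end IsraelStewart

/-- Causality of Israel-Stewart-type hydrodynamics with shear and bulk viscosity and a conserved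
baryon current, for a solution `U` on an open set `D` of a coordinate patch with metric `g`. -/
theorem theorem1 (M : Model) (D : Set Point) (hD : IsOpen D)
    (g : Point → Matrix (Fin 4) (Fin 4) ℝ)
    (hg : ∀ p ∈ D, IsLorentzian (g p))
    (hgdiff : ∀ μ ν, DifferentiableOn ℝ (fun p => g p μ ν) D)
    -- `x⁰` is a time coordinate
    (htime : ∀ p ∈ D, (g p)⁻¹ 0 0 < 0)
    (U : Point → State) (hU : DifferentiableOn ℝ U D)
    (hconstr : ∀ p ∈ D, Constraints (g p) (U p))
    (hP : ∀ p ∈ D, DifferentiableAt ℝ M.pressure (U p .energy, U p .baryon))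
    -- the basis of shear-stress eigenvectors and the eigenvalues `Λ_A`
    (e : Point → Fin 4 → Fin 4 → ℝ) (L : Point → Fin 4 → ℝ)
    (hframe : ∀ p ∈ D, IsEigenframe (g p) (U p) (e p) (L p))
    (htauBulk : ∀ p ∈ D, (M.transport p (U p)).tauBulk ≠ 0)
    (htauShear : ∀ p ∈ D, (M.transport p (U p)).tauShear ≠ 0)
    (hE : ∀ p ∈ D, ∀ A, enthalpy M (U p) + L p A ≠ 0) :
    -- the equations of motion are the quasilinear system `(𝔸^α ∂_α + 𝔹) U = 0`
    (∀ p ∈ D, EquationsOfMotionAt M g U p ↔ QuasilinearAt M g U p) ∧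
    -- the characteristic determinant
    (∀ p ∈ D, ∀ φ : Fin 4 → ℝ, spatialSq (g p) (U p) φ ≠ 0 →
      let v := Real.sqrt (spatialSq (g p) (U p) φ)
      let xhat := freq (U p) φ / v
      let w := directionSq (g p) (U p) (e p) φ
      charDet M (g p) p (U p) φ / (v ^ 23 * ∏ k : Fin 3, (enthalpy M (U p) + L p k.succ))
        = enthalpy M (U p) * (M.transport p (U p)).tauBulk * (M.transport p (U p)).tauShear ^ 16
          * xhat ^ 15 * (xhat ^ 2 - shearSpeedSq M p (U p) (L p) w)
          * (cubicP3 M p (U p) (L p) w).toPoly.eval (xhat ^ 2)) ∧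
    -- a solution propagates causally, on `D` or any part of it, if and only if the conditions hold
    ((∀ p ∈ D, QuasilinearAt M g U p) →
      ∀ S ⊆ D, ((∀ p ∈ S, CausalAt M (g p) p (U p)) ↔ ∀ p ∈ S, Conditions M p (U p) (L p))) := by
  have hmetric : ∀ p ∈ D, MetricAt g p := fun p hp =>
    ⟨fun μ ν => (hgdiff μ ν).differentiableAt (hD.mem_nhds hp),
      Filter.mem_of_superset (hD.mem_nhds hp) fun q hq => (hg q hq).1,
      Filter.mem_of_superset (hD.mem_nhds hp) fun q hq => (hg q hq).isUnit_det⟩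
  have hfields : ∀ p ∈ D, FieldsAt g U p := fun p hp =>
    ⟨hmetric p hp, hU.differentiableAt (hD.mem_nhds hp),
      Filter.mem_of_superset (hD.mem_nhds hp) hconstr⟩
  have hreg : ∀ p ∈ D, Regular M (g p) p (U p) (e p) (L p) := fun p hp =>
    ⟨hframe p hp, hconstr p hp, htauBulk p hp, htauShear p hp, hE p hp⟩
  exact ⟨fun p hp => equationsOfMotionAt_iff (hfields p hp) (hP p hp),
    fun p hp φ hφ => (hreg p hp).charDet_div φ hφ,
    fun _ S hS => forall₂_congr fun p hp =>
      (hreg p (hS hp)).causalAt_iff_conditions (htime p (hS hp))⟩
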